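/- Let $d\ge 2$, $0<T<\infty$, and let $\Omega$ be $\mathbb{R}^d$ or the torus $\mathbb{T}^d=\mathbb{R}^d/\mathbb{Z}^d$. Let $p\in[3,\infty]$, $\theta\in(0,\tfrac13)$, $\beta\in(0,1)$, and let $$v\in L^{p}\big((0,T);B^\theta_{3,\infty}(\Omega)\big)\cap L^{2p/3}\big((0,T);B^\beta_{2,\infty}(\Omega)\big)$$ be a weak (distributional) solution of the incompressible Euler equations $\partial_t v+\operatorname{div}(v\otimes v)+\nabla \pi=0$, $\operatorname{div} v=0$ on $\Omega\times(0,T)$. Here $\|f\|_{B^\theta_{q,\infty}}=\|f\|_{L^q}+\sup_{h\ne0}|h|^{-\theta}\|f(\cdot+h)-f\|_{L^q}$. Let $e_v(t)=\frac12\int_\Omega|v(x,t)|^2\,dx$ be the kinetic energy. For an open set $U\subset(0,T)$, say that $v$ is conservative on $U\times\Omega$ if $e_v'=0$ in $\mathcal{D}'(U)$, and that $v$ is non-conservative if it is not conservative on $(0,T)\times\Omega$. Suppose that $v$ is non-conservative, and that there is a (relatively) closed set $S_T\subset(0,T)$ such that $v$ is conservative on $\big((0,T)\setminus S_T\big)\times\Omega$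 and whose upper Minkowski dimension $$\gamma=\inf\Big\{s\ge0:\ \limsup_{\delta\to0^+}\frac{|\{t\in\mathbb{R}:\operatorname{dist}(t,S_T)\le\delta\}|}{\delta^{1-s}}=0\Big\}$$ satisfies $\gamma<1$. Then $$\frac{2\beta}{1-3\theta+2\beta}\le 1-\frac{p-3}{p}(1-\gamma),$$ or equivalently, when $p>3$, $$\gamma\ge 1-\frac{p}{p-3}\Big(1-\frac{2\beta}{1-3\theta+2\beta}\Big),$$ where $\frac{p-3}{p}=\frac{p}{p-3}=1$ if $p=\infty$. -/

import Mathlib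

open MeasureTheory Set Filter Topology
open scoped ENNReal

noncomputable section

namespace EulerTime

/-- The Euclidean space `ℝ^d`. -/
abbrev Space (d : ℕ) : Type := EuclideanSpace ℝ (Fin d)

/-- The two spatial domains: the whole space `ℝ^d` and the torus `𝕋^d = ℝ^d / ℤ^d`.
Functions on the torus are represented by `ℤ^d`-periodic functions on `ℝ^d`. -/
inductive Domain : Type
  | whole : Domain
  | torus : Domain

/-- A fundamental cell: all of `ℝ^d`, respectively the unit cube `[0,1)^d`. Integrals over the
domain are integrals over this cell. -/
def Domain.cell (Ω : Domain) (d : ℕ) : Set (Space d) :=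
  match Ω with
  | .whole => univ
  | .torus => {x | ∀ i, x i ∈ Ico (0 : ℝ) 1}

/-- `f` is a function on the domain: no condition on `ℝ^d`, and `ℤ^d`-periodicity on `𝕋^d`. -/
def Domain.IsFunctionOn {d : ℕ} {F : Type*} (Ω : Domain) (f : Space d → F) : Prop :=
  match Ω with
  | .whole => True
  | .torus => ∀ (k : Fin d → ℤ) (x : Space d),
      f (x + WithLp.toLp 2 (fun i => (k i : ℝ))) = f x

/-- The Lebesgue measure of the domain. -/
def Domain.measure (Ω : Domain) (d : ℕ) : Measure (Space d) :=
  volume.restrict (Ω.cell d)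

/-- The Besov seminorm `[f]_{B^θ_{q,∞}} = sup_{h ≠ 0} ‖f(· + h) - f‖_{L^q} / |h|^θ`. -/
def besovSeminorm {d : ℕ} (Ω : Domain) (θ : ℝ) (q : ℝ≥0∞) (f : Space d → Space d) : ℝ≥0∞ :=
  ⨆ (h : Space d) (_ : h ≠ 0),
    eLpNorm (fun x => f (x + h) - f x) q (Ω.measure d) / ENNReal.ofReal (‖h‖ ^ θ)

/-- The full Besov norm `‖f‖_{B^θ_{q,∞}} = ‖f‖_{L^q} + [f]_{B^θ_{q,∞}}`. -/
def besovNorm {d : ℕ} (Ω : Domain) (θ : ℝ) (q : ℝ≥0∞) (f : Space d → Space d) : ℝ≥0∞ :=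
  eLpNorm f q (Ω.measure d) + besovSeminorm Ω θ q f

/-- `v ∈ L^r((0,T); B^θ_{q,∞}(Ω))`: `v` is (a.e. equal to) a jointly measurable field on
`(0,T) × Ω`, and `t ↦ ‖v(t)‖_{B^θ_{q,∞}}` has finite `L^r(0,T)` norm. -/
structure MemLpBesov {d : ℕ} (Ω : Domain) (T : ℝ) (r : ℝ≥0∞) (θ : ℝ) (q : ℝ≥0∞)
    (v : ℝ → Space d → Space d) : Prop where
  isFunctionOn : ∀ t ∈ Ioo 0 T, Ω.IsFunctionOn (v t)
  aestronglyMeasurable : AEStronglyMeasurable (fun z : ℝ × Space d => v z.1 z.2)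
    (volume.restrict (Ioo 0 T ×ˢ univ))
  norm_lt_top : eLpNorm (fun t => besovNorm Ω θ q (v t)) r (volume.restrict (Ioo 0 T)) < ⊤

/-- `φ ∈ C_c^∞(Ω × (0,T); F)`. On the torus, compact support only restricts the time variable. -/
structure IsTestFunction {d : ℕ} {F : Type*} [NormedAddCommGroup F] [NormedSpace ℝ F]
    (Ω : Domain) (T : ℝ) (φ : ℝ → Space d → F) : Prop where
  isFunctionOn : ∀ t, Ω.IsFunctionOn (φ t)
  contDiff : ContDiff ℝ ((⊤ : ℕ∞) : WithTop ℕ∞) (fun z : ℝ × Space d => φ z.1 z.2)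
  time_support : ∃ K : Set ℝ, IsCompact K ∧ K ⊆ Ioo 0 T ∧ ∀ t ∉ K, ∀ x, φ t x = 0
  space_support : Ω = .whole → HasCompactSupport (fun z : ℝ × Space d => φ z.1 z.2)

/-- The divergence of a vector field on `ℝ^d`. -/
def divergence {d : ℕ} (w : Space d → Space d) (x : Space d) : ℝ :=
  ∑ i, fderiv ℝ w x (EuclideanSpace.single i 1) i

/-- Weak solutions of `∂_t v + div (v ⊗ v) + ∇p = 0`, `div v = 0` on `Ω × (0,T)`: locally square
integrable fields satisfying both equations in the sense of distributions, the pressure being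
eliminated by testing the momentum equation with divergence-free fields. -/
structure IsWeakEulerSolution {d : ℕ} (Ω : Domain) (T : ℝ) (v : ℝ → Space d → Space d) :
    Prop where
  isFunctionOn : ∀ t ∈ Ioo 0 T, Ω.IsFunctionOn (v t)
  memLp_loc : ∀ K : Set (ℝ × Space d), IsCompact K → K ⊆ Ioo 0 T ×ˢ univ →
    MemLp (fun z : ℝ × Space d => v z.1 z.2) 2 (volume.restrict K)
  /-- `∫∫ v · ∇ψ = 0` -/
  incompressible : ∀ ψ : ℝ → Space d → ℝ, IsTestFunction Ω T ψ →
    ∫ z in Ioo 0 T ×ˢ Ω.cell d, fderiv ℝ (ψ z.1) z.2 (v z.1 z.2) = 0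
  /-- `∫∫ v · ∂_t φ + (v ⊗ v) : ∇φ = 0` -/
  momentum : ∀ φ : ℝ → Space d → Space d, IsTestFunction Ω T φ →
    (∀ t x, divergence (φ t) x = 0) →
    ∫ z in Ioo 0 T ×ˢ Ω.cell d,
      (inner ℝ (v z.1 z.2) (deriv (fun s => φ s z.2) z.1)
        + inner ℝ (v z.1 z.2) (fderiv ℝ (φ z.1) z.2 (v z.1 z.2))) = 0

/-- The kinetic energy `e_v(t) = 1/2 ∫_Ω |v(x,t)|² dx`. -/
def kineticEnergy {d : ℕ} (Ω : Domain) (v : ℝ → Space d → Space d) (t : ℝ) : ℝ :=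
  (1 / 2) * ∫ x, ‖v t x‖ ^ 2 ∂(Ω.measure d)

/-- `v` is conservative on `U × Ω`, for an open set of times `U`: `e_v' = 0` in `𝒟'(U)`, that is
`⟨e_v', φ⟩ = - ∫ e_v φ' = 0` for every `φ ∈ C_c^∞(U)`. -/
def IsConservativeOn {d : ℕ} (Ω : Domain) (v : ℝ → Space d → Space d) (U : Set ℝ) : Prop :=
  ∀ φ : ℝ → ℝ, ContDiff ℝ ((⊤ : ℕ∞) : WithTop ℕ∞) φ → HasCompactSupport φ → tsupport φ ⊆ U →
    - ∫ t in U, kineticEnergy Ω v t * deriv φ t = 0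

/-- Conservative solutions on `(0,T)`: `e_v' = 0` in `𝒟'((0,T))`. -/
def IsConservative {d : ℕ} (Ω : Domain) (T : ℝ) (v : ℝ → Space d → Space d) : Prop :=
  IsConservativeOn Ω v (Ioo 0 T)

/-- The upper `s`-dimensional Minkowski content of `S ⊆ ℝ`,
`limsup_{δ → 0⁺} |{x : dist(x,S) ≤ δ}| / δ^{1-s}`. -/
def upperMinkowskiContent (s : ℝ) (S : Set ℝ) : ℝ≥0∞ :=
  limsup (fun δ : ℝ => volume (Metric.cthickening δ S) / ENNReal.ofReal (δ ^ (1 - s))) (𝓝[>] 0)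

/-- The upper Minkowski dimension of a bounded set `S ⊆ ℝ`. -/
def upperMinkowskiDim (S : Set ℝ) : ℝ :=
  sInf {s : ℝ | 0 ≤ s ∧ upperMinkowskiContent s S = 0}

/-- The number `(p - 3) / p` for `p ∈ [3,∞]`, equal to `1` for `p = ∞`. -/
def holderGap (p : ℝ≥0∞) : ℝ :=
  if p = ⊤ then 1 else (p.toReal - 3) / p.toReal

/-- The number `p / (p - 3)` for `p ∈ (3,∞]`, equal to `1` for `p = ∞`. -/
def holderConj (p : ℝ≥0∞) : ℝ :=
  if p = ⊤ then 1 else p.toReal / (p.toReal - 3)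

end EulerTime

end

open EulerTime

/-!
Energy can only be lost or gained on a set of times whose dimension is large, because a cutoff in
time near a small set costs less than the regularity of the field gains.

*Balance at scale `ℓ`.* Let `w` be the velocity field, and `k` an even mollifier at scale `ℓ` with
integral one. The correlations `corr2` and `corr3` of `w` at two times satisfy an equation in the
increment `z`, which at coinciding times and after averaging against `k` becomes a balance for the
regularized energy `∫ k(z) ∫ w(t, y + z) · w(t, y) dy dz`. The quadratic identity
`SpaceField.integral_mul_corr2_self` and the Duchon–Robert formula
`SpaceField.integral_fderiv_corr3_self` express the error of that energy and the flux by squares and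
cubes of increments of `w`. So, for a test function `ψ` of time
(`EulerField.enorm_integral_deriv_mul_lpEnergy_le` and `incrementEnergy_le`),
`|∫ ψ' ‖w‖²_{L²}| ≤ ∫ |ψ'| ℓ^{2β} ‖w‖²_{B^β_{2,∞}} + C ∫ |ψ| ℓ^{3θ-1} ‖w‖³_{B^θ_{3,∞}}`.

*Localization in time.* Energy variations are only seen near `S`, so `ψ` may be multiplied by a
cutoff at distance `δ` from `S` (`integral_kineticEnergy_mul_cutoff`), with derivative of size `1/δ`.
Hölder's inequality in time gives both terms a factor `|S_δ|^{1-3/p}`, where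
`|S_δ| ≤ δ^{1-s}` for `s` above the dimension. The choice `ℓ = δ^{1/(1-3θ+2β)}` makes the two terms
equal in size, namely `δ` to the power `(1-3/p)(1-s) - (1-3θ)/(1-3θ+2β)`. If the asserted inequality
failed, this exponent would be positive for some admissible `s`; letting `δ → 0`, the energy would be
conserved (`isConservative_of_content_eq_zero`).

*The balance without a pressure.* Since solutions are tested only with divergence-free fields, the
equation cannot be mollified directly: that would require Leray projection. Instead the momentum
equation, translated by `y`, is tested with the compactly supported divergence-free fields
`curlField k (w τ y) s`, that is `z ↦ (∇k · w(τ,y)) s - (∇k · s) w(τ,y)`, and integrated over `τ` and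
`y`. By incompressibility of `w(τ)` the first half does not contribute, and what is left is the
derivative in the direction `s` of the correlation equation
(`EulerField.integral_directional_kernel`). Hence the correlation functional is unchanged when its
increment is shifted (`EulerField.integral_pairDensity_shift`). On `ℝ^d` it tends to zero as the shift
goes to infinity, since correlations decay. On the torus it is averaged over all shifts, which leaves
the product of the means of `w(t)` and `w(τ)`, and the mean is conserved. Either way the functional
vanishes (`EulerField.integral_pairDensity`). The two times are then made to coincide, by continuity of
time translations in `L²` and `L³` (`EulerField.integral_balance_eq_zero`); symmetrizing the cutoff in
the two times removes the term in which the approximate identity in `t - τ` is differentiated.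
-/

noncomputable section

namespace EulerTime

/-! ### The lattice and the fundamental cell -/

/-- The embedding of `ℤ^d` into `ℝ^d`. -/
def latticeHom (d : ℕ) : (Fin d → ℤ) →+ Space d where
  toFun k := WithLp.toLp 2 (fun i => (k i : ℝ))
  map_zero' := by ext i; simp
  map_add' k l := by ext i; simp

@[simp] lemma latticeHom_apply {d : ℕ} (k : Fin d → ℤ) (i : Fin d) :
    latticeHom d k i = (k i : ℝ) := rfl

lemma latticeHom_injective (d : ℕ) : Function.Injective (latticeHom d) := by
  intro k l h
  funext i
  have := congrArg (fun x : Space d => x i) h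
  simpa using this

/-- The lattice `ℤ^d ⊆ ℝ^d`, acting on `ℝ^d` by translations. -/
abbrev lattice (d : ℕ) : AddSubgroup (Space d) := (latticeHom d).range

instance (d : ℕ) : Countable (lattice d) := by
  have : Countable (Set.range (latticeHom d)) := Set.countable_range _
  exact this

/-- The lattice vector carrying a point into the unit cube. -/
def cellShift {d : ℕ} (x : Space d) : Fin d → ℤ := fun i => -⌊x i⌋

lemma add_cellShift_mem {d : ℕ} (x : Space d) :
    x + latticeHom d (cellShift x) ∈ Domain.torus.cell d := by
  intro i
  have h0 := Int.floor_le (x i)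
  have h1 := Int.lt_floor_add_one (x i)
  simp only [PiLp.add_apply, latticeHom_apply, cellShift, Int.cast_neg, mem_Ico]
  constructor <;> linarith

lemma eq_cellShift {d : ℕ} {x : Space d} {k : Fin d → ℤ}
    (h : x + latticeHom d k ∈ Domain.torus.cell d) : k = cellShift x := by
  funext i
  have := h i
  simp only [PiLp.add_apply, latticeHom_apply, mem_Ico] at this
  simp only [cellShift]
  have : ⌊x i⌋ = -k i := by
    rw [Int.floor_eq_iff]
    push_cast
    constructor <;> linarith
  omega

lemma measurableSet_cell (Ω : Domain) (d : ℕ) : MeasurableSet (Ω.cell d) := by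
  cases Ω with
  | whole => exact MeasurableSet.univ
  | torus =>
    have : Domain.torus.cell d = ⋂ i : Fin d, (fun x : Space d => x i) ⁻¹' Ico (0 : ℝ) 1 := by
      ext x; simp [Domain.cell]
    rw [this]
    refine MeasurableSet.iInter fun i => ?_
    exact (by fun_prop : Measurable fun x : Space d => x i) measurableSet_Ico

lemma isAddFundamentalDomain_cell (d : ℕ) :
    IsAddFundamentalDomain (lattice d) (Domain.torus.cell d) (volume : Measure (Space d)) := by
  refine IsAddFundamentalDomain.mk' (measurableSet_cell _ _).nullMeasurableSet fun x => ?_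
  refine ⟨⟨latticeHom d (cellShift x), ⟨_, rfl⟩⟩, ?_, ?_⟩
  · have := add_cellShift_mem x
    rwa [add_comm] at this
  · rintro ⟨_, ⟨k, rfl⟩⟩ h
    have h' : x + latticeHom d k ∈ Domain.torus.cell d := by
      rw [add_comm]; exact h
    exact Subtype.ext (congrArg (latticeHom d) (eq_cellShift h'))

instance (Ω : Domain) (d : ℕ) : SigmaFinite (Ω.measure d) := by
  unfold Domain.measure; infer_instance

instance (Ω : Domain) (d : ℕ) : IsLocallyFiniteMeasure (Ω.measure d) := by
  unfold Domain.measure; infer_instance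

lemma norm_le_of_mem_cell {d : ℕ} {x : Space d} (hx : x ∈ Domain.torus.cell d) :
    ‖x‖ ≤ Real.sqrt d := by
  rw [EuclideanSpace.norm_eq]
  apply Real.sqrt_le_sqrt
  calc ∑ i, ‖x i‖ ^ 2 ≤ ∑ _i : Fin d, (1 : ℝ) := by
        refine Finset.sum_le_sum fun i _ => ?_
        have := hx i
        rw [Real.norm_eq_abs, sq_abs]
        have h0 := this.1
        have h1 := this.2.le
        nlinarith
    _ = d := by simp

lemma isFiniteMeasure_torus (d : ℕ) : IsFiniteMeasure (Domain.torus.measure d) := by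
  constructor
  rw [Domain.measure, Measure.restrict_apply_univ]
  refine lt_of_le_of_lt (measure_mono (t := Metric.closedBall 0 (Real.sqrt d)) fun x hx => ?_)
    measure_closedBall_lt_top
  simpa using norm_le_of_mem_cell hx

/-! ### Translation invariance -/

lemma Domain.IsFunctionOn.periodic {d : ℕ} {F : Type*} {f : Space d → F}
    (hf : Domain.torus.IsFunctionOn f) (k : Fin d → ℤ) (x : Space d) :
    f (x + latticeHom d k) = f x := hf k x

lemma Domain.IsFunctionOn.translate {Ω : Domain} {d : ℕ} {F : Type*} {f : Space d → F}
    (hf : Ω.IsFunctionOn f) (h : Space d) : Ω.IsFunctionOn (fun x => f (x + h)) := by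
  cases Ω with
  | whole => trivial
  | torus =>
    intro k x
    have := hf k (x + h)
    simp only [← this]
    congr 1
    abel

lemma Domain.IsFunctionOn.comp {Ω : Domain} {d : ℕ} {F G : Type*} {f : Space d → F}
    (hf : Ω.IsFunctionOn f) (φ : F → G) : Ω.IsFunctionOn (fun x => φ (f x)) := by
  cases Ω with
  | whole => trivial
  | torus =>
    intro k x
    simp only [hf k x]

lemma Domain.IsFunctionOn.comp₂ {Ω : Domain} {d : ℕ} {F G H : Type*} {f : Space d → F}
    {g : Space d → G} (hf : Ω.IsFunctionOn f) (hg : Ω.IsFunctionOn g) (φ : F → G → H) :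
    Ω.IsFunctionOn (fun x => φ (f x) (g x)) := by
  cases Ω with
  | whole => trivial
  | torus =>
    intro k x
    simp only [hf k x, hg k x]

lemma isFunctionOn_const (Ω : Domain) {d : ℕ} {F : Type*} (a : F) :
    Ω.IsFunctionOn (fun _ : Space d => a) := by
  cases Ω with
  | whole => trivial
  | torus => intro k x; rfl

open scoped Pointwise in
lemma isAddFundamentalDomain_vadd_cell (d : ℕ) (h : Space d) :
    IsAddFundamentalDomain (lattice d) (h +ᵥ Domain.torus.cell d)
      (volume : Measure (Space d)) :=
  (isAddFundamentalDomain_cell d).vadd_of_comm h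

open scoped Pointwise in
lemma image_add_right_cell (d : ℕ) (h : Space d) :
    (fun x => x + h) '' Domain.torus.cell d = h +ᵥ Domain.torus.cell d := by
  have : (fun x => x + h) = fun x => h +ᵥ x := by
    funext x
    exact add_comm x h
  rw [this]
  rfl

lemma lattice_invariant {d : ℕ} {F : Type*} {f : Space d → F}
    (hf : Domain.torus.IsFunctionOn f) (g : lattice d) (x : Space d) : f (g +ᵥ x) = f x := by
  obtain ⟨_, ⟨k, rfl⟩⟩ := g
  have := hf.periodic k x
  rwa [add_comm] at this

/-- Translation invariance on the domain: on the torus, the translated unit cube is another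
fundamental domain of the lattice. -/
theorem lintegral_translate {Ω : Domain} {d : ℕ} {f : Space d → ℝ≥0∞}
    (hf : Ω.IsFunctionOn f) (h : Space d) :
    ∫⁻ x, f (x + h) ∂(Ω.measure d) = ∫⁻ x, f x ∂(Ω.measure d) := by
  cases Ω with
  | whole => simpa [Domain.measure, Domain.cell] using lintegral_add_right_eq_self f h
  | torus =>
    have h1 := (measurePreserving_add_right (volume : Measure (Space d)) h).setLIntegral_comp_emb
      (measurableEmbedding_addRight h) f (Domain.torus.cell d)
    rw [Domain.measure, h1, image_add_right_cell]
    exact (isAddFundamentalDomain_vadd_cell d h).setLIntegral_eq (isAddFundamentalDomain_cell d) f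
      (lattice_invariant hf)

theorem integral_translate {Ω : Domain} {d : ℕ} {G : Type*} [NormedAddCommGroup G]
    [NormedSpace ℝ G] {f : Space d → G} (hf : Ω.IsFunctionOn f) (h : Space d) :
    ∫ x, f (x + h) ∂(Ω.measure d) = ∫ x, f x ∂(Ω.measure d) := by
  cases Ω with
  | whole => simpa [Domain.measure, Domain.cell] using integral_add_right_eq_self f h
  | torus =>
    have h1 := (measurePreserving_add_right (volume : Measure (Space d)) h).setIntegral_image_emb
      (measurableEmbedding_addRight h) f (Domain.torus.cell d)
    rw [Domain.measure, ← h1, image_add_right_cell]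
    exact (isAddFundamentalDomain_vadd_cell d h).setIntegral_eq (isAddFundamentalDomain_cell d)
      (lattice_invariant hf)

theorem integrable_translate {Ω : Domain} {d : ℕ} {G : Type*} [NormedAddCommGroup G]
    {f : Space d → G} (hfm : StronglyMeasurable f) (hf : Ω.IsFunctionOn f)
    (hi : Integrable f (Ω.measure d)) (h : Space d) :
    Integrable (fun x => f (x + h)) (Ω.measure d) := by
  refine ⟨(hfm.comp_measurable (measurable_add_const h)).aestronglyMeasurable, ?_⟩
  have := lintegral_translate (hf.comp (fun y => ‖y‖ₑ)) h
  rw [HasFiniteIntegral, this]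
  exact hi.2

/-! ### Periodization -/

lemma finite_lattice_meets_ball {d : ℕ} (R : ℝ) :
    {k : Fin d → ℤ | ‖latticeHom d k‖ ≤ R}.Finite := by
  refine (Set.finite_Icc (fun _ : Fin d => -⌈R⌉) (fun _ => ⌈R⌉)).subset fun k hk => ?_
  have h : ∀ i, |(k i : ℝ)| ≤ R := fun i => by
    have := (PiLp.norm_apply_le (latticeHom d k) i).trans hk
    simpa using this
  refine ⟨fun i => ?_, fun i => ?_⟩
  · have := (abs_le.1 (h i)).1
    have h2 := Int.le_ceil R
    have : (-(⌈R⌉ : ℝ)) ≤ k i := by linarith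
    exact_mod_cast this
  · have := (abs_le.1 (h i)).2
    have h2 := Int.le_ceil R
    have : (k i : ℝ) ≤ (⌈R⌉ : ℝ) := by linarith
    exact_mod_cast this

/-- The lattice vectors of norm at most `R`, as a finite set. -/
def latticeBall (d : ℕ) (R : ℝ) : Finset (Fin d → ℤ) := (finite_lattice_meets_ball R).toFinset

lemma eq_zero_of_notMem_latticeBall {d : ℕ} {F : Type*} [Zero F] {g : Space d → F} {R r : ℝ}
    (hg : ∀ x, R < ‖x‖ → g x = 0) {x : Space d} (hx : ‖x‖ ≤ r) {k : Fin d → ℤ}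
    (hk : k ∉ latticeBall d (R + r)) : g (x + latticeHom d k) = 0 := by
  apply hg
  simp only [latticeBall, Finite.mem_toFinset, mem_ofPred_eq, not_le] at hk
  have := norm_sub_le (x + latticeHom d k) x
  rw [add_sub_cancel_left] at this
  linarith

/-- The periodization `x ↦ ∑_k g (x + k)` of a compactly supported function. -/
def periodize {d : ℕ} {F : Type*} [AddCommMonoid F] [TopologicalSpace F] (g : Space d → F) :
    Space d → F := fun x => ∑' k : Fin d → ℤ, g (x + latticeHom d k)

section periodize
variable {d : ℕ} {F : Type*} [NormedAddCommGroup F]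

lemma periodize_eq_sum {g : Space d → F} {R r : ℝ} (hg : ∀ x, R < ‖x‖ → g x = 0)
    {x : Space d} (hx : ‖x‖ ≤ r) :
    periodize g x = ∑ k ∈ latticeBall d (R + r), g (x + latticeHom d k) :=
  tsum_eq_sum fun _ hk => eq_zero_of_notMem_latticeBall hg hx hk

lemma periodize_isFunctionOn (g : Space d → F) : Domain.torus.IsFunctionOn (periodize g) := by
  intro k x
  change ∑' l, g (x + latticeHom d k + latticeHom d l) = ∑' l, g (x + latticeHom d l)
  rw [← (Equiv.addLeft k).tsum_eq (fun l => g (x + latticeHom d l))]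
  refine tsum_congr fun l => ?_
  simp [add_assoc]

lemma exists_radius {g : Space d → F} (hg : HasCompactSupport g) :
    ∃ R : ℝ, 0 < R ∧ ∀ x, R < ‖x‖ → g x = 0 := by
  obtain ⟨R, hR⟩ := hg.isCompact.isBounded.subset_closedBall 0
  refine ⟨max R 1, by positivity, fun x hx => ?_⟩
  by_contra h
  have := hR (subset_tsupport g h)
  rw [mem_closedBall_zero_iff] at this
  exact absurd (this.trans (le_max_left R 1)) (not_le.2 hx)

lemma periodize_eventuallyEq {g : Space d → F} {R : ℝ} (hg : ∀ x, R < ‖x‖ → g x = 0)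
    (x : Space d) : periodize g =ᶠ[𝓝 x]
      fun y => ∑ k ∈ latticeBall d (R + (‖x‖ + 1)), g (y + latticeHom d k) := by
  filter_upwards [Metric.ball_mem_nhds x one_pos] with y hy
  refine periodize_eq_sum hg ?_
  have h1 := norm_sub_norm_le y x
  rw [Metric.mem_ball, dist_eq_norm] at hy
  linarith

variable [NormedSpace ℝ F]

lemma contDiff_periodize {g : Space d → F} (hgc : HasCompactSupport g) {n : WithTop ℕ∞}
    (hg : ContDiff ℝ n g) : ContDiff ℝ n (periodize g) := by
  obtain ⟨R, -, hR⟩ := exists_radius hgc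
  rw [contDiff_iff_contDiffAt]
  intro x
  refine ContDiffAt.congr_of_eventuallyEq ?_ (periodize_eventuallyEq hR x)
  exact (ContDiff.sum fun k _ => hg.comp (contDiff_id.add contDiff_const)).contDiffAt

lemma fderiv_eq_zero_of_radius {g : Space d → F} {R : ℝ} (hg : ∀ x, R < ‖x‖ → g x = 0)
    (x : Space d) (hx : R < ‖x‖) : fderiv ℝ g x = 0 := by
  have : g =ᶠ[𝓝 x] fun _ => 0 := by
    filter_upwards [(isOpen_lt continuous_const continuous_norm).mem_nhds hx] with z hz
    exact hg z hz
  rw [this.fderiv_eq]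
  simp

lemma fderiv_periodize {g : Space d → F} (hgc : HasCompactSupport g)
    (hg : Differentiable ℝ g) (x : Space d) :
    fderiv ℝ (periodize g) x = periodize (fderiv ℝ g) x := by
  obtain ⟨R, -, hR⟩ := exists_radius hgc
  have hd : ∀ k, DifferentiableAt ℝ (fun y => g (y + latticeHom d k)) x := fun k =>
    (hg.comp (differentiable_id.add_const (latticeHom d k))).differentiableAt
  rw [(periodize_eventuallyEq hR x).fderiv_eq,
    periodize_eq_sum (fderiv_eq_zero_of_radius hR) (show ‖x‖ ≤ ‖x‖ + 1 by linarith),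
    fderiv_fun_sum fun k _ => hd k]
  refine Finset.sum_congr rfl fun k _ => ?_
  simp [fderiv_comp_add_right]

end periodize

/-- Unfolding: the integral over the torus of a periodization is the integral over `ℝ^d`. -/
theorem setIntegral_tsum_translates {d : ℕ} {f : ℝ → Space d → ℝ} {I : Set ℝ} {R : ℝ}
    (hf : ∀ t x, R < ‖x‖ → f t x = 0)
    (hi : IntegrableOn (fun z : ℝ × Space d => f z.1 z.2) (I ×ˢ univ)) :
    ∫ z in I ×ˢ Domain.torus.cell d, ∑' k, f z.1 (z.2 + latticeHom d k)
      = ∫ t in I, ∫ x, f t x := by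
  have hprod : ∀ s : Set (Space d), (volume : Measure (ℝ × Space d)).restrict (I ×ˢ s)
      = (volume.restrict I).prod (volume.restrict s) := fun s =>
    (Measure.prod_restrict I s).symm
  rw [IntegrableOn, hprod, Measure.restrict_univ] at hi
  have hsum : ∀ t, ∀ x ∈ Domain.torus.cell d, ∑' k, f t (x + latticeHom d k)
      = ∑ k ∈ latticeBall d (R + Real.sqrt d), f t (x + latticeHom d k) := fun t x hx =>
    periodize_eq_sum (hf t) (norm_le_of_mem_cell hx)
  have hsh : ∀ k : Fin d → ℤ, Integrable (fun z : ℝ × Space d => f z.1 (z.2 + latticeHom d k))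
      ((volume.restrict I).prod (volume.restrict (Domain.torus.cell d))) := fun k => by
    have h1 : Integrable (fun z : ℝ × Space d => f z.1 (z.2 + latticeHom d k))
        ((volume.restrict I).prod volume) := by
      have hmp : MeasurePreserving (Prod.map id fun x : Space d => x + latticeHom d k)
          ((volume.restrict I).prod volume) ((volume.restrict I).prod volume) :=
        (MeasurePreserving.id _).prod (measurePreserving_add_right volume _)
      exact (hmp.integrable_comp hi.aestronglyMeasurable).2 hi
    refine h1.mono_measure ?_
    exact Measure.prod_mono le_rfl Measure.restrict_le_self
  have hae : ∀ᵐ t ∂(volume.restrict I), Integrable (f t) := hi.prod_right_ae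
  rw [hprod, integral_congr_ae (g := fun z : ℝ × Space d =>
      ∑ k ∈ latticeBall d (R + Real.sqrt d), f z.1 (z.2 + latticeHom d k)),
    integral_prod _ (integrable_finsetSum _ fun k _ => hsh k)]
  · refine integral_congr_ae ?_
    have hae2 : ∀ᵐ t ∂(volume.restrict I), ∀ k : Fin d → ℤ,
        Integrable (fun x => f t (x + latticeHom d k))
          (volume.restrict (Domain.torus.cell d)) :=
      ae_all_iff.2 fun k => (hsh k).prod_right_ae
    filter_upwards [hae, hae2] with t ht ht2
    rw [integral_finsetSum _ fun k _ => ht2 k,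
      (isAddFundamentalDomain_cell d).integral_eq_tsum'' (f t) ht]
    have hinj : Function.Bijective (fun k : Fin d → ℤ =>
        (⟨latticeHom d k, ⟨k, rfl⟩⟩ : lattice d)) := by
      constructor
      · intro k l h
        exact latticeHom_injective d (congrArg Subtype.val h)
      · rintro ⟨_, ⟨k, rfl⟩⟩
        exact ⟨k, rfl⟩
    rw [← (Equiv.ofBijective _ hinj).tsum_eq]
    rw [tsum_eq_sum (s := latticeBall d (R + Real.sqrt d))]
    · refine Finset.sum_congr rfl fun k _ => ?_
      refine integral_congr_ae (Eventually.of_forall fun x => ?_)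
      change f t (x + latticeHom d k) = f t (latticeHom d k + x)
      rw [add_comm]
    · intro k hk
      refine (setIntegral_congr_fun (measurableSet_cell _ _) (g := fun _ => 0) fun x hx => ?_).trans
        (by simp)
      change f t (latticeHom d k + x) = 0
      rw [add_comm]
      exact eq_zero_of_notMem_latticeBall (hf t) (norm_le_of_mem_cell hx) hk
  · have : ∀ᵐ z ∂((volume.restrict I).prod (volume.restrict (Domain.torus.cell d))),
        z.2 ∈ Domain.torus.cell d := by
      have h3 : ∀ᵐ x ∂(volume.restrict (Domain.torus.cell d)), x ∈ Domain.torus.cell d :=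
        ae_restrict_mem (measurableSet_cell _ _)
      exact Measure.quasiMeasurePreserving_snd.ae h3
    filter_upwards [this] with z hz
    exact hsum z.1 z.2 hz

/-! ### Testing with compactly supported functions on `ℝ^d` -/

/-- A smooth function of time with compact support in `(0,T)`. -/
structure IsTimeTest (T : ℝ) (ψ : ℝ → ℝ) : Prop where
  contDiff : ContDiff ℝ ((⊤ : ℕ∞) : WithTop ℕ∞) ψ
  compact : HasCompactSupport ψ
  subset : tsupport ψ ⊆ Ioo 0 T

/-- A smooth compactly supported function on `ℝ^d`. -/
structure IsSpaceTest {d : ℕ} {F : Type*} [NormedAddCommGroup F] [NormedSpace ℝ F]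
    (g : Space d → F) : Prop where
  contDiff : ContDiff ℝ ((⊤ : ℕ∞) : WithTop ℕ∞) g
  compact : HasCompactSupport g

section
variable {d : ℕ} {F : Type*} [NormedAddCommGroup F] [NormedSpace ℝ F]

lemma IsSpaceTest.differentiable {g : Space d → F} (hg : IsSpaceTest g) : Differentiable ℝ g :=
  hg.contDiff.differentiable (by simp)

lemma IsSpaceTest.fderiv {g : Space d → F} (hg : IsSpaceTest g) : IsSpaceTest (fderiv ℝ g) :=
  ⟨hg.contDiff.fderiv_right (by simp), hg.compact.fderiv ℝ⟩

lemma IsSpaceTest.bounded {g : Space d → F} (hg : IsSpaceTest g) : ∃ C, 0 ≤ C ∧ ∀ x, ‖g x‖ ≤ C := by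
  obtain ⟨C, hC⟩ := hg.contDiff.continuous.bounded_above_of_compact_support hg.compact
  exact ⟨C, (norm_nonneg _).trans (hC 0), hC⟩

lemma IsSpaceTest.comp_add_right {g : Space d → F} (hg : IsSpaceTest g) (y : Space d) :
    IsSpaceTest (fun x => g (x + y)) :=
  ⟨hg.contDiff.comp (contDiff_id.add contDiff_const),
    hg.compact.comp_homeomorph (Homeomorph.addRight y)⟩

lemma IsSpaceTest.comp_sub_left {g : Space d → F} (hg : IsSpaceTest g) (y : Space d) :
    IsSpaceTest (fun x => g (y - x)) :=
  ⟨hg.contDiff.comp (contDiff_const.sub contDiff_id),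
    hg.compact.comp_homeomorph (Homeomorph.subLeft y)⟩

lemma IsTimeTest.differentiable {T : ℝ} {ψ : ℝ → ℝ} (hψ : IsTimeTest T ψ) : Differentiable ℝ ψ :=
  hψ.contDiff.differentiable (by simp)

lemma IsTimeTest.continuous_deriv {T : ℝ} {ψ : ℝ → ℝ} (hψ : IsTimeTest T ψ) :
    Continuous (deriv ψ) :=
  hψ.contDiff.continuous_deriv (by simp)

lemma IsTimeTest.bounded {T : ℝ} {ψ : ℝ → ℝ} (hψ : IsTimeTest T ψ) :
    ∃ C, 0 ≤ C ∧ (∀ t, |ψ t| ≤ C) ∧ ∀ t, |deriv ψ t| ≤ C := by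
  obtain ⟨C, hC⟩ := hψ.contDiff.continuous.bounded_above_of_compact_support hψ.compact
  obtain ⟨D, hD⟩ := hψ.continuous_deriv.bounded_above_of_compact_support hψ.compact.deriv
  exact ⟨max C D, ((norm_nonneg _).trans (hC 0)).trans (le_max_left _ _),
    fun t => (hC t).trans (le_max_left _ _), fun t => (hD t).trans (le_max_right _ _)⟩

lemma contDiff_prod_smul {ψ : ℝ → ℝ} {g : Space d → F} {n : WithTop ℕ∞} (hψ : ContDiff ℝ n ψ)
    (hg : ContDiff ℝ n g) : ContDiff ℝ n (fun z : ℝ × Space d => ψ z.1 • g z.2) :=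
  (hψ.comp contDiff_fst).smul (hg.comp contDiff_snd)

lemma isTestFunction_whole {T : ℝ} {ψ : ℝ → ℝ} {g : Space d → F} (hψ : IsTimeTest T ψ)
    (hg : IsSpaceTest g) : IsTestFunction .whole T (fun t x => ψ t • g x) where
  isFunctionOn _ := trivial
  contDiff := contDiff_prod_smul hψ.contDiff hg.contDiff
  time_support := ⟨tsupport ψ, hψ.compact, hψ.subset, fun t ht x => by
    rw [image_eq_zero_of_notMem_tsupport ht, zero_smul]⟩
  space_support _ := by
    refine HasCompactSupport.intro (hψ.compact.isCompact.prod hg.compact.isCompact) ?_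
    intro z hz
    rw [mem_prod, not_and_or] at hz
    rcases hz with h | h
    · rw [image_eq_zero_of_notMem_tsupport h, zero_smul]
    · rw [image_eq_zero_of_notMem_tsupport h, smul_zero]

lemma isTestFunction_torus {T : ℝ} {ψ : ℝ → ℝ} {g : Space d → F} (hψ : IsTimeTest T ψ)
    (hg : ContDiff ℝ ((⊤ : ℕ∞) : WithTop ℕ∞) g) (hper : Domain.torus.IsFunctionOn g) :
    IsTestFunction .torus T (fun t x => ψ t • g x) where
  isFunctionOn _ := hper.comp _
  contDiff := contDiff_prod_smul hψ.contDiff hg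
  time_support := ⟨tsupport ψ, hψ.compact, hψ.subset, fun t ht x => by
    rw [image_eq_zero_of_notMem_tsupport ht, zero_smul]⟩
  space_support h := by cases h

end

section
variable {d : ℕ} {v : ℝ → Space d → Space d} {T : ℝ}

/-- The integrand of the momentum equation tested with `ψ(t) g(x)`. -/
def momentumDensity (v : ℝ → Space d → Space d) (ψ : ℝ → ℝ) (g : Space d → Space d) (t : ℝ)
    (x : Space d) : ℝ :=
  deriv ψ t * inner ℝ (v t x) (g x) + ψ t * inner ℝ (v t x) (fderiv ℝ g x (v t x))

/-- The integrand of the incompressibility condition tested with `ψ(t) q(x)`. -/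
def divergenceDensity (v : ℝ → Space d → Space d) (ψ : ℝ → ℝ) (q : Space d → ℝ) (t : ℝ)
    (x : Space d) : ℝ :=
  ψ t * fderiv ℝ q x (v t x)

lemma integrableOn_of_bound {f : ℝ × Space d → ℝ} {ψ : ℝ → ℝ} (hψ : IsTimeTest T ψ) {R C : ℝ}
    (hloc : ∀ K : Set (ℝ × Space d), IsCompact K → K ⊆ Ioo 0 T ×ˢ univ →
      MemLp (fun z : ℝ × Space d => v z.1 z.2) 2 (volume.restrict K))
    (hfm : AEStronglyMeasurable (fun z : ℝ × Space d => v z.1 z.2)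
        (volume.restrict (tsupport ψ ×ˢ Metric.closedBall 0 R)) →
      AEStronglyMeasurable f (volume.restrict (tsupport ψ ×ˢ Metric.closedBall 0 R)))
    (hf : ∀ z, ‖f z‖ ≤ C * (1 + ‖v z.1 z.2‖ ^ 2))
    (h0 : ∀ z, z ∉ tsupport ψ ×ˢ Metric.closedBall (0 : Space d) R → f z = 0) :
    Integrable f := by
  set K : Set (ℝ × Space d) := tsupport ψ ×ˢ Metric.closedBall 0 R with hKdef
  have hK : IsCompact K := hψ.compact.isCompact.prod (isCompact_closedBall _ _)
  have hv := hloc K hK (prod_mono hψ.subset (subset_univ _))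
  rw [← integrableOn_iff_integrable_of_support_subset (s := K)]
  · have : IsFiniteMeasure ((volume : Measure (ℝ × Space d)).restrict K) :=
      ⟨by rw [Measure.restrict_apply_univ]; exact hK.measure_lt_top⟩
    have hb : Integrable (fun z : ℝ × Space d => C * (1 + ‖v z.1 z.2‖ ^ 2)) (volume.restrict K) :=
      ((integrable_const 1).add hv.integrable_norm_pow').const_mul C
    exact hb.mono' (hfm hv.aestronglyMeasurable) (Eventually.of_forall hf)
  · intro z hz
    by_contra h
    exact hz (h0 z h)

lemma notMem_prod_closedBall {ψ : ℝ → ℝ} {R : ℝ} {z : ℝ × Space d}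
    (hz : z ∉ tsupport ψ ×ˢ Metric.closedBall (0 : Space d) R) :
    z.1 ∉ tsupport ψ ∨ R < ‖z.2‖ := by
  rw [mem_prod, not_and_or, mem_closedBall_zero_iff, not_le] at hz
  exact hz

lemma deriv_eq_zero_of_notMem_tsupport {ψ : ℝ → ℝ} {t : ℝ} (ht : t ∉ tsupport ψ) :
    deriv ψ t = 0 :=
  image_eq_zero_of_notMem_tsupport fun h => ht (tsupport_deriv_subset (𝕜 := ℝ) h)

lemma integrable_momentumDensity {Ω : Domain} (hv : IsWeakEulerSolution Ω T v) {ψ : ℝ → ℝ}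
    (hψ : IsTimeTest T ψ) {g : Space d → Space d} (hg : IsSpaceTest g) :
    Integrable (fun z : ℝ × Space d => momentumDensity v ψ g z.1 z.2) := by
  obtain ⟨R, -, hR⟩ := exists_radius hg.compact
  obtain ⟨A, hA0, hA⟩ := hg.bounded
  obtain ⟨B, hB0, hB⟩ := hg.fderiv.bounded
  obtain ⟨C, hC0, hC, hC'⟩ := hψ.bounded
  refine integrableOn_of_bound (C := C * (A + B)) (R := R) hψ hv.memLp_loc ?_ ?_ ?_
  · intro hm
    have h1 : AEStronglyMeasurable (fun z : ℝ × Space d => g z.2)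
        (volume.restrict (tsupport ψ ×ˢ Metric.closedBall 0 R)) :=
      (hg.contDiff.continuous.comp continuous_snd).aestronglyMeasurable
    have h2 : AEStronglyMeasurable (fun z : ℝ × Space d => fderiv ℝ g z.2)
        (volume.restrict (tsupport ψ ×ˢ Metric.closedBall 0 R)) :=
      (hg.fderiv.contDiff.continuous.comp continuous_snd).aestronglyMeasurable
    have h3 := isBoundedBilinearMap_apply.continuous.comp_aestronglyMeasurable (h2.prodMk hm)
    exact ((hψ.continuous_deriv.comp continuous_fst).aestronglyMeasurable.mul (hm.inner h1)).add
      ((hψ.contDiff.continuous.comp continuous_fst).aestronglyMeasurable.mul (hm.inner h3))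
  · intro z
    set n := ‖v z.1 z.2‖ with hn
    have hn0 : 0 ≤ n := norm_nonneg _
    have e1 : ‖deriv ψ z.1 * inner ℝ (v z.1 z.2) (g z.2)‖ ≤ C * (n * A) := by
      rw [norm_mul]
      refine mul_le_mul (hC' _) ((norm_inner_le_norm _ _).trans ?_) (norm_nonneg _) hC0
      exact mul_le_mul_of_nonneg_left (hA _) hn0
    have e2 : ‖ψ z.1 * inner ℝ (v z.1 z.2) (fderiv ℝ g z.2 (v z.1 z.2))‖ ≤ C * (n * (B * n)) := by
      rw [norm_mul]
      refine mul_le_mul (hC _) ((norm_inner_le_norm _ _).trans ?_) (norm_nonneg _) hC0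
      refine mul_le_mul_of_nonneg_left ?_ hn0
      exact (ContinuousLinearMap.le_opNorm _ _).trans (mul_le_mul_of_nonneg_right (hB _) hn0)
    refine (norm_add_le _ _).trans ((add_le_add e1 e2).trans ?_)
    have : n ≤ 1 + n ^ 2 := by nlinarith [sq_nonneg (n - 1)]
    have h1 : n * A ≤ (1 + n ^ 2) * A := mul_le_mul_of_nonneg_right this hA0
    have h2 : n * (B * n) ≤ (1 + n ^ 2) * B := by nlinarith
    nlinarith
  · intro z hz
    rcases notMem_prod_closedBall hz with h | h
    · simp [momentumDensity, image_eq_zero_of_notMem_tsupport h,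
        deriv_eq_zero_of_notMem_tsupport h]
    · simp [momentumDensity, hR _ h, fderiv_eq_zero_of_radius hR _ h]

lemma integrable_divergenceDensity {Ω : Domain} (hv : IsWeakEulerSolution Ω T v) {ψ : ℝ → ℝ}
    (hψ : IsTimeTest T ψ) {q : Space d → ℝ} (hq : IsSpaceTest q) :
    Integrable (fun z : ℝ × Space d => divergenceDensity v ψ q z.1 z.2) := by
  obtain ⟨R, -, hR⟩ := exists_radius hq.compact
  obtain ⟨B, hB0, hB⟩ := hq.fderiv.bounded
  obtain ⟨C, hC0, hC, hC'⟩ := hψ.bounded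
  refine integrableOn_of_bound (C := C * B) (R := R) hψ hv.memLp_loc ?_ ?_ ?_
  · intro hm
    have h2 : AEStronglyMeasurable (fun z : ℝ × Space d => fderiv ℝ q z.2)
        (volume.restrict (tsupport ψ ×ˢ Metric.closedBall 0 R)) :=
      (hq.fderiv.contDiff.continuous.comp continuous_snd).aestronglyMeasurable
    have h3 := isBoundedBilinearMap_apply.continuous.comp_aestronglyMeasurable (h2.prodMk hm)
    exact (hψ.contDiff.continuous.comp continuous_fst).aestronglyMeasurable.mul h3
  · intro z
    have hn0 : 0 ≤ ‖v z.1 z.2‖ := norm_nonneg _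
    have e2 : ‖ψ z.1 * fderiv ℝ q z.2 (v z.1 z.2)‖ ≤ C * (B * ‖v z.1 z.2‖) := by
      rw [norm_mul]
      refine mul_le_mul (hC _) ?_ (norm_nonneg _) hC0
      exact (ContinuousLinearMap.le_opNorm _ _).trans (mul_le_mul_of_nonneg_right (hB _) hn0)
    refine e2.trans ?_
    rw [mul_assoc]
    refine mul_le_mul_of_nonneg_left (mul_le_mul_of_nonneg_left ?_ hB0) hC0
    nlinarith [sq_nonneg (‖v z.1 z.2‖ - 1)]
  · intro z hz
    rcases notMem_prod_closedBall hz with h | h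
    · simp [divergenceDensity, image_eq_zero_of_notMem_tsupport h]
    · simp [divergenceDensity, fderiv_eq_zero_of_radius hR _ h]

lemma divergence_periodize {g : Space d → Space d} (hg : IsSpaceTest g)
    (hdiv : ∀ x, divergence g x = 0) (x : Space d) : divergence (periodize g) x = 0 := by
  obtain ⟨R, -, hR⟩ := exists_radius hg.compact
  have h := periodize_eq_sum (fderiv_eq_zero_of_radius hR) (le_refl ‖x‖)
  simp only [divergence, fderiv_periodize hg.compact hg.differentiable, h,
    sum_apply, WithLp.ofLp_sum, Finset.sum_apply]
  rw [Finset.sum_comm]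
  exact Finset.sum_eq_zero fun k _ => hdiv _

lemma setIntegral_prod_univ {f : ℝ → Space d → ℝ} {I : Set ℝ}
    (hi : Integrable (fun z : ℝ × Space d => f z.1 z.2)) :
    ∫ z in I ×ˢ univ, f z.1 z.2 = ∫ t in I, ∫ x, f t x := by
  rw [Measure.volume_eq_prod, setIntegral_prod _ hi.integrableOn]
  simp

/-- On either domain the momentum equation may be tested with a compactly supported
divergence-free field on `ℝ^d`: on the torus its periodization is the actual test function. -/
theorem integral_momentumDensity {Ω : Domain} (hv : IsWeakEulerSolution Ω T v) {ψ : ℝ → ℝ}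
    (hψ : IsTimeTest T ψ) {g : Space d → Space d} (hg : IsSpaceTest g)
    (hdiv : ∀ x, divergence g x = 0) :
    ∫ t in Ioo 0 T, ∫ x, momentumDensity v ψ g t x = 0 := by
  have hi := integrable_momentumDensity hv hψ hg
  have key : ∀ (G : Space d → Space d), Differentiable ℝ G → ∀ (t : ℝ) (x : Space d),
      inner ℝ (v t x) (deriv (fun s => ψ s • G x) t)
        + inner ℝ (v t x) (fderiv ℝ (fun y => ψ t • G y) x (v t x))
      = momentumDensity v ψ G t x := fun G hG t x => by
    rw [deriv_smul_const hψ.differentiable.differentiableAt, fderiv_fun_const_smul hG.differentiableAt]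
    simp [momentumDensity, inner_smul_right]
  have hdivs : ∀ (G : Space d → Space d), Differentiable ℝ G → (∀ x, divergence G x = 0) →
      ∀ (t : ℝ) (x : Space d), divergence (fun y => ψ t • G y) x = 0 := fun G hG h0 t x => by
    have := h0 x
    simp only [divergence] at this ⊢
    rw [fderiv_fun_const_smul hG.differentiableAt]
    simp [← Finset.mul_sum, this]
  cases Ω with
  | whole =>
    have h := hv.momentum _ (isTestFunction_whole hψ hg) (hdivs g hg.differentiable hdiv)
    simp only [key g hg.differentiable] at h
    rw [← setIntegral_prod_univ hi]
    exact h
  | torus =>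
    obtain ⟨R, -, hR⟩ := exists_radius hg.compact
    have hP := contDiff_periodize hg.compact hg.contDiff
    have hPd : Differentiable ℝ (periodize g) := hP.differentiable (by simp)
    have h := hv.momentum _ (isTestFunction_torus hψ hP (periodize_isFunctionOn g))
      (hdivs _ hPd (divergence_periodize hg hdiv))
    simp only [key _ hPd] at h
    rw [← setIntegral_tsum_translates (R := R) (fun t x hx => by
      simp [momentumDensity, hR _ hx, fderiv_eq_zero_of_radius hR _ hx]) hi.integrableOn]
    refine Eq.trans (setIntegral_congr_fun (measurableSet_Ioo.prod (measurableSet_cell _ _))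
      fun z hz => ?_) h
    have hper : ∀ k, v z.1 (z.2 + latticeHom d k) = v z.1 z.2 := fun k =>
      (hv.isFunctionOn z.1 hz.1).periodic k z.2
    have e1 := periodize_eq_sum hR (norm_le_of_mem_cell hz.2)
    have e2 := periodize_eq_sum (fderiv_eq_zero_of_radius hR) (norm_le_of_mem_cell hz.2)
    rw [momentumDensity, fderiv_periodize hg.compact hg.differentiable, e1, e2,
      tsum_eq_sum (s := latticeBall d (R + Real.sqrt d))]
    · simp only [momentumDensity, hper, sum_apply, inner_sum, Finset.mul_sum,
        Finset.sum_add_distrib]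
    · intro k hk
      have f1 := eq_zero_of_notMem_latticeBall hR (norm_le_of_mem_cell hz.2) hk
      have f2 := eq_zero_of_notMem_latticeBall (fderiv_eq_zero_of_radius hR)
        (norm_le_of_mem_cell hz.2) hk
      simp [momentumDensity, f1, f2]

/-- The counterpart of `integral_momentumDensity` for the incompressibility condition. -/
theorem integral_divergenceDensity {Ω : Domain} (hv : IsWeakEulerSolution Ω T v) {ψ : ℝ → ℝ}
    (hψ : IsTimeTest T ψ) {q : Space d → ℝ} (hq : IsSpaceTest q) :
    ∫ t in Ioo 0 T, ∫ x, divergenceDensity v ψ q t x = 0 := by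
  have hi := integrable_divergenceDensity hv hψ hq
  have key : ∀ (G : Space d → ℝ), Differentiable ℝ G → ∀ (t : ℝ) (x : Space d),
      fderiv ℝ (fun y => ψ t • G y) x (v t x) = divergenceDensity v ψ G t x := fun G hG t x => by
    rw [fderiv_fun_const_smul hG.differentiableAt]
    simp [divergenceDensity]
  cases Ω with
  | whole =>
    have h := hv.incompressible _ (isTestFunction_whole hψ hq)
    simp only [key q hq.differentiable] at h
    rw [← setIntegral_prod_univ hi]
    exact h
  | torus =>
    obtain ⟨R, -, hR⟩ := exists_radius hq.compact
    have hP := contDiff_periodize hq.compact hq.contDiff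
    have hPd : Differentiable ℝ (periodize q) := hP.differentiable (by simp)
    have h := hv.incompressible _ (isTestFunction_torus hψ hP (periodize_isFunctionOn q))
    simp only [key _ hPd] at h
    rw [← setIntegral_tsum_translates (R := R) (fun t x hx => by
      simp [divergenceDensity, fderiv_eq_zero_of_radius hR _ hx]) hi.integrableOn]
    refine Eq.trans (setIntegral_congr_fun (measurableSet_Ioo.prod (measurableSet_cell _ _))
      fun z hz => ?_) h
    have hper : ∀ k, v z.1 (z.2 + latticeHom d k) = v z.1 z.2 := fun k =>
      (hv.isFunctionOn z.1 hz.1).periodic k z.2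
    have e2 := periodize_eq_sum (fderiv_eq_zero_of_radius hR) (norm_le_of_mem_cell hz.2)
    rw [divergenceDensity, fderiv_periodize hq.compact hq.differentiable, e2,
      tsum_eq_sum (s := latticeBall d (R + Real.sqrt d))]
    · simp only [divergenceDensity, hper, sum_apply, Finset.mul_sum]
    · intro k hk
      have f2 := eq_zero_of_notMem_latticeBall (fderiv_eq_zero_of_radius hR)
        (norm_le_of_mem_cell hz.2) hk
      simp [divergenceDensity, f2]

/-- Incompressibility at almost every time, tested with a fixed function. -/
theorem ae_integral_fderiv_eq_zero {Ω : Domain} (hv : IsWeakEulerSolution Ω T v)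
    {q : Space d → ℝ} (hq : IsSpaceTest q) :
    ∀ᵐ t, t ∈ Ioo 0 T → ∫ x, fderiv ℝ q x (v t x) = 0 := by
  obtain ⟨R, -, hR⟩ := exists_radius hq.compact
  obtain ⟨B, hB0, hB⟩ := hq.fderiv.bounded
  refine isOpen_Ioo.ae_eq_zero_of_integral_contDiff_smul_eq_zero ?_ ?_
  · rw [locallyIntegrableOn_iff isOpen_Ioo.isLocallyClosed]
    intro K hKI hK
    have hKc : IsCompact (K ×ˢ Metric.closedBall (0 : Space d) R) :=
      hK.prod (isCompact_closedBall _ _)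
    have hv2 := hv.memLp_loc _ hKc (prod_mono hKI (subset_univ _))
    have : IsFiniteMeasure ((volume : Measure (ℝ × Space d)).restrict
        (K ×ˢ Metric.closedBall 0 R)) :=
      ⟨by rw [Measure.restrict_apply_univ]; exact hKc.measure_lt_top⟩
    have h2 : AEStronglyMeasurable (fun z : ℝ × Space d => fderiv ℝ q z.2)
        (volume.restrict (K ×ˢ Metric.closedBall 0 R)) :=
      (hq.fderiv.contDiff.continuous.comp continuous_snd).aestronglyMeasurable
    have h3 := isBoundedBilinearMap_apply.continuous.comp_aestronglyMeasurable
      (h2.prodMk hv2.aestronglyMeasurable)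
    have hint : Integrable (fun z : ℝ × Space d => fderiv ℝ q z.2 (v z.1 z.2))
        (volume.restrict (K ×ˢ Metric.closedBall 0 R)) := by
      refine ((hv2.integrable (by norm_num)).norm.const_mul B).mono' h3
        (Eventually.of_forall fun z => ?_)
      exact (ContinuousLinearMap.le_opNorm _ _).trans
        (mul_le_mul_of_nonneg_right (hB _) (norm_nonneg _))
    rw [Measure.volume_eq_prod, ← Measure.prod_restrict] at hint
    have h4 := hint.integral_prod_left
    refine h4.congr (Eventually.of_forall fun t => ?_)
    refine setIntegral_eq_integral_of_forall_compl_eq_zero fun x hx => ?_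
    rw [mem_closedBall_zero_iff, not_le] at hx
    simp [fderiv_eq_zero_of_radius hR _ hx]
  · intro ψ hψ hψc hψs
    have h := integral_divergenceDensity hv ⟨hψ, hψc, hψs⟩ hq
    simp only [divergenceDensity, integral_const_mul] at h
    rw [← h]
    simp only [smul_eq_mul]
    refine (setIntegral_eq_integral_of_forall_compl_eq_zero fun t ht => ?_).symm
    rw [image_eq_zero_of_notMem_tsupport fun h => ht (hψs h), zero_mul]

end

/-! ### Besov norms and Hölder's inequality in time -/

section besov
variable {d : ℕ} {Ω : Domain} {θ : ℝ} {q : ℝ≥0∞} {f g : Space d → Space d}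

lemma eLpNorm_le_besovNorm : eLpNorm f q (Ω.measure d) ≤ besovNorm Ω θ q f := le_self_add

lemma eLpNorm_sub_le_besovNorm (h : Space d) :
    eLpNorm (fun x => f (x + h) - f x) q (Ω.measure d)
      ≤ ENNReal.ofReal (‖h‖ ^ θ) * besovNorm Ω θ q f := by
  by_cases h0 : h = 0
  · subst h0
    simp
  · have hpos : 0 < ‖h‖ ^ θ := Real.rpow_pos_of_pos (norm_pos_iff.2 h0) _
    have h1 : eLpNorm (fun x => f (x + h) - f x) q (Ω.measure d) / ENNReal.ofReal (‖h‖ ^ θ)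
        ≤ besovNorm Ω θ q f :=
      (le_iSup₂ (f := fun (h : Space d) (_ : h ≠ 0) =>
        eLpNorm (fun x => f (x + h) - f x) q (Ω.measure d) / ENNReal.ofReal (‖h‖ ^ θ)) h h0).trans
        le_add_self
    rw [mul_comm]
    exact (ENNReal.div_le_iff_le_mul (Or.inl (ENNReal.ofReal_pos.2 hpos).ne')
      (Or.inl ENNReal.ofReal_ne_top)).1 h1

lemma besovNorm_congr (h : f =ᵐ[volume] g) : besovNorm Ω θ q f = besovNorm Ω θ q g := by
  have hac : Ω.measure d ≪ volume := Measure.restrict_le_self.absolutelyContinuous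
  unfold besovNorm besovSeminorm
  rw [eLpNorm_congr_ae (hac.ae_le h)]
  congr 1
  refine iSup_congr fun y => iSup_congr fun _ => ?_
  congr 1
  refine eLpNorm_congr_ae (hac.ae_le ?_)
  have h2 := (measurePreserving_add_right (volume : Measure (Space d)) y).quasiMeasurePreserving.ae h
  filter_upwards [h, h2] with x hx hx2
  rw [hx, hx2]

end besov

/-- Hölder's inequality in time. The dominating function `B` need not be measurable, as is the
case for `t ↦ ‖v(t)‖_{B^θ_{q,∞}}`, a supremum over uncountably many translations. -/
lemma setLIntegral_rpow_le_of_le {ν : Measure ℝ} {f B : ℝ → ℝ≥0∞} (hf : Measurable f)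
    (hfB : ∀ᵐ t ∂ν, f t ≤ B t) {q : ℝ} (hq : 0 < q) {r : ℝ≥0∞} (hqr : ENNReal.ofReal q ≤ r)
    (A : Set ℝ) :
    ∫⁻ t in A, f t ^ q ∂ν ≤ eLpNorm B r ν ^ q * ν A ^ (1 - q / r.toReal) := by
  have h1 := eLpNorm_le_eLpNorm_mul_rpow_measure_univ (μ := ν.restrict A) hqr
    hf.aestronglyMeasurable
  have h2 : eLpNorm f r (ν.restrict A) ≤ eLpNorm B r ν :=
    (eLpNorm_mono_measure f Measure.restrict_le_self).trans (eLpNorm_mono_enorm_ae (by simpa using hfB))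
  have hq0 : ENNReal.ofReal q ≠ 0 := (ENNReal.ofReal_pos.2 hq).ne'
  rw [eLpNorm_eq_lintegral_rpow_enorm_toReal hq0 ENNReal.ofReal_ne_top,
    ENNReal.toReal_ofReal hq.le, Measure.restrict_apply_univ] at h1
  have h3 := ENNReal.rpow_le_rpow (h1.trans (mul_le_mul_left h2 _)) hq.le
  rw [← ENNReal.rpow_mul, one_div_mul_cancel hq.ne', ENNReal.rpow_one,
    ENNReal.mul_rpow_of_nonneg _ _ hq.le, ← ENNReal.rpow_mul] at h3
  simp only [enorm_eq_self] at h3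
  refine h3.trans (le_of_eq ?_)
  congr 2
  field_simp

/-! ### A measurable representative -/

lemma cellShift_add {d : ℕ} (x : Space d) (k : Fin d → ℤ) :
    cellShift (x + latticeHom d k) = cellShift x - k := by
  funext i
  simp only [cellShift, PiLp.add_apply, latticeHom_apply, Int.floor_add_intCast, Pi.sub_apply]
  ring

lemma measurable_add_cellShift (d : ℕ) :
    Measurable fun x : Space d => x + latticeHom d (cellShift x) := by
  refine measurable_id.add ?_
  have h1 : Measurable (latticeHom d) := Measurable.of_discrete
  refine h1.comp (measurable_pi_lambda _ fun i => ?_)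
  have : Measurable fun x : Space d => x i := by fun_prop
  exact (Int.measurable_floor.comp this).neg

/-- A jointly measurable representative that is exactly periodic for every time: on the torus, the
values on the unit cube are extended periodically. -/
lemma exists_representative {Ω : Domain} {d : ℕ} {T : ℝ} {v : ℝ → Space d → Space d}
    (hper : ∀ t ∈ Ioo 0 T, Ω.IsFunctionOn (v t))
    (hm : AEStronglyMeasurable (fun z : ℝ × Space d => v z.1 z.2)
      (volume.restrict (Ioo 0 T ×ˢ univ))) :
    ∃ w : ℝ → Space d → Space d, StronglyMeasurable (Function.uncurry w) ∧
      (∀ t, Ω.IsFunctionOn (w t)) ∧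
      ∀ᵐ z ∂((volume.restrict (Ioo 0 T)).prod (volume : Measure (Space d))),
        v z.1 z.2 = w z.1 z.2 := by
  have hμ : (volume : Measure (ℝ × Space d)).restrict (Ioo 0 T ×ˢ univ)
      = (volume.restrict (Ioo 0 T)).prod volume := by
    rw [Measure.volume_eq_prod, ← Measure.prod_restrict, Measure.restrict_univ]
  rw [hμ] at hm
  cases Ω with
  | whole => exact ⟨fun t x => hm.mk _ (t, x), hm.stronglyMeasurable_mk, fun _ => trivial,
      hm.ae_eq_mk⟩
  | torus =>
    refine ⟨fun t x => hm.mk _ (t, x + latticeHom d (cellShift x)), ?_, ?_, ?_⟩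
    · exact hm.stronglyMeasurable_mk.comp_measurable
        (measurable_fst.prodMk ((measurable_add_cellShift d).comp measurable_snd))
    · intro t k x
      change hm.mk _ (t, x + latticeHom d k + latticeHom d (cellShift (x + latticeHom d k))) = _
      rw [cellShift_add, map_sub]
      congr 2
      abel
    · have h1 : ∀ᵐ z ∂((volume.restrict (Ioo 0 T)).prod (volume : Measure (Space d))),
          ∀ k : Fin d → ℤ, v z.1 (z.2 + latticeHom d k) = hm.mk _ (z.1, z.2 + latticeHom d k) := by
        refine ae_all_iff.2 fun k => ?_
        have hmp : MeasurePreserving (Prod.map id fun x : Space d => x + latticeHom d k)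
            ((volume.restrict (Ioo 0 T)).prod volume) ((volume.restrict (Ioo 0 T)).prod volume) :=
          (MeasurePreserving.id _).prod (measurePreserving_add_right volume _)
        exact hmp.quasiMeasurePreserving.ae hm.ae_eq_mk
      have h2 : ∀ᵐ z ∂((volume.restrict (Ioo 0 T)).prod (volume : Measure (Space d))),
          z.1 ∈ Ioo 0 T :=
        Measure.quasiMeasurePreserving_fst.ae (ae_restrict_mem measurableSet_Ioo)
      filter_upwards [h1, h2] with z hz hz2
      rw [← hz, (hper z.1 hz2).periodic]

/-- A jointly measurable, exactly periodic velocity field vanishing outside `(0,T)`, all of whose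
time slices belong to `L² ∩ L³`, and which satisfies the Euler equations tested with products of
functions of time and compactly supported functions on `ℝ^d`. On the torus such test functions do
not see the mean of the field, whose conservation is recorded separately. -/
structure EulerField {d : ℕ} (Ω : Domain) (T : ℝ) (w : ℝ → Space d → Space d) : Prop where
  stronglyMeasurable : StronglyMeasurable (Function.uncurry w)
  isFunctionOn : ∀ t, Ω.IsFunctionOn (w t)
  eq_zero : ∀ t ∉ Ioo 0 T, w t = 0
  memLp_two : ∀ t, MemLp (w t) 2 (Ω.measure d)
  memLp_three : ∀ t, MemLp (w t) 3 (Ω.measure d)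
  memLp_two_prod : MemLp (Function.uncurry w) 2 (volume.prod (Ω.measure d))
  memLp_three_prod : MemLp (Function.uncurry w) 3 (volume.prod (Ω.measure d))
  momentum : ∀ ψ, IsTimeTest T ψ → ∀ g : Space d → Space d, IsSpaceTest g →
    (∀ x, divergence g x = 0) → ∀ y,
    ∫ t in Ioo 0 T, ∫ z, (deriv ψ t * inner ℝ (w t (y + z)) (g z)
      + ψ t * inner ℝ (w t (y + z)) (fderiv ℝ g z (w t (y + z)))) = 0
  incompressible : ∀ q : Space d → ℝ, IsSpaceTest q →
    ∀ᵐ t, ∀ᵐ y ∂(Ω.measure d), ∫ z, fderiv ℝ q z (w t (y - z)) = 0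
  mean : Ω = .torus → ∀ ψ, IsTimeTest T ψ → ∀ e : Space d,
    ∫ t in Ioo 0 T, deriv ψ t * ∫ x, inner ℝ (w t x) e ∂(Ω.measure d) = 0

lemma measurable_eLpNorm_slice {Ω : Domain} {d : ℕ} {w : ℝ → Space d → Space d}
    (hw : StronglyMeasurable (Function.uncurry w)) {q : ℝ≥0∞} (hq0 : q ≠ 0) (hq : q ≠ ⊤) :
    Measurable fun t => eLpNorm (w t) q (Ω.measure d) := by
  simp only [eLpNorm_eq_lintegral_rpow_enorm_toReal hq0 hq]
  refine Measurable.pow_const ?_ _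
  exact Measurable.lintegral_prod_right' (f := fun z : ℝ × Space d => ‖w z.1 z.2‖ₑ ^ q.toReal)
    (hw.measurable.enorm.pow_const _)

lemma slice_stronglyMeasurable {d : ℕ} {w : ℝ → Space d → Space d}
    (hw : StronglyMeasurable (Function.uncurry w)) (t : ℝ) : StronglyMeasurable (w t) :=
  hw.comp_measurable measurable_prodMk_left

/-- Integrability in space-time from a bound on the time slices by a function `B`, itself perhaps
not measurable, with finite norm of higher exponent on `(0,T)`. -/
lemma memLp_prod_of_slices {Ω : Domain} {d : ℕ} {T : ℝ} {w : ℝ → Space d → Space d}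
    (hw : StronglyMeasurable (Function.uncurry w)) (h0 : ∀ t ∉ Ioo 0 T, w t = 0) {q : ℝ}
    (hq : 0 < q) {r : ℝ≥0∞} (hqr : ENNReal.ofReal q ≤ r) {B : ℝ → ℝ≥0∞}
    (hB : eLpNorm B r (volume.restrict (Ioo 0 T)) < ⊤)
    (hle : ∀ᵐ t ∂(volume.restrict (Ioo 0 T)), eLpNorm (w t) (ENNReal.ofReal q) (Ω.measure d) ≤ B t) :
    MemLp (Function.uncurry w) (ENNReal.ofReal q) (volume.prod (Ω.measure d)) := by
  have hq0 : ENNReal.ofReal q ≠ 0 := (ENNReal.ofReal_pos.2 hq).ne'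
  refine ⟨hw.aestronglyMeasurable, ?_⟩
  rw [eLpNorm_lt_top_iff_lintegral_rpow_enorm_lt_top hq0 ENNReal.ofReal_ne_top,
    lintegral_prod _ (hw.measurable.enorm.pow_const _).aemeasurable, ENNReal.toReal_ofReal hq.le]
  have h1 : ∀ t, ∫⁻ x, ‖Function.uncurry w (t, x)‖ₑ ^ q ∂(Ω.measure d)
      = eLpNorm (w t) (ENNReal.ofReal q) (Ω.measure d) ^ q := fun t => by
    rw [eLpNorm_eq_lintegral_rpow_enorm_toReal hq0 ENNReal.ofReal_ne_top,
      ENNReal.toReal_ofReal hq.le, ← ENNReal.rpow_mul, one_div_mul_cancel hq.ne', ENNReal.rpow_one]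
    rfl
  simp only [h1]
  have h2 : ∫⁻ t, eLpNorm (w t) (ENNReal.ofReal q) (Ω.measure d) ^ q
      = ∫⁻ t in Ioo 0 T, eLpNorm (w t) (ENNReal.ofReal q) (Ω.measure d) ^ q := by
    refine (setLIntegral_eq_of_support_subset fun t ht => ?_).symm
    by_contra h
    refine ht ?_
    simp [h0 t h, hq]
  have h3 := setLIntegral_rpow_le_of_le (measurable_eLpNorm_slice hw hq0 ENNReal.ofReal_ne_top)
    hle hq hqr univ
  rw [Measure.restrict_univ] at h3
  rw [h2]
  refine h3.trans_lt (ENNReal.mul_lt_top (ENNReal.rpow_lt_top_of_nonneg hq.le hB.ne) ?_)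
  refine ENNReal.rpow_lt_top_of_nonneg ?_ (measure_ne_top _ _)
  rw [sub_nonneg]
  by_cases hr : r = ⊤
  · simp [hr]
  · have : q ≤ r.toReal := (ENNReal.ofReal_le_iff_le_toReal hr).1 hqr
    exact div_le_one_of_le₀ this (hq.le.trans this)

/-- A weak solution with the given Besov regularity agrees with an `EulerField` at almost every
time. Exponents `p ≥ 3` and `2p/3 ≥ 2` in time make the field cubically and square integrable in
space-time. -/
theorem exists_eulerField {Ω : Domain} {d : ℕ} {T : ℝ} {p : ℝ≥0∞} (hp : 3 ≤ p) {θ β : ℝ}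
    {v : ℝ → Space d → Space d} (hv3 : MemLpBesov Ω T p θ 3 v)
    (hv2 : MemLpBesov Ω T (2 * p / 3) β 2 v) (hv : IsWeakEulerSolution Ω T v) :
    ∃ w, EulerField Ω T w ∧ ∀ᵐ t ∂(volume.restrict (Ioo 0 T)), v t =ᵐ[volume] w t := by
  obtain ⟨w₀, hw₀m, hw₀p, hw₀v⟩ :=
    exists_representative hv3.isFunctionOn hv3.aestronglyMeasurable
  have hsl := Measure.ae_ae_of_ae_prod hw₀v
  have hac : Ω.measure d ≪ volume := Measure.restrict_le_self.absolutelyContinuous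
  -- The times with slices in `L² ∩ L³`. At the remaining ones the field is replaced by zero.
  set G : Set ℝ := Ioo 0 T ∩ ({t | eLpNorm (w₀ t) 2 (Ω.measure d) < ⊤}
    ∩ {t | eLpNorm (w₀ t) 3 (Ω.measure d) < ⊤}) with hG
  have hGm : MeasurableSet G := measurableSet_Ioo.inter
    ((measurableSet_lt (measurable_eLpNorm_slice hw₀m (by norm_num) (by norm_num))
      measurable_const).inter (measurableSet_lt
      (measurable_eLpNorm_slice hw₀m (by norm_num) (by norm_num)) measurable_const))
  have hqr3 : ENNReal.ofReal 3 ≤ p := by simpa using hp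
  have hqr2 : ENNReal.ofReal 2 ≤ 2 * p / 3 := by
    rw [ENNReal.le_div_iff_mul_le (by simp) (by simp)]
    simpa using mul_le_mul_right hp 2
  have hle3 : ∀ᵐ t ∂(volume.restrict (Ioo 0 T)),
      eLpNorm (w₀ t) 3 (Ω.measure d) ≤ besovNorm Ω θ 3 (v t) := by
    filter_upwards [hsl] with t ht
    rw [← eLpNorm_congr_ae (hac.ae_le ht)]
    exact eLpNorm_le_besovNorm
  have hle2 : ∀ᵐ t ∂(volume.restrict (Ioo 0 T)),
      eLpNorm (w₀ t) 2 (Ω.measure d) ≤ besovNorm Ω β 2 (v t) := by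
    filter_upwards [hsl] with t ht
    rw [← eLpNorm_congr_ae (hac.ae_le ht)]
    exact eLpNorm_le_besovNorm
  have hfin : ∀ (q : ℝ) (r : ℝ≥0∞) (B : ℝ → ℝ≥0∞), 0 < q → ENNReal.ofReal q ≤ r →
      eLpNorm B r (volume.restrict (Ioo 0 T)) < ⊤ → (∀ᵐ t ∂(volume.restrict (Ioo 0 T)),
        eLpNorm (w₀ t) (ENNReal.ofReal q) (Ω.measure d) ≤ B t) →
      ∀ᵐ t ∂(volume.restrict (Ioo 0 T)), eLpNorm (w₀ t) (ENNReal.ofReal q) (Ω.measure d) < ⊤ := by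
    intro q r B hq hqr hB hle
    have hq0 : ENNReal.ofReal q ≠ 0 := (ENNReal.ofReal_pos.2 hq).ne'
    have h3 := setLIntegral_rpow_le_of_le
      (measurable_eLpNorm_slice (Ω := Ω) hw₀m hq0 ENNReal.ofReal_ne_top) hle hq hqr univ
    rw [Measure.restrict_univ] at h3
    have h4 := h3.trans_lt (ENNReal.mul_lt_top (ENNReal.rpow_lt_top_of_nonneg hq.le hB.ne)
      (ENNReal.rpow_lt_top_of_nonneg (by
        rw [sub_nonneg]
        by_cases hr : r = ⊤
        · simp [hr]
        · have : q ≤ r.toReal := (ENNReal.ofReal_le_iff_le_toReal hr).1 hqr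
          exact div_le_one_of_le₀ this (hq.le.trans this)) (measure_ne_top _ _)))
    have h5 := ae_lt_top ((measurable_eLpNorm_slice (Ω := Ω) hw₀m hq0
      ENNReal.ofReal_ne_top).pow_const q) h4.ne
    filter_upwards [h5] with t ht
    exact (ENNReal.rpow_lt_top_iff_of_pos hq).1 ht
  have hGae : ∀ᵐ t ∂(volume.restrict (Ioo 0 T)), t ∈ G := by
    have h2 := hfin 2 _ _ two_pos hqr2 hv2.norm_lt_top (by simpa using hle2)
    have h3 := hfin 3 _ _ three_pos hqr3 hv3.norm_lt_top (by simpa using hle3)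
    simp only [ENNReal.ofReal_ofNat] at h2 h3
    filter_upwards [h2, h3, ae_restrict_mem measurableSet_Ioo] with t h2 h3 h
    exact ⟨h, h2, h3⟩
  set w : ℝ → Space d → Space d := G.indicator w₀ with hw
  have hwG : ∀ t ∈ G, w t = w₀ t := fun t ht => indicator_of_mem ht _
  have hwn : ∀ t ∉ G, w t = 0 := fun t ht => indicator_of_notMem ht _
  have hwm : StronglyMeasurable (Function.uncurry w) := by
    have : Function.uncurry w = (Prod.fst ⁻¹' G).indicator (Function.uncurry w₀) := by
      funext ⟨t, x⟩
      by_cases ht : t ∈ G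
      · rw [indicator_of_mem (by exact ht)]
        simp [hwG t ht]
      · rw [indicator_of_notMem (by exact ht)]
        simp [hwn t ht]
    rw [this]
    exact hw₀m.indicator (measurable_fst hGm)
  have hw0 : ∀ t ∉ Ioo 0 T, w t = 0 := fun t ht => hwn t fun h => ht h.1
  have hwper : ∀ t, Ω.IsFunctionOn (w t) := fun t => by
    by_cases ht : t ∈ G
    · rw [hwG t ht]; exact hw₀p t
    · rw [hwn t ht]; exact isFunctionOn_const Ω (0 : Space d)
  have hvwp : ∀ᵐ z ∂((volume.restrict (Ioo 0 T)).prod (volume : Measure (Space d))),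
      v z.1 z.2 = w z.1 z.2 := by
    have h1 : ∀ᵐ z ∂((volume.restrict (Ioo 0 T)).prod (volume : Measure (Space d))), z.1 ∈ G :=
      Measure.quasiMeasurePreserving_fst.ae hGae
    filter_upwards [hw₀v, h1] with z hz hz1
    rw [hwG _ hz1, hz]
  have hvw : ∀ᵐ t ∂(volume.restrict (Ioo 0 T)), v t =ᵐ[volume] w t :=
    Measure.ae_ae_of_ae_prod hvwp
  have hp2 : MemLp (Function.uncurry w) 2 (volume.prod (Ω.measure d)) := by
    have := memLp_prod_of_slices (Ω := Ω) hwm hw0 two_pos hqr2 hv2.norm_lt_top (by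
      filter_upwards [hle2, hGae] with t ht ht2
      rw [hwG t ht2]
      simpa using ht)
    simpa using this
  have hp3 : MemLp (Function.uncurry w) 3 (volume.prod (Ω.measure d)) := by
    have := memLp_prod_of_slices (Ω := Ω) hwm hw0 three_pos hqr3 hv3.norm_lt_top (by
      filter_upwards [hle3, hGae] with t ht ht2
      rw [hwG t ht2]
      simpa using ht)
    simpa using this
  refine ⟨w, ⟨hwm, hwper, hw0, fun t => ?_, fun t => ?_, hp2, hp3, ?_, ?_, ?_⟩, hvw⟩
  · refine ⟨(slice_stronglyMeasurable hwm t).aestronglyMeasurable, ?_⟩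
    by_cases ht : t ∈ G
    · rw [hwG t ht]; exact ht.2.1
    · rw [hwn t ht]; simp
  · refine ⟨(slice_stronglyMeasurable hwm t).aestronglyMeasurable, ?_⟩
    by_cases ht : t ∈ G
    · rw [hwG t ht]; exact ht.2.2
    · rw [hwn t ht]; simp
  · intro ψ hψ g hg hdiv y
    have hgy : IsSpaceTest (fun x => g (x - y)) := by
      simpa only [sub_eq_add_neg] using hg.comp_add_right (-y)
    have hD : ∀ x, fderiv ℝ (fun x => g (x - y)) x = fderiv ℝ g (x - y) := fun x => by
      simp only [sub_eq_add_neg, fderiv_comp_add_right]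
    have h := integral_momentumDensity hv hψ hgy (fun x => by
      have := hdiv (x - y)
      simpa only [divergence, hD] using this)
    refine Eq.trans (integral_congr_ae ?_) h
    filter_upwards [hvw] with t ht
    rw [← integral_add_left_eq_self (momentumDensity v ψ (fun x => g (x - y)) t) y]
    refine integral_congr_ae ?_
    filter_upwards [(measurePreserving_add_left (volume : Measure (Space d)) y).quasiMeasurePreserving.ae ht]
      with z hz
    rw [momentumDensity, hD, hz, add_sub_cancel_left]
  · intro q hq
    have hy : ∀ y : Space d, ∀ᵐ t, ∫ z, fderiv ℝ q z (w t (y - z)) = 0 := fun y => by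
      have h := ae_integral_fderiv_eq_zero hv (hq.comp_sub_left y)
      filter_upwards [h, (ae_restrict_iff' measurableSet_Ioo).1 hvw] with t ht ht2
      by_cases htI : t ∈ Ioo 0 T
      · rw [← neg_eq_zero, ← ht htI, ← integral_neg, ← integral_sub_left_eq_self _ volume y]
        refine integral_congr_ae ?_
        filter_upwards [ht2 htI] with x hx
        rw [sub_sub_cancel, ← hx]
        have : HasFDerivAt (fun x => q (y - x)) (-(fderiv ℝ q (y - x))) x := by
          have h1 := (hq.differentiable (y - x)).hasFDerivAt.comp x
            ((hasFDerivAt_id x).const_sub y)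
          exact h1.congr_fderiv (by ext; simp)
        rw [this.fderiv]
        simp
      · simp [hw0 t htI]
    have hmeas : StronglyMeasurable fun z : ℝ × Space d =>
        ∫ x, fderiv ℝ q x (w z.1 (z.2 - x)) := by
      refine StronglyMeasurable.integral_prod_right' (f := fun z : (ℝ × Space d) × Space d =>
        fderiv ℝ q z.2 (w z.1.1 (z.1.2 - z.2))) ?_
      have h1 : StronglyMeasurable fun z : (ℝ × Space d) × Space d => fderiv ℝ q z.2 :=
        (hq.fderiv.contDiff.continuous.comp continuous_snd).stronglyMeasurable
      have h2 : StronglyMeasurable fun z : (ℝ × Space d) × Space d => w z.1.1 (z.1.2 - z.2) :=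
        hwm.comp_measurable (f := Function.uncurry w)
          (g := fun z : (ℝ × Space d) × Space d => (z.1.1, z.1.2 - z.2)) (by fun_prop)
      exact isBoundedBilinearMap_apply.continuous.comp_stronglyMeasurable (h1.prodMk h2)
    refine (Measure.ae_ae_comm (p := fun (t : ℝ) (y : Space d) =>
      ∫ z, fderiv ℝ q z (w t (y - z)) = 0) ?_).2 (Eventually.of_forall hy)
    exact hmeas.measurable (measurableSet_singleton 0)
  -- Constants are admissible test fields on the torus, which gives conservation of the mean.
  · rintro rfl ψ hψ e
    have h := hv.momentum _ (isTestFunction_torus hψ (contDiff_const (c := e))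
      (isFunctionOn_const _ e)) (fun t x => by simp [divergence])
    have hμ : (volume : Measure (ℝ × Space d)).restrict (Ioo 0 T ×ˢ Domain.torus.cell d)
        = (volume.restrict (Ioo 0 T)).prod (Domain.torus.measure d) := by
      rw [Measure.volume_eq_prod, ← Measure.prod_restrict]; rfl
    have := isFiniteMeasure_torus d
    have hae : ∀ᵐ z ∂((volume.restrict (Ioo 0 T)).prod (Domain.torus.measure d)),
        v z.1 z.2 = w z.1 z.2 :=
      (Measure.prod_mono le_rfl Measure.restrict_le_self).absolutelyContinuous.ae_le hvwp
    obtain ⟨C, hC0, hC, hC'⟩ := hψ.bounded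
    have hwi : Integrable (Function.uncurry w)
        ((volume.restrict (Ioo 0 T)).prod (Domain.torus.measure d)) :=
      (hp2.mono_measure (Measure.prod_mono Measure.restrict_le_self le_rfl)).integrable
        (by norm_num)
    have hint : Integrable (fun z : ℝ × Space d => deriv ψ z.1 * inner ℝ (w z.1 z.2) e)
        ((volume.restrict (Ioo 0 T)).prod (Domain.torus.measure d)) := by
      refine (hwi.inner_const (𝕜 := ℝ) e).bdd_mul (c := C)
        (hψ.continuous_deriv.comp continuous_fst).aestronglyMeasurable
        (Eventually.of_forall fun z => hC' _)
    rw [hμ] at h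
    refine Eq.trans ?_ h
    rw [integral_congr_ae (g := fun z : ℝ × Space d =>
      deriv ψ z.1 * inner ℝ (w z.1 z.2) e), integral_prod _ hint]
    · simp only [integral_const_mul]
    · filter_upwards [hae] with z hz
      rw [deriv_smul_const hψ.differentiable.differentiableAt, hz]
      simp [inner_smul_right]

/-! ### Spatial correlations -/

/-- A measurable field on the domain belonging to `L² ∩ L³`. -/
structure SpaceField {d : ℕ} (Ω : Domain) (u : Space d → Space d) : Prop where
  stronglyMeasurable : StronglyMeasurable u
  isFunctionOn : Ω.IsFunctionOn u
  memLp_two : MemLp u 2 (Ω.measure d)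
  memLp_three : MemLp u 3 (Ω.measure d)

lemma EulerField.spaceField {d : ℕ} {Ω : Domain} {T : ℝ} {w : ℝ → Space d → Space d}
    (hw : EulerField Ω T w) (t : ℝ) : SpaceField Ω (w t) :=
  ⟨slice_stronglyMeasurable hw.stronglyMeasurable t, hw.isFunctionOn t, hw.memLp_two t,
    hw.memLp_three t⟩

/-- The `n`-th power of the `L^n` norm of `u` over the domain. -/
def lpEnergy {d : ℕ} (Ω : Domain) (n : ℕ) (u : Space d → Space d) : ℝ :=
  ∫ y, ‖u y‖ ^ n ∂(Ω.measure d)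

/-- The correlation `∫ u(y + h) · u'(y) dy`. -/
def corr2 {d : ℕ} (Ω : Domain) (u u' : Space d → Space d) (h : Space d) : ℝ :=
  ∫ y, inner ℝ (u (y + h)) (u' y) ∂(Ω.measure d)

/-- The vector-valued correlation `∫ (u(y + h) · u'(y)) u(y + h) dy`. -/
def corr3 {d : ℕ} (Ω : Domain) (u u' : Space d → Space d) (h : Space d) : Space d :=
  ∫ y, (inner ℝ (u (y + h)) (u' y) : ℝ) • u (y + h) ∂(Ω.measure d)

lemma lpEnergy_nonneg {d : ℕ} (Ω : Domain) (n : ℕ) (u : Space d → Space d) :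
    0 ≤ lpEnergy Ω n u := integral_nonneg fun _ => by positivity

/-- Young's inequality with a parameter, the small constant on the first factor. -/
lemma pow_mul_le_young {x y η : ℝ} (hx : 0 ≤ x) (hy : 0 ≤ y) (hη : 0 < η) (m : ℕ) :
    x ^ m * y ≤ η * x ^ (m + 1) + η⁻¹ ^ m * y ^ (m + 1) := by
  rcases le_total y (η * x) with h | h
  · have h1 : x ^ m * y ≤ x ^ m * (η * x) := mul_le_mul_of_nonneg_left h (by positivity)
    have h2 : 0 ≤ η⁻¹ ^ m * y ^ (m + 1) := by positivity
    calc x ^ m * y ≤ x ^ m * (η * x) := h1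
      _ = η * x ^ (m + 1) := by ring
      _ ≤ _ := by linarith
  · have h1 : x ≤ η⁻¹ * y := by
      rw [inv_mul_eq_div, le_div_iff₀ hη]; linarith
    have h2 : x ^ m * y ≤ (η⁻¹ * y) ^ m * y :=
      mul_le_mul_of_nonneg_right (pow_le_pow_left₀ hx h1 m) hy
    have h3 : 0 ≤ η * x ^ (m + 1) := by positivity
    calc x ^ m * y ≤ (η⁻¹ * y) ^ m * y := h2
      _ = η⁻¹ ^ m * y ^ (m + 1) := by ring
      _ ≤ _ := by linarith

/-- Young's inequality with a parameter, the small constant on the second factor. -/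
lemma pow_mul_le_young' {x y η : ℝ} (hx : 0 ≤ x) (hy : 0 ≤ y) (hη : 0 < η) (hη1 : η ≤ 1) {m : ℕ}
    (hm : 1 ≤ m) :
    x ^ m * y ≤ η * y ^ (m + 1) + η⁻¹ ^ m * x ^ (m + 1) := by
  rcases le_total x (η * y) with h | h
  · have h1 : x ^ m * y ≤ (η * y) ^ m * y :=
      mul_le_mul_of_nonneg_right (pow_le_pow_left₀ hx h m) hy
    have h2 : 0 ≤ η⁻¹ ^ m * x ^ (m + 1) := by positivity
    have h3 : η ^ m ≤ η := by simpa using pow_le_pow_of_le_one hη.le hη1 hm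
    calc x ^ m * y ≤ (η * y) ^ m * y := h1
      _ = η ^ m * y ^ (m + 1) := by ring
      _ ≤ η * y ^ (m + 1) := mul_le_mul_of_nonneg_right h3 (by positivity)
      _ ≤ _ := by linarith
  · have h1 : y ≤ η⁻¹ * x := by
      rw [inv_mul_eq_div, le_div_iff₀ hη]; linarith
    have h2 : x ^ m * y ≤ x ^ m * (η⁻¹ * x) := mul_le_mul_of_nonneg_left h1 (by positivity)
    have h3 : 0 ≤ η * y ^ (m + 1) := by positivity
    have h4 : η⁻¹ ≤ η⁻¹ ^ m := by
      simpa using pow_le_pow_right₀ ((one_le_inv₀ hη).2 hη1) hm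
    calc x ^ m * y ≤ x ^ m * (η⁻¹ * x) := h2
      _ = η⁻¹ * x ^ (m + 1) := by ring
      _ ≤ η⁻¹ ^ m * x ^ (m + 1) := mul_le_mul_of_nonneg_right h4 (by positivity)
      _ ≤ _ := by linarith

lemma pow_mul_le_add {x y : ℝ} (hx : 0 ≤ x) (hy : 0 ≤ y) (m : ℕ) :
    x ^ m * y ≤ x ^ (m + 1) + y ^ (m + 1) := by
  simpa using pow_mul_le_young hx hy one_pos m

section field
variable {d : ℕ} {Ω : Domain} {u u' : Space d → Space d}

lemma SpaceField.integrable_pow (hu : SpaceField Ω u) {n : ℕ} (hn : n = 2 ∨ n = 3) :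
    Integrable (fun y => ‖u y‖ ^ n) (Ω.measure d) := by
  rcases hn with rfl | rfl
  · exact hu.memLp_two.integrable_norm_pow (by norm_num)
  · exact hu.memLp_three.integrable_norm_pow (by norm_num)

lemma SpaceField.integrable_pow_translate (hu : SpaceField Ω u) {n : ℕ} (hn : n = 2 ∨ n = 3)
    (h : Space d) : Integrable (fun y => ‖u (y + h)‖ ^ n) (Ω.measure d) :=
  integrable_translate (f := fun y => ‖u y‖ ^ n) (hu.stronglyMeasurable.norm.pow n)
    (hu.isFunctionOn.comp (fun b => ‖b‖ ^ n)) (hu.integrable_pow hn) h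

lemma SpaceField.integral_pow_translate (hu : SpaceField Ω u) (n : ℕ) (h : Space d) :
    ∫ y, ‖u (y + h)‖ ^ n ∂(Ω.measure d) = lpEnergy Ω n u :=
  integral_translate (f := fun y => ‖u y‖ ^ n) (hu.isFunctionOn.comp (fun b => ‖b‖ ^ n)) h

lemma SpaceField.translate_stronglyMeasurable (hu : SpaceField Ω u) (h : Space d) :
    StronglyMeasurable fun y => u (y + h) :=
  hu.stronglyMeasurable.comp_measurable (measurable_add_const h)

lemma SpaceField.integrable_of_le (hu : SpaceField Ω u) (hu' : SpaceField Ω u') {m : ℕ}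
    (hm : m = 1 ∨ m = 2) {G : Type*} [NormedAddCommGroup G] {f : Space d → G} {h : Space d} {C : ℝ}
    (hC : 0 ≤ C)
    (hf : StronglyMeasurable f) (hle : ∀ y, ‖f y‖ ≤ C * (‖u (y + h)‖ ^ m * ‖u' y‖)) :
    Integrable f (Ω.measure d) := by
  have hn : m + 1 = 2 ∨ m + 1 = 3 := by omega
  refine (((hu.integrable_pow_translate hn h).add (hu'.integrable_pow hn)).const_mul C).mono'
    hf.aestronglyMeasurable (Eventually.of_forall fun y => (hle y).trans ?_)
  exact mul_le_mul_of_nonneg_left (pow_mul_le_add (norm_nonneg _) (norm_nonneg _) m) hC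

lemma SpaceField.integral_pow_mul_le (hu : SpaceField Ω u) (hu' : SpaceField Ω u') {m : ℕ}
    (hm : m = 1 ∨ m = 2) {h : Space d} :
    ∫ y, ‖u (y + h)‖ ^ m * ‖u' y‖ ∂(Ω.measure d) ≤ lpEnergy Ω (m + 1) u + lpEnergy Ω (m + 1) u' := by
  have hn : m + 1 = 2 ∨ m + 1 = 3 := by omega
  rw [← hu.integral_pow_translate (m + 1) h, lpEnergy,
    ← integral_add (hu.integrable_pow_translate hn h) (hu'.integrable_pow hn)]
  refine integral_mono_of_nonneg (Eventually.of_forall fun y => by positivity)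
    ((hu.integrable_pow_translate hn h).add (hu'.integrable_pow hn))
    (Eventually.of_forall fun y => ?_)
  exact pow_mul_le_add (norm_nonneg _) (norm_nonneg _) m

lemma norm_corr2_integrand (a b : Space d) : ‖(inner ℝ b a : ℝ)‖ ≤ ‖b‖ ^ 1 * ‖a‖ := by
  simpa using norm_inner_le_norm (𝕜 := ℝ) b a

lemma norm_corr3_integrand (a b : Space d) : ‖(inner ℝ b a : ℝ) • b‖ ≤ ‖b‖ ^ 2 * ‖a‖ := by
  rw [norm_smul]
  calc ‖(inner ℝ b a : ℝ)‖ * ‖b‖ ≤ (‖b‖ * ‖a‖) * ‖b‖ :=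
        mul_le_mul_of_nonneg_right (norm_inner_le_norm b a) (norm_nonneg _)
    _ = ‖b‖ ^ 2 * ‖a‖ := by ring

lemma SpaceField.integrable_corr2 (hu : SpaceField Ω u) (hu' : SpaceField Ω u') (h : Space d) :
    Integrable (fun y => (inner ℝ (u (y + h)) (u' y) : ℝ)) (Ω.measure d) :=
  hu.integrable_of_le hu' (Or.inl rfl) zero_le_one
    ((hu.translate_stronglyMeasurable h).inner hu'.stronglyMeasurable)
    fun y => by rw [one_mul]; exact norm_corr2_integrand _ _

lemma SpaceField.integrable_corr3 (hu : SpaceField Ω u) (hu' : SpaceField Ω u') (h : Space d) :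
    Integrable (fun y => (inner ℝ (u (y + h)) (u' y) : ℝ) • u (y + h)) (Ω.measure d) :=
  hu.integrable_of_le hu' (Or.inr rfl) zero_le_one
    (((hu.translate_stronglyMeasurable h).inner (𝕜 := ℝ) hu'.stronglyMeasurable).smul
      (hu.translate_stronglyMeasurable h))
    fun y => by rw [one_mul]; exact norm_corr3_integrand _ _

lemma SpaceField.norm_corr2_le (hu : SpaceField Ω u) (hu' : SpaceField Ω u') (h : Space d) :
    ‖corr2 Ω u u' h‖ ≤ ∫ y, ‖u (y + h)‖ ^ 1 * ‖u' y‖ ∂(Ω.measure d) := by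
  refine norm_integral_le_of_norm_le ?_ (Eventually.of_forall fun y => norm_corr2_integrand _ _)
  exact hu.integrable_of_le hu' (Or.inl rfl) zero_le_one
    (((hu.translate_stronglyMeasurable h).norm.pow 1).mul hu'.stronglyMeasurable.norm)
    fun y => by rw [one_mul, Real.norm_of_nonneg (by positivity)]

lemma SpaceField.norm_corr3_le (hu : SpaceField Ω u) (hu' : SpaceField Ω u') (h : Space d) :
    ‖corr3 Ω u u' h‖ ≤ ∫ y, ‖u (y + h)‖ ^ 2 * ‖u' y‖ ∂(Ω.measure d) := by
  refine norm_integral_le_of_norm_le ?_ (Eventually.of_forall fun y => norm_corr3_integrand _ _)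
  exact hu.integrable_of_le hu' (Or.inr rfl) zero_le_one
    (((hu.translate_stronglyMeasurable h).norm.pow 2).mul hu'.stronglyMeasurable.norm)
    fun y => by rw [one_mul, Real.norm_of_nonneg (by positivity)]

lemma SpaceField.norm_corr2_le_add (hu : SpaceField Ω u) (hu' : SpaceField Ω u') (h : Space d) :
    ‖corr2 Ω u u' h‖ ≤ lpEnergy Ω 2 u + lpEnergy Ω 2 u' :=
  (hu.norm_corr2_le hu' h).trans (hu.integral_pow_mul_le hu' (Or.inl rfl))

lemma SpaceField.norm_corr3_le_add (hu : SpaceField Ω u) (hu' : SpaceField Ω u') (h : Space d) :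
    ‖corr3 Ω u u' h‖ ≤ lpEnergy Ω 3 u + lpEnergy Ω 3 u' :=
  (hu.norm_corr3_le hu' h).trans (hu.integral_pow_mul_le hu' (Or.inr rfl))

lemma SpaceField.corr2_neg (hu : SpaceField Ω u) (hu' : SpaceField Ω u') (h : Space d) :
    corr2 Ω u u' (-h) = corr2 Ω u' u h := by
  unfold corr2
  rw [← integral_translate (f := fun y => (inner ℝ (u (y + -h)) (u' y) : ℝ))
    ((hu.isFunctionOn.translate (-h)).comp₂ hu'.isFunctionOn (fun a b => (inner ℝ a b : ℝ))) h]
  simp only [add_neg_cancel_right, real_inner_comm]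

/-! ### Mixing of translations on the whole space -/

lemma tendsto_tail_energy {d : ℕ} {u : Space d → Space d} {n : ℕ}
    (hu : Integrable (fun y => ‖u y‖ ^ n)) :
    Tendsto (fun r : ℝ => ∫ y, {y : Space d | r ≤ ‖y‖}.indicator (fun y => ‖u y‖ ^ n) y)
      atTop (𝓝 0) := by
  have hms : ∀ r : ℝ, MeasurableSet {y : Space d | r ≤ ‖y‖} := fun r =>
    measurableSet_le measurable_const measurable_norm
  have : Tendsto (fun r : ℝ => ∫ y, {y : Space d | r ≤ ‖y‖}.indicator (fun y => ‖u y‖ ^ n) y)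
      atTop (𝓝 (∫ _y : Space d, (0 : ℝ))) := by
    refine tendsto_integral_filter_of_dominated_convergence (fun y => ‖u y‖ ^ n)
      (Eventually.of_forall fun r => (hu.indicator (hms r)).aestronglyMeasurable)
      (Eventually.of_forall fun r => Eventually.of_forall fun y => ?_) hu
      (Eventually.of_forall fun y => ?_)
    · refine (norm_indicator_le_norm_self _ _).trans (le_of_eq ?_)
      rw [Real.norm_of_nonneg (by positivity)]
    · refine tendsto_const_nhds.congr' ?_
      filter_upwards [eventually_gt_atTop ‖y‖] with r hr
      rw [indicator_of_notMem]
      simpa using hr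
  simpa using this

/-- Distant translates decouple: for `‖h‖ ≥ 2r`, either `y` or `y + h` lies outside the ball of
radius `r`, where the corresponding factor has small energy. -/
lemma tendsto_integral_pow_mul_translate {u u' : Space d → Space d} (hu : SpaceField .whole u)
    (hu' : SpaceField .whole u') {m : ℕ} (hm : m = 1 ∨ m = 2) :
    Tendsto (fun h => ∫ y, ‖u (y + h)‖ ^ m * ‖u' y‖ ∂(Domain.whole.measure d))
      (comap norm atTop) (𝓝 0) := by
  have hn : m + 1 = 2 ∨ m + 1 = 3 := by omega
  have hμ : Domain.whole.measure d = volume := by simp [Domain.measure, Domain.cell]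
  have hui := hu.integrable_pow hn
  have hui' := hu'.integrable_pow hn
  rw [hμ] at hui hui'
  have hms : ∀ r : ℝ, MeasurableSet {y : Space d | r ≤ ‖y‖} := fun r =>
    measurableSet_le measurable_const measurable_norm
  set N := lpEnergy .whole (m + 1) u + lpEnergy .whole (m + 1) u' with hN
  have hN0 : 0 ≤ N := add_nonneg (lpEnergy_nonneg _ _ _) (lpEnergy_nonneg _ _ _)
  rw [Metric.tendsto_nhds]
  intro ε hε
  set η : ℝ := min 1 (ε / (2 * (N + 1))) with hη
  have hη0 : 0 < η := lt_min one_pos (by positivity)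
  have hη1 : η ≤ 1 := min_le_left _ _
  have hηN : η * N < ε / 2 := by
    calc η * N ≤ ε / (2 * (N + 1)) * N := mul_le_mul_of_nonneg_right (min_le_right _ _) hN0
      _ < ε / (2 * (N + 1)) * (N + 1) := mul_lt_mul_of_pos_left (by linarith) (by positivity)
      _ = ε / 2 := by field_simp
  have htail := ((tendsto_tail_energy hui).add (tendsto_tail_energy hui')).const_mul (η⁻¹ ^ m)
  rw [add_zero, mul_zero] at htail
  obtain ⟨r, hr⟩ := (htail.eventually (gt_mem_nhds (half_pos hε))).exists
  have hev : ∀ᶠ h : Space d in comap norm atTop, 2 * r ≤ ‖h‖ :=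
    tendsto_comap.eventually (eventually_ge_atTop (2 * r))
  filter_upwards [hev] with h hh
  rw [Real.dist_eq, sub_zero, abs_of_nonneg (integral_nonneg fun y => by positivity)]
  set f : Space d → ℝ := {y : Space d | r ≤ ‖y‖}.indicator (fun y => ‖u y‖ ^ (m + 1)) with hf
  set f' : Space d → ℝ := {y : Space d | r ≤ ‖y‖}.indicator (fun y => ‖u' y‖ ^ (m + 1)) with hf'
  have hfi : Integrable f := hui.indicator (hms r)
  have hfi' : Integrable f' := hui'.indicator (hms r)
  have hfih : Integrable fun y => f (y + h) := hfi.comp_add_right h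
  have h1 : Integrable (fun y => ‖u (y + h)‖ ^ (m + 1)) := hui.comp_add_right h
  have hf0 : ∀ y, 0 ≤ f y := fun y => indicator_nonneg (fun _ _ => by positivity) _
  have hf0' : ∀ y, 0 ≤ f' y := fun y => indicator_nonneg (fun _ _ => by positivity) _
  have hpt : ∀ y, ‖u (y + h)‖ ^ m * ‖u' y‖ ≤ η * (‖u (y + h)‖ ^ (m + 1) + ‖u' y‖ ^ (m + 1))
      + η⁻¹ ^ m * (f (y + h) + f' y) := fun y => by
    have p0 : 0 ≤ η⁻¹ ^ m := by positivity
    by_cases hy : r ≤ ‖y‖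
    · have e : f' y = ‖u' y‖ ^ (m + 1) := indicator_of_mem (by exact hy) _
      have := pow_mul_le_young (norm_nonneg (u (y + h))) (norm_nonneg (u' y)) hη0 m
      have q1 := mul_nonneg p0 (hf0 (y + h))
      have q2 : 0 ≤ η * ‖u' y‖ ^ (m + 1) := by positivity
      rw [e]
      linarith
    · have hyh : r ≤ ‖y + h‖ := by
        have := norm_sub_le (y + h) y
        rw [add_sub_cancel_left] at this
        linarith
      have e : f (y + h) = ‖u (y + h)‖ ^ (m + 1) := indicator_of_mem (by exact hyh) _
      have := pow_mul_le_young' (norm_nonneg (u (y + h))) (norm_nonneg (u' y)) hη0 hη1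
        (m := m) (by omega)
      have q1 := mul_nonneg p0 (hf0' y)
      have q2 : 0 ≤ η * ‖u (y + h)‖ ^ (m + 1) := by positivity
      rw [e]
      linarith
  have i1 : Integrable fun y => η * (‖u (y + h)‖ ^ (m + 1) + ‖u' y‖ ^ (m + 1)) :=
    (h1.add hui').const_mul η
  have i2 : Integrable fun y => η⁻¹ ^ m * (f (y + h) + f' y) := (hfih.add hfi').const_mul _
  rw [hμ]
  calc ∫ y, ‖u (y + h)‖ ^ m * ‖u' y‖
      ≤ ∫ y, (η * (‖u (y + h)‖ ^ (m + 1) + ‖u' y‖ ^ (m + 1)) + η⁻¹ ^ m * (f (y + h) + f' y)) :=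
        integral_mono_of_nonneg (Eventually.of_forall fun y => by positivity)
          (i1.add i2)
          (Eventually.of_forall hpt)
    _ = η * N + η⁻¹ ^ m * ((∫ y, f y) + ∫ y, f' y) := by
        rw [integral_add i1 i2,
          integral_const_mul, integral_const_mul, integral_add h1 hui', integral_add hfih hfi',
          integral_add_right_eq_self f h,
          integral_add_right_eq_self (fun y => ‖u y‖ ^ (m + 1)) h]
        simp [hN, lpEnergy, hμ]
    _ < ε := by linarith

lemma tendsto_corr2_whole {u u' : Space d → Space d} (hu : SpaceField .whole u)
    (hu' : SpaceField .whole u') : Tendsto (corr2 .whole u u') (comap norm atTop) (𝓝 0) :=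
  squeeze_zero_norm (hu.norm_corr2_le hu')
    (tendsto_integral_pow_mul_translate hu hu' (Or.inl rfl))

lemma tendsto_corr3_whole {u u' : Space d → Space d} (hu : SpaceField .whole u)
    (hu' : SpaceField .whole u') : Tendsto (corr3 .whole u u') (comap norm atTop) (𝓝 0) :=
  squeeze_zero_norm (hu.norm_corr3_le hu')
    (tendsto_integral_pow_mul_translate hu hu' (Or.inr rfl))

end field

/-! ### Integrability of densities against compactly supported kernels -/

/-- A continuous density `φ(z, b, a)`, supported in `‖z‖ ≤ R` and of size `‖b‖^n + ‖a‖^n`. It is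
evaluated at `b = u(y + z)` and `a = u'(y)`. -/
structure IsDensity {d : ℕ} (n : ℕ) (R C : ℝ) (φ : Space d → Space d → Space d → ℝ) : Prop where
  continuous : Continuous fun x : Space d × Space d × Space d => φ x.1 x.2.1 x.2.2
  nonneg : 0 ≤ C
  le : ∀ z b a, ‖φ z b a‖ ≤ (Metric.closedBall (0 : Space d) R).indicator (fun _ => C) z
    * (‖b‖ ^ n + ‖a‖ ^ n)

section density
variable {d : ℕ} {Ω : Domain} {X : Type*} [MeasurableSpace X] {π : Measure X}

lemma integrable_weight_translate {a : X → Space d → Space d}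
    (ha : StronglyMeasurable (Function.uncurry a)) (hf : ∀ p, SpaceField Ω (a p)) {n : ℕ}
    (hn : n = 2 ∨ n = 3) {h : X → Space d} (hh : Measurable h) {κ : X → ℝ}
    (hκ : StronglyMeasurable κ) (hi : Integrable (fun p => κ p * lpEnergy Ω n (a p)) π) :
    Integrable (fun x : X × Space d => κ x.1 * ‖a x.1 (x.2 + h x.1)‖ ^ n) (π.prod (Ω.measure d)) := by
  have hm : StronglyMeasurable fun x : X × Space d => κ x.1 * ‖a x.1 (x.2 + h x.1)‖ ^ n := by
    have h1 : StronglyMeasurable fun x : X × Space d => a x.1 (x.2 + h x.1) :=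
      ha.comp_measurable (g := fun x : X × Space d => (x.1, x.2 + h x.1)) (by fun_prop)
    exact (hκ.comp_measurable measurable_fst).mul (h1.norm.pow n)
  rw [integrable_prod_iff hm.aestronglyMeasurable]
  refine ⟨Eventually.of_forall fun p => ((hf p).integrable_pow_translate hn (h p)).const_mul (κ p), ?_⟩
  refine hi.norm.congr (Eventually.of_forall fun p => ?_)
  simp only [norm_mul, norm_pow, norm_norm]
  rw [integral_const_mul, (hf p).integral_pow_translate, Real.norm_of_nonneg (lpEnergy_nonneg _ _ _)]

lemma integrable_density [SFinite π] {u u' : X → Space d → Space d}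
    (hum : StronglyMeasurable (Function.uncurry u)) (hu : ∀ p, SpaceField Ω (u p))
    (hum' : StronglyMeasurable (Function.uncurry u')) (hu' : ∀ p, SpaceField Ω (u' p))
    {z : X → Space d} (hz : Measurable z) {n : ℕ} (hn : n = 2 ∨ n = 3) {R C : ℝ}
    {φ : Space d → Space d → Space d → ℝ} (hφ : IsDensity n R C φ)
    {χ : X → ℝ} (hχ : StronglyMeasurable χ) {A : ℝ} (hA : ∀ p, ‖χ p‖ ≤ A)
    (hi : Integrable (fun p => (Metric.closedBall (0 : Space d) R).indicator (fun _ => C) (z p)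
      * lpEnergy Ω n (u p)) π)
    (hi' : Integrable (fun p => (Metric.closedBall (0 : Space d) R).indicator (fun _ => C) (z p)
      * lpEnergy Ω n (u' p)) π) :
    Integrable (fun x : X × Space d => χ x.1 * φ (z x.1) (u x.1 (x.2 + z x.1)) (u' x.1 x.2))
      (π.prod (Ω.measure d)) := by
  have hκ : StronglyMeasurable fun p => (Metric.closedBall (0 : Space d) R).indicator
      (fun _ => C) (z p) :=
    (stronglyMeasurable_const.indicator Metric.isClosed_closedBall.measurableSet).comp_measurable hz
  have i1 := integrable_weight_translate hum hu hn hz hκ hi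
  have i2 := integrable_weight_translate hum' hu' hn (h := fun _ => 0) measurable_const hκ hi'
  simp only [add_zero] at i2
  have m1 : StronglyMeasurable fun x : X × Space d => u x.1 (x.2 + z x.1) :=
    hum.comp_measurable (g := fun x : X × Space d => (x.1, x.2 + z x.1)) (by fun_prop)
  have m2 : StronglyMeasurable fun x : X × Space d => z x.1 :=
    (hz.comp measurable_fst).stronglyMeasurable
  have m3 : StronglyMeasurable fun x : X × Space d => φ (z x.1) (u x.1 (x.2 + z x.1)) (u' x.1 x.2) :=
    hφ.continuous.comp_stronglyMeasurable (m2.prodMk (m1.prodMk hum'))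
  refine ((i1.add i2).const_mul A).mono'
    ((hχ.comp_measurable measurable_fst).mul m3).aestronglyMeasurable
    (Eventually.of_forall fun x => ?_)
  have hA0 : 0 ≤ A := (norm_nonneg _).trans (hA x.1)
  have hκ0 : 0 ≤ (Metric.closedBall (0 : Space d) R).indicator (fun _ => C) (z x.1) :=
    indicator_nonneg (fun _ _ => hφ.nonneg) _
  rw [norm_mul]
  refine mul_le_mul (hA _) ((hφ.le _ _ _).trans ?_) (norm_nonneg _) hA0
  rw [Pi.add_apply, ← mul_add]

lemma integrable_ball_weight (R C c : ℝ) : Integrable (fun z : Space d =>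
    (Metric.closedBall (0 : Space d) R).indicator (fun _ => C) z * c) := by
  refine Integrable.mul_const ?_ _
  refine (integrable_indicator_iff Metric.isClosed_closedBall.measurableSet).2 ?_
  exact integrableOn_const measure_closedBall_lt_top.ne

/-- Integrability of a density at fixed times. -/
lemma SpaceField.integrable_density {u u' : Space d → Space d} (hu : SpaceField Ω u)
    (hu' : SpaceField Ω u') {n : ℕ} (hn : n = 2 ∨ n = 3) {R C : ℝ}
    {φ : Space d → Space d → Space d → ℝ} (hφ : IsDensity n R C φ) :
    Integrable (fun x : Space d × Space d => φ x.1 (u (x.2 + x.1)) (u' x.2))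
      (volume.prod (Ω.measure d)) := by
  have := EulerTime.integrable_density (Ω := Ω) (π := (volume : Measure (Space d)))
    (u := fun _ => u) (u' := fun _ => u')
    (hu.stronglyMeasurable.comp_measurable measurable_snd) (fun _ => hu)
    (hu'.stronglyMeasurable.comp_measurable measurable_snd) (fun _ => hu')
    (z := fun z => z) measurable_id hn hφ (χ := fun _ => 1) stronglyMeasurable_const (A := 1)
    (fun _ => by simp) (integrable_ball_weight _ _ _) (integrable_ball_weight _ _ _)
  simpa using this

end density

/-! ### Energy defect and flux of a single field -/

section
variable {d : ℕ} {Ω : Domain} {u u' : Space d → Space d}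

lemma IsSpaceTest.exists_bound {F : Type*} [NormedAddCommGroup F] [NormedSpace ℝ F]
    {g : Space d → F} (hg : IsSpaceTest g) : ∃ R C, 0 ≤ C ∧
      ∀ z, ‖g z‖ ≤ (Metric.closedBall (0 : Space d) R).indicator (fun _ => C) z := by
  obtain ⟨R, -, hR⟩ := exists_radius hg.compact
  obtain ⟨C, hC0, hC⟩ := hg.bounded
  refine ⟨R, C, hC0, fun z => ?_⟩
  by_cases hz : z ∈ Metric.closedBall (0 : Space d) R
  · rw [indicator_of_mem hz]; exact hC z
  · rw [indicator_of_notMem hz]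
    rw [mem_closedBall_zero_iff, not_le] at hz
    rw [hR z hz, norm_zero]

lemma exists_isDensity_apply {n : ℕ} {G : Type*} [NormedAddCommGroup G] [NormedSpace ℝ G]
    {K : Space d → G →L[ℝ] ℝ} (hK : IsSpaceTest K) {P : Space d → Space d → G}
    (hPc : Continuous (Function.uncurry P)) {c : ℝ} (hc : 0 ≤ c)
    (hP : ∀ b a, ‖P b a‖ ≤ c * (‖b‖ ^ n + ‖a‖ ^ n)) :
    ∃ R C, IsDensity n R C (fun z b a => K z (P b a)) := by
  obtain ⟨R, C, hC0, hC⟩ := hK.exists_bound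
  refine ⟨R, C * c, ⟨?_, by positivity, fun z b a => ?_⟩⟩
  · exact (hK.contDiff.continuous.comp continuous_fst).clm_apply (hPc.comp continuous_snd)
  · have h1 : (Metric.closedBall (0 : Space d) R).indicator (fun _ => C * c) z
        = (Metric.closedBall (0 : Space d) R).indicator (fun _ => C) z * c := by
      by_cases hz : z ∈ Metric.closedBall (0 : Space d) R
      · rw [indicator_of_mem hz, indicator_of_mem hz]
      · rw [indicator_of_notMem hz, indicator_of_notMem hz, zero_mul]
    rw [h1, mul_assoc]
    refine (ContinuousLinearMap.le_opNorm _ _).trans ?_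
    exact mul_le_mul (hC z) (hP b a) (norm_nonneg _) ((norm_nonneg _).trans (hC z))

lemma exists_isDensity_mul {n : ℕ} {k : Space d → ℝ} (hk : IsSpaceTest k)
    {P : Space d → Space d → ℝ} (hPc : Continuous (Function.uncurry P)) {c : ℝ} (hc : 0 ≤ c)
    (hP : ∀ b a, ‖P b a‖ ≤ c * (‖b‖ ^ n + ‖a‖ ^ n)) :
    ∃ R C, IsDensity n R C (fun z b a => k z * P b a) := by
  have hK : IsSpaceTest (fun z => ContinuousLinearMap.mul ℝ ℝ (k z)) :=
    ⟨(ContinuousLinearMap.mul ℝ ℝ).contDiff.comp hk.contDiff,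
      hk.compact.comp_left (g := fun r => ContinuousLinearMap.mul ℝ ℝ r) (map_zero _)⟩
  exact exists_isDensity_apply hK hPc hc hP

lemma norm_le_pow_add_pow {G : Type*} [NormedAddCommGroup G] {g : G} {i j n : ℕ} {b a : Space d}
    (hn : i + j = n) (h : ‖g‖ ≤ ‖b‖ ^ i * ‖a‖ ^ j) : ‖g‖ ≤ 1 * (‖b‖ ^ n + ‖a‖ ^ n) := by
  rw [one_mul]
  have hm : ‖b‖ ^ i * ‖a‖ ^ j ≤ max ‖b‖ ‖a‖ ^ n := by
    rw [← hn, pow_add]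
    gcongr
    · exact le_max_left _ _
    · exact le_max_right _ _
  refine (h.trans hm).trans ?_
  rcases le_total ‖b‖ ‖a‖ with hl | hl
  · rw [max_eq_right hl]; linarith [pow_nonneg (norm_nonneg b) n]
  · rw [max_eq_left hl]; linarith [pow_nonneg (norm_nonneg a) n]

/-- Changing variables `(z, y) ↦ (-z, y + z)` exchanges the two fields. -/
lemma SpaceField.integral_density_flip (hu : SpaceField Ω u) (hu' : SpaceField Ω u') {n : ℕ}
    (hn : n = 2 ∨ n = 3) {R C : ℝ} {φ : Space d → Space d → Space d → ℝ}
    (hφ : IsDensity n R C φ) :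
    ∫ x : Space d × Space d, φ x.1 (u (x.2 + x.1)) (u' x.2) ∂(volume.prod (Ω.measure d))
      = ∫ x : Space d × Space d, φ (-x.1) (u x.2) (u' (x.2 + x.1))
        ∂(volume.prod (Ω.measure d)) := by
  have hφ' : IsDensity n R C (fun z b a => φ (-z) a b) := by
    refine ⟨?_, hφ.nonneg, fun z b a => ?_⟩
    · exact hφ.continuous.comp (f := fun x : Space d × Space d × Space d => (-x.1, x.2.2, x.2.1))
        (by fun_prop)
    · have h := hφ.le (-z) a b
      rw [add_comm (‖b‖ ^ n)]
      convert h using 2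
      simp [indicator]
  rw [integral_prod _ (hu.integrable_density hu' hn hφ),
    integral_prod _ (hu'.integrable_density hu hn hφ'),
    ← integral_neg_eq_self]
  refine integral_congr_ae (Eventually.of_forall fun z => ?_)
  have := integral_translate (Ω := Ω) (f := fun y => φ (-z) (u (y + -z)) (u' y))
    ((hu.isFunctionOn.translate (-z)).comp₂ hu'.isFunctionOn (fun b a => φ (-z) b a)) z
  simp only [add_neg_cancel_right] at this
  exact this.symm

/-- If `u'` is divergence free, a gradient kernel applied to `u'` does not contribute. -/
lemma SpaceField.integral_fderiv_apply_eq_zero (hu : SpaceField Ω u) (hu' : SpaceField Ω u')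
    {q : Space d → ℝ} (hq : IsSpaceTest q)
    (hinc : ∀ᵐ y ∂(Ω.measure d), ∫ z, fderiv ℝ q z (u' (y - z)) = 0) {m : ℕ}
    (hm : m = 1 ∨ m = 2) {φ : Space d → ℝ} (hφ : Continuous φ) {c : ℝ} (hc : 0 ≤ c)
    (hφm : ∀ b, ‖φ b‖ ≤ c * ‖b‖ ^ m) :
    ∫ x : Space d × Space d, fderiv ℝ q x.1 (φ (u (x.2 + x.1)) • u' x.2)
      ∂(volume.prod (Ω.measure d)) = 0 := by
  have hn : m + 1 = 2 ∨ m + 1 = 3 := by omega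
  have hbound : ∀ b a : Space d, ‖φ b • a‖ ≤ c * (‖b‖ ^ (m + 1) + ‖a‖ ^ (m + 1)) := fun b a => by
    rw [norm_smul]
    calc ‖φ b‖ * ‖a‖ ≤ c * ‖b‖ ^ m * ‖a‖ := mul_le_mul_of_nonneg_right (hφm b) (norm_nonneg _)
      _ = c * (‖b‖ ^ m * ‖a‖) := by ring
      _ ≤ _ := mul_le_mul_of_nonneg_left (pow_mul_le_add (norm_nonneg _) (norm_nonneg _) m) hc
  obtain ⟨R, C, hD⟩ := exists_isDensity_apply (n := m + 1) hq.fderiv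
    (P := fun b a => φ b • a) (by exact (hφ.comp continuous_fst).smul continuous_snd) hc hbound
  rw [hu.integral_density_flip hu' hn hD]
  have hqn : IsSpaceTest (fun z => fderiv ℝ q (-z)) := by
    simpa using hq.fderiv.comp_sub_left 0
  obtain ⟨R', C', hD'⟩ := exists_isDensity_apply (n := m + 1) hqn
    (P := fun b a => φ a • b) (by exact (hφ.comp continuous_snd).smul continuous_fst) hc
    (fun b a => by rw [add_comm]; exact hbound a b)
  rw [integral_prod_symm _ (hu'.integrable_density hu hn hD')]
  refine integral_eq_zero_of_ae ?_
  filter_upwards [hinc] with y hy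
  simp only [map_smul, smul_eq_mul, integral_const_mul, Pi.zero_apply]
  rw [← integral_neg_eq_self] at hy
  simp only [sub_neg_eq_add] at hy
  rw [hy, mul_zero]

lemma fderiv_neg_of_even {k : Space d → ℝ} (hkd : Differentiable ℝ k) (hke : ∀ z, k (-z) = k z)
    (z : Space d) : fderiv ℝ k (-z) = - fderiv ℝ k z := by
  have h1 : (fun z => k (-z)) = k := funext hke
  have h2 : HasFDerivAt (fun z => k (-z)) (-(fderiv ℝ k (-z))) z :=
    ((hkd (-z)).hasFDerivAt.comp z (hasFDerivAt_id z).neg).congr_fderiv (by ext; simp)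
  rw [h1] at h2
  rw [h2.fderiv, neg_neg]

lemma integral_fderiv_eq_zero_of_even {k : Space d → ℝ} (hkd : Differentiable ℝ k)
    (hke : ∀ z, k (-z) = k z) : ∫ z, fderiv ℝ k z = 0 := by
  have h := integral_neg_eq_self (fderiv ℝ k) (volume : Measure (Space d))
  simp only [fderiv_neg_of_even hkd hke, integral_neg] at h
  have h2 : (2 : ℝ) • ∫ z, fderiv ℝ k z = 0 := by
    rw [two_smul]
    nth_rewrite 1 [← h]
    exact neg_add_cancel _
  exact (smul_eq_zero.1 h2).resolve_left two_ne_zero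

/-- The energy defect of the regularized energy `∫ k(z) ∫ u(y + z) · u(y) dy dz`. -/
theorem SpaceField.integral_mul_corr2_self (hu : SpaceField Ω u) {k : Space d → ℝ}
    (hk : IsSpaceTest k) (hk1 : ∫ z, k z = 1) :
    ∫ z, k z * corr2 Ω u u z = lpEnergy Ω 2 u
      - 1 / 2 * ∫ z, k z * ∫ y, ‖u (y + z) - u y‖ ^ 2 ∂(Ω.measure d) := by
  have hn : (2 : ℕ) = 2 ∨ (2 : ℕ) = 3 := Or.inl rfl
  have hin : Continuous (Function.uncurry fun b a : Space d => (inner ℝ b a : ℝ)) :=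
    continuous_fst.inner continuous_snd
  obtain ⟨R, C, hD⟩ := exists_isDensity_mul (n := 2) hk (P := fun b a => (inner ℝ b a : ℝ))
    hin zero_le_one (fun b a => norm_le_pow_add_pow (i := 1) (j := 1) rfl
      (by simpa using norm_inner_le_norm (𝕜 := ℝ) b a))
  have h1 := (hu.integrable_density hu hn hD).integral_prod_left
  simp only [integral_const_mul] at h1
  have hpt : ∀ z, k z * ∫ y, ‖u (y + z) - u y‖ ^ 2 ∂(Ω.measure d)
      = k z * (2 * lpEnergy Ω 2 u) - 2 * (k z * corr2 Ω u u z) := fun z => by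
    have e1 := hu.integrable_pow_translate hn z
    have e2 := hu.integrable_pow hn
    have e3 := hu.integrable_corr2 hu z
    have : ∀ y, ‖u (y + z) - u y‖ ^ 2
        = (‖u (y + z)‖ ^ 2 + ‖u y‖ ^ 2) - 2 * inner ℝ (u (y + z)) (u y) := fun y => by
      rw [norm_sub_sq_real]; ring
    simp only [this]
    rw [integral_sub (e1.fun_add e2) (e3.const_mul 2), integral_add e1 e2, integral_const_mul,
      hu.integral_pow_translate, corr2]
    simp only [lpEnergy]
    ring
  have hki : Integrable k := hk.contDiff.continuous.integrable_of_hasCompactSupport hk.compact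
  simp only [hpt]
  have h1' : Integrable fun z => k z * corr2 Ω u u z := h1
  rw [integral_sub (hki.mul_const _) (h1'.const_mul 2), integral_mul_const, hk1,
    integral_const_mul]
  ring

/-- The Duchon–Robert representation of the energy flux through the scale of the kernel `k`:
after expanding the cubic expression in the increments, translation invariance and
incompressibility leave only four copies of the flux. -/
theorem SpaceField.integral_fderiv_corr3_self (hu : SpaceField Ω u) {k : Space d → ℝ}
    (hk : IsSpaceTest k) (hke : ∀ z, k (-z) = k z)
    (hinc : ∀ᵐ y ∂(Ω.measure d), ∫ z, fderiv ℝ k z (u (y - z)) = 0) :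
    ∫ z, fderiv ℝ k z (corr3 Ω u u z) = - (1 / 4) * ∫ x : Space d × Space d,
      fderiv ℝ k x.1 (‖u (x.2 + x.1) - u x.2‖ ^ 2 • (u (x.2 + x.1) - u x.2))
        ∂(volume.prod (Ω.measure d)) := by
  have hn : (3 : ℕ) = 2 ∨ (3 : ℕ) = 3 := Or.inr rfl
  have hodd := fderiv_neg_of_even hk.differentiable hke
  have hK := hk.fderiv
  obtain ⟨R1, C1, D1⟩ := exists_isDensity_apply (n := 3) hK (P := fun b _ => ‖b‖ ^ 2 • b)
    (by simp only [Function.uncurry_def]; fun_prop) zero_le_one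
    (fun b a => norm_le_pow_add_pow (i := 3) (j := 0) rfl
      (by rw [norm_smul, norm_pow, norm_norm]; apply le_of_eq; ring))
  obtain ⟨R2, C2, D2⟩ := exists_isDensity_apply (n := 3) hK (P := fun b a => ‖a‖ ^ 2 • b)
    (by simp only [Function.uncurry_def]; fun_prop) zero_le_one
    (fun b a => norm_le_pow_add_pow (i := 1) (j := 2) rfl
      (by rw [norm_smul, norm_pow, norm_norm]; apply le_of_eq; ring))
  obtain ⟨R3, C3, D3⟩ := exists_isDensity_apply (n := 3) hK
    (P := fun b a => (inner ℝ b a : ℝ) • b)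
    (by simp only [Function.uncurry_def]; fun_prop) zero_le_one
    (fun b a => norm_le_pow_add_pow (i := 2) (j := 1) rfl
      (by simpa using norm_corr3_integrand a b))
  obtain ⟨R4, C4, D4⟩ := exists_isDensity_apply (n := 3) hK (P := fun b a => ‖b‖ ^ 2 • a)
    (by simp only [Function.uncurry_def]; fun_prop) zero_le_one
    (fun b a => norm_le_pow_add_pow (i := 2) (j := 1) rfl
      (by rw [norm_smul, norm_pow, norm_norm]; apply le_of_eq; ring))
  obtain ⟨R5, C5, D5⟩ := exists_isDensity_apply (n := 3) hK (P := fun _ a => ‖a‖ ^ 2 • a)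
    (by simp only [Function.uncurry_def]; fun_prop) zero_le_one
    (fun b a => norm_le_pow_add_pow (i := 0) (j := 3) rfl
      (by rw [norm_smul, norm_pow, norm_norm]; apply le_of_eq; ring))
  obtain ⟨R6, C6, D6⟩ := exists_isDensity_apply (n := 3) hK
    (P := fun b a => (inner ℝ b a : ℝ) • a)
    (by simp only [Function.uncurry_def]; fun_prop) zero_le_one
    (fun b a => norm_le_pow_add_pow (i := 1) (j := 2) rfl (by
      have := norm_corr3_integrand b a
      rw [real_inner_comm] at this
      rw [pow_one, mul_comm]; exact this))
  have I1 := hu.integrable_density hu hn D1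
  have I2 := hu.integrable_density hu hn D2
  have I3 := hu.integrable_density hu hn D3
  have I4 := hu.integrable_density hu hn D4
  have I5 := hu.integrable_density hu hn D5
  have I6 := hu.integrable_density hu hn D6
  have E4 : ∫ x : Space d × Space d, fderiv ℝ k x.1 (‖u (x.2 + x.1)‖ ^ 2 • u x.2)
      ∂(volume.prod (Ω.measure d)) = 0 :=
    hu.integral_fderiv_apply_eq_zero hu hk hinc (m := 2) (Or.inr rfl) (φ := fun b => ‖b‖ ^ 2)
      (by fun_prop) zero_le_one (fun b => by simp)
  have E5 : ∫ x : Space d × Space d, fderiv ℝ k x.1 (‖u x.2‖ ^ 2 • u x.2)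
      ∂(volume.prod (Ω.measure d)) = 0 := by
    rw [integral_prod_symm _ I5]
    refine integral_eq_zero_of_ae (Eventually.of_forall fun y => ?_)
    have hKi : Integrable (fderiv ℝ k) :=
      hK.contDiff.continuous.integrable_of_hasCompactSupport hK.compact
    have := ContinuousLinearMap.integral_apply hKi (‖u y‖ ^ 2 • u y)
    rw [integral_fderiv_eq_zero_of_even hk.differentiable hke] at this
    simpa using this.symm
  -- As `∇k` is odd, exchanging the two points changes signs: `F1` and `F2` reduce the terms to the
  -- vanishing ones `E5` and `E4`, and `F6` identifies the two mixed terms up to sign.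
  have F1 := hu.integral_density_flip hu hn D1
  have F2 := hu.integral_density_flip hu hn D2
  have F6 := hu.integral_density_flip hu hn D6
  simp only [hodd, neg_apply, integral_neg] at F1 F2 F6
  rw [E5, neg_zero] at F1
  rw [E4, neg_zero] at F2
  have hcomm : ∀ x : Space d × Space d, (inner ℝ (u x.2) (u (x.2 + x.1)) : ℝ)
      = inner ℝ (u (x.2 + x.1)) (u x.2) := fun x => real_inner_comm _ _
  simp only [hcomm] at F6
  have hexp : ∀ x : Space d × Space d,
      fderiv ℝ k x.1 (‖u (x.2 + x.1) - u x.2‖ ^ 2 • (u (x.2 + x.1) - u x.2))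
      = ((fderiv ℝ k x.1 (‖u (x.2 + x.1)‖ ^ 2 • u (x.2 + x.1))
        + fderiv ℝ k x.1 (‖u x.2‖ ^ 2 • u (x.2 + x.1)))
        - 2 * fderiv ℝ k x.1 ((inner ℝ (u (x.2 + x.1)) (u x.2) : ℝ) • u (x.2 + x.1)))
        - ((fderiv ℝ k x.1 (‖u (x.2 + x.1)‖ ^ 2 • u x.2)
        + fderiv ℝ k x.1 (‖u x.2‖ ^ 2 • u x.2))
        - 2 * fderiv ℝ k x.1 ((inner ℝ (u (x.2 + x.1)) (u x.2) : ℝ) • u x.2)) := fun x => by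
    rw [norm_sub_sq_real]
    simp only [map_smul, map_sub, smul_eq_mul]
    ring
  simp only [hexp]
  have S1 := (I1.fun_add I2).sub (I3.const_mul 2)
  have S2 := (I4.fun_add I5).sub (I6.const_mul 2)
  simp only [Pi.sub_def] at S1 S2
  rw [integral_sub S1 S2,
    integral_sub (I1.fun_add I2) (I3.const_mul 2), integral_sub (I4.fun_add I5) (I6.const_mul 2),
    integral_add I1 I2, integral_add I4 I5, integral_const_mul, integral_const_mul,
    F1, F2, E4, E5, F6]
  have hJ : ∫ z, fderiv ℝ k z (corr3 Ω u u z) = ∫ x : Space d × Space d,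
      fderiv ℝ k x.1 ((inner ℝ (u (x.2 + x.1)) (u x.2) : ℝ) • u (x.2 + x.1))
        ∂(volume.prod (Ω.measure d)) := by
    rw [integral_prod _ I3]
    refine integral_congr_ae (Eventually.of_forall fun z => ?_)
    exact (ContinuousLinearMap.integral_comp_comm (fderiv ℝ k z)
      (hu.integrable_corr3 hu z)).symm
  rw [hJ]
  ring

end

/-! ### The two-time correlation equation -/

/-- A test function `χ(t,τ)` of two times, an admissible test function in `t` for each `τ`. -/
structure IsTwoTimeTest (T : ℝ) (χ : ℝ → ℝ → ℝ) : Prop where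
  test : ∀ τ, IsTimeTest T (fun t => χ t τ)
  continuous : Continuous fun q : ℝ × ℝ => χ q.1 q.2
  continuous_deriv : Continuous fun q : ℝ × ℝ => deriv (fun t => χ t q.2) q.1
  bounded : ∃ A, ∀ q : ℝ × ℝ, ‖χ q.1 q.2‖ ≤ A ∧ ‖deriv (fun t => χ t q.2) q.1‖ ≤ A

/-- Lebesgue measure on `(0,T)`. -/
abbrev timeMeasure (T : ℝ) : Measure ℝ := volume.restrict (Ioo 0 T)

/-- The measure `dt dτ dz` on `((0,T) × (0,T)) × ℝ^d`. -/
abbrev pairMeasure (T : ℝ) (d : ℕ) : Measure ((ℝ × ℝ) × Space d) :=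
  ((timeMeasure T).prod (timeMeasure T)).prod volume

lemma integral_prod_prod_eq_zero {Q Z Y : Type*} [MeasurableSpace Q] [MeasurableSpace Z]
    [MeasurableSpace Y] {μ : Measure Q} {ν : Measure Z} {ρ : Measure Y} [SFinite μ] [SFinite ν]
    [SFinite ρ] {F : (Q × Z) × Y → ℝ} (hF : Integrable F ((μ.prod ν).prod ρ))
    (h : ∀ᵐ q ∂μ, ∫ x : Z × Y, F ((q, x.1), x.2) ∂(ν.prod ρ) = 0) :
    ∫ x, F x ∂((μ.prod ν).prod ρ) = 0 := by
  have hmp := (measurePreserving_prodAssoc μ ν ρ).symm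
  have hF' : Integrable (fun x => F (MeasurableEquiv.prodAssoc.symm x)) (μ.prod (ν.prod ρ)) :=
    hmp.integrable_comp_of_integrable hF
  rw [← hmp.integral_comp', integral_prod _ hF']
  exact integral_eq_zero_of_ae h

section
variable {d : ℕ} {Ω : Domain} {T : ℝ} {w : ℝ → Space d → Space d}

lemma EulerField.integrable_lpEnergy_volume (hw : EulerField Ω T w) {n : ℕ} (hn : n = 2 ∨ n = 3) :
    Integrable (fun t => lpEnergy Ω n (w t)) := by
  have h : Integrable (fun x : ℝ × Space d => ‖w x.1 x.2‖ ^ n) (volume.prod (Ω.measure d)) := by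
    rcases hn with rfl | rfl
    · exact hw.memLp_two_prod.integrable_norm_pow (by norm_num)
    · exact hw.memLp_three_prod.integrable_norm_pow (by norm_num)
  exact h.integral_prod_left

lemma EulerField.integrable_lpEnergy (hw : EulerField Ω T w) {n : ℕ} (hn : n = 2 ∨ n = 3) :
    Integrable (fun t => lpEnergy Ω n (w t)) (timeMeasure T) :=
  (hw.integrable_lpEnergy_volume hn).integrableOn

lemma EulerField.integrable_pair_weight (hw : EulerField Ω T w) {n : ℕ} (hn : n = 2 ∨ n = 3)
    (R C : ℝ) : Integrable (fun p : (ℝ × ℝ) × Space d =>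
      (Metric.closedBall (0 : Space d) R).indicator (fun _ => C) p.2
        * lpEnergy Ω n (w p.1.1)) (pairMeasure T d) ∧
    Integrable (fun p : (ℝ × ℝ) × Space d =>
      (Metric.closedBall (0 : Space d) R).indicator (fun _ => C) p.2
        * lpEnergy Ω n (w p.1.2)) (pairMeasure T d) := by
  have hb : Integrable (fun z : Space d =>
      (Metric.closedBall (0 : Space d) R).indicator (fun _ => C) z) := by
    simpa using integrable_ball_weight (d := d) R C 1
  have h1 := (hw.integrable_lpEnergy hn).comp_fst (timeMeasure T)
  have h2 := (hw.integrable_lpEnergy hn).comp_snd (timeMeasure T)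
  constructor
  · simpa only [mul_comm] using h1.mul_prod hb
  · simpa only [mul_comm] using h2.mul_prod hb

lemma EulerField.integrable_density (hw : EulerField Ω T w) {n : ℕ} (hn : n = 2 ∨ n = 3)
    {R C : ℝ} {φ : Space d → Space d → Space d → ℝ} (hφ : IsDensity n R C φ) {χ : ℝ × ℝ → ℝ}
    (hχ : Continuous χ) {A : ℝ} (hA : ∀ q, ‖χ q‖ ≤ A) :
    Integrable (fun x : ((ℝ × ℝ) × Space d) × Space d =>
      χ x.1.1 * φ x.1.2 (w x.1.1.1 (x.2 + x.1.2)) (w x.1.1.2 x.2))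
      ((pairMeasure T d).prod (Ω.measure d)) := by
  obtain ⟨h1, h2⟩ := hw.integrable_pair_weight hn R C
  exact EulerTime.integrable_density (Ω := Ω) (π := pairMeasure T d)
    (u := fun p => w p.1.1) (u' := fun p => w p.1.2)
    (hw.stronglyMeasurable.comp_measurable
      (g := fun x : ((ℝ × ℝ) × Space d) × Space d => (x.1.1.1, x.2)) (by fun_prop))
    (fun p => hw.spaceField _)
    (hw.stronglyMeasurable.comp_measurable
      (g := fun x : ((ℝ × ℝ) × Space d) × Space d => (x.1.1.2, x.2)) (by fun_prop))
    (fun p => hw.spaceField _)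
    (z := fun p => p.2) measurable_snd hn hφ (χ := fun p => χ p.1)
    (hχ.comp continuous_fst).stronglyMeasurable (fun p => hA _) h1 h2

lemma IsSpaceTest.fderiv_apply {k : Space d → ℝ} (hk : IsSpaceTest k) (s : Space d) :
    IsSpaceTest (fun z => _root_.fderiv ℝ k z s) :=
  ⟨hk.fderiv.contDiff.clm_apply contDiff_const,
    hk.fderiv.compact.comp_left (g := fun L : Space d →L[ℝ] ℝ => L s) rfl⟩

lemma IsSpaceTest.fderiv_fderiv_apply {k : Space d → ℝ} (hk : IsSpaceTest k) (s z b : Space d) :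
    _root_.fderiv ℝ (fun z => _root_.fderiv ℝ k z s) z b
      = _root_.fderiv ℝ (_root_.fderiv ℝ k) z b s := by
  rw [fderiv_clm_apply (hk.fderiv.differentiable z) (differentiableAt_const s)]
  simp

lemma IsSpaceTest.fderiv_fderiv_comm {k : Space d → ℝ} (hk : IsSpaceTest k) (z a b : Space d) :
    _root_.fderiv ℝ (_root_.fderiv ℝ k) z a b = _root_.fderiv ℝ (_root_.fderiv ℝ k) z b a :=
  (hk.contDiff.contDiffAt.isSymmSndFDerivAt
    (by rw [minSmoothness_of_isRCLikeNormedField]; exact WithTop.coe_le_coe.2 (le_top : (2 : ℕ∞) ≤ ⊤))).eq a b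

lemma sum_coord_smul_single (b : Space d) : ∑ i, b i • EuclideanSpace.single i (1 : ℝ) = b := by
  ext j
  simp [Finset.sum_apply, Pi.single_apply]

/-- The compactly supported divergence-free field `(Dk · a) s - (Dk · s) a`, in any dimension. -/
def curlField (k : Space d → ℝ) (a s : Space d) (z : Space d) : Space d :=
  fderiv ℝ k z a • s - fderiv ℝ k z s • a

lemma isSpaceTest_curlField {k : Space d → ℝ} (hk : IsSpaceTest k) (a s : Space d) :
    IsSpaceTest (curlField k a s) :=
  ⟨((hk.fderiv_apply a).contDiff.smul contDiff_const).sub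
      ((hk.fderiv_apply s).contDiff.smul contDiff_const),
    ((hk.fderiv_apply a).compact.smul_right (f' := fun _ => s)).sub
      ((hk.fderiv_apply s).compact.smul_right (f' := fun _ => a))⟩

lemma fderiv_curlField {k : Space d → ℝ} (hk : IsSpaceTest k) (a s z b : Space d) :
    fderiv ℝ (curlField k a s) z b
      = fderiv ℝ (fderiv ℝ k) z b a • s - fderiv ℝ (fderiv ℝ k) z b s • a := by
  have h1 : HasFDerivAt (curlField k a s)
      ((fderiv ℝ (fun z => fderiv ℝ k z a) z).smulRight s
        - (fderiv ℝ (fun z => fderiv ℝ k z s) z).smulRight a) z :=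
    (((hk.fderiv_apply a).differentiable z).hasFDerivAt.smul_const s).sub
      (((hk.fderiv_apply s).differentiable z).hasFDerivAt.smul_const a)
  rw [h1.fderiv]
  simp [hk.fderiv_fderiv_apply]

lemma divergence_curlField {k : Space d → ℝ} (hk : IsSpaceTest k) (a s z : Space d) :
    divergence (curlField k a s) z = 0 := by
  have h : ∀ a s : Space d, ∑ i, fderiv ℝ (fderiv ℝ k) z (EuclideanSpace.single i 1) a * s i
      = fderiv ℝ (fderiv ℝ k) z s a := fun a s => by
    conv_rhs => rw [← sum_coord_smul_single s]
    simp [mul_comm]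
  simp only [divergence, fderiv_curlField hk, PiLp.sub_apply, PiLp.smul_apply, smul_eq_mul,
    Finset.sum_sub_distrib, h]
  rw [hk.fderiv_fderiv_comm, sub_self]

/-- The derivative, in the direction `s` of the spatial increment, of the two-time correlation
equation with kernel `k`. It arises from testing with `curlField k (w τ y) s`: of the two halves of
this field, the one along `s` drops out because `w τ` is divergence free. -/
theorem EulerField.integral_directional_kernel (hw : EulerField Ω T w) {χ : ℝ → ℝ → ℝ}
    (hχ : IsTwoTimeTest T χ) {k : Space d → ℝ} (hk : IsSpaceTest k) (s : Space d) :
    ∫ p, (deriv (fun t => χ t p.1.2) p.1.1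
        * (fderiv ℝ k p.2 s * corr2 Ω (w p.1.1) (w p.1.2) p.2)
      + χ p.1.1 p.1.2
        * fderiv ℝ (fun z => fderiv ℝ k z s) p.2 (corr3 Ω (w p.1.1) (w p.1.2) p.2))
      ∂(pairMeasure T d) = 0 := by
  obtain ⟨A, hA⟩ := hχ.bounded
  have h2 : (2 : ℕ) = 2 ∨ (2 : ℕ) = 3 := Or.inl rfl
  have h3 : (3 : ℕ) = 2 ∨ (3 : ℕ) = 3 := Or.inr rfl
  obtain ⟨R1, C1, D1⟩ := exists_isDensity_apply (n := 2) hk.fderiv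
    (P := fun b a => (inner ℝ b s : ℝ) • a)
    (by simp only [Function.uncurry_def]; fun_prop) (norm_nonneg s) (fun b a => by
      rw [norm_smul]
      have e1 := pow_mul_le_add (norm_nonneg b) (norm_nonneg a) 1
      rw [pow_one] at e1
      calc ‖(inner ℝ b s : ℝ)‖ * ‖a‖ ≤ (‖b‖ * ‖s‖) * ‖a‖ :=
            mul_le_mul_of_nonneg_right (norm_inner_le_norm b s) (norm_nonneg _)
        _ = ‖s‖ * (‖b‖ * ‖a‖) := by ring
        _ ≤ _ := mul_le_mul_of_nonneg_left e1 (norm_nonneg _))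
  obtain ⟨R2, C2, D2⟩ := exists_isDensity_mul (n := 2) (hk.fderiv_apply s)
    (P := fun b a => (inner ℝ b a : ℝ))
    (by simp only [Function.uncurry_def]; fun_prop) zero_le_one
    (fun b a => norm_le_pow_add_pow (i := 1) (j := 1) rfl
      (by simpa using norm_inner_le_norm (𝕜 := ℝ) b a))
  have hcoord : ∀ i, ∀ b : Space d, ‖b i * (inner ℝ b s : ℝ)‖ ≤ ‖s‖ * ‖b‖ ^ 2 := fun i b => by
    rw [norm_mul]
    calc ‖b i‖ * ‖(inner ℝ b s : ℝ)‖ ≤ ‖b‖ * (‖b‖ * ‖s‖) :=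
          mul_le_mul (PiLp.norm_apply_le b i) (norm_inner_le_norm b s) (norm_nonneg _)
            (norm_nonneg _)
      _ = ‖s‖ * ‖b‖ ^ 2 := by ring
  have hD3 : ∀ i, ∃ R C, IsDensity 3 R C (fun z b a =>
      fderiv ℝ (fun z => fderiv ℝ k z (EuclideanSpace.single i 1)) z
        ((b i * (inner ℝ b s : ℝ)) • a)) := fun i =>
    exists_isDensity_apply (n := 3) (hk.fderiv_apply (EuclideanSpace.single i 1)).fderiv
      (P := fun b a => (b i * (inner ℝ b s : ℝ)) • a)
      (by simp only [Function.uncurry_def]; fun_prop) (norm_nonneg s) (fun b a => by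
        rw [norm_smul]
        calc ‖b i * (inner ℝ b s : ℝ)‖ * ‖a‖ ≤ (‖s‖ * ‖b‖ ^ 2) * ‖a‖ :=
              mul_le_mul_of_nonneg_right (hcoord i b) (norm_nonneg _)
          _ = ‖s‖ * (‖b‖ ^ 2 * ‖a‖) := by ring
          _ ≤ _ := mul_le_mul_of_nonneg_left
            (pow_mul_le_add (norm_nonneg b) (norm_nonneg a) 2) (norm_nonneg _))
  choose R3 C3 D3 using hD3
  obtain ⟨R4, C4, D4⟩ := exists_isDensity_apply (n := 3) (hk.fderiv_apply s).fderiv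
    (P := fun b a => (inner ℝ b a : ℝ) • b)
    (by simp only [Function.uncurry_def]; fun_prop) zero_le_one
    (fun b a => norm_le_pow_add_pow (i := 2) (j := 1) rfl
      (by simpa using norm_corr3_integrand a b))
  have I1 := hw.integrable_density h2 D1 hχ.continuous_deriv (fun q => (hA q).2)
  have I2 := hw.integrable_density h2 D2 hχ.continuous_deriv (fun q => (hA q).2)
  have I3 := fun i => hw.integrable_density h3 (D3 i) hχ.continuous (fun q => (hA q).1)
  have I4 := hw.integrable_density h3 D4 hχ.continuous (fun q => (hA q).1)
  have I3' := integrable_finsetSum Finset.univ (fun i _ => I3 i)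
  -- The terms in which the gradient kernel acts on `w(τ)` vanish.
  have Z1 := integral_prod_prod_eq_zero I1 (by
    have := Measure.quasiMeasurePreserving_snd (μ := timeMeasure T) (ν := timeMeasure T) |>.ae
      (ae_restrict_of_ae (hw.incompressible k hk))
    filter_upwards [this] with q hq
    rw [integral_const_mul, (hw.spaceField q.1).integral_fderiv_apply_eq_zero (hw.spaceField q.2)
      hk hq (m := 1) (Or.inl rfl) (φ := fun b => inner ℝ b s) (by fun_prop) (norm_nonneg s)
      (fun b => by rw [pow_one, mul_comm]; exact norm_inner_le_norm b s), mul_zero])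
  have Z3 := fun i => integral_prod_prod_eq_zero (I3 i) (by
    have := Measure.quasiMeasurePreserving_snd (μ := timeMeasure T) (ν := timeMeasure T) |>.ae
      (ae_restrict_of_ae (hw.incompressible _ (hk.fderiv_apply (EuclideanSpace.single i 1))))
    filter_upwards [this] with q hq
    rw [integral_const_mul, (hw.spaceField q.1).integral_fderiv_apply_eq_zero (hw.spaceField q.2)
      (hk.fderiv_apply (EuclideanSpace.single i 1)) hq (m := 2) (Or.inr rfl)
      (φ := fun b => b i * inner ℝ b s) (by fun_prop) (norm_nonneg s) (hcoord i), mul_zero])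
  -- The momentum equation tested with `curlField k (w τ y) s`, integrated over `(τ, y)`.
  set F : ((ℝ × ℝ) × Space d) × Space d → ℝ := fun x =>
    deriv (fun t => χ t x.1.1.2) x.1.1.1
        * inner ℝ (w x.1.1.1 (x.2 + x.1.2)) (curlField k (w x.1.1.2 x.2) s x.1.2)
      + χ x.1.1.1 x.1.1.2 * inner ℝ (w x.1.1.1 (x.2 + x.1.2))
        (fderiv ℝ (curlField k (w x.1.1.2 x.2) s) x.1.2 (w x.1.1.1 (x.2 + x.1.2))) with hF
  have hFeq : F = fun x => ((deriv (fun t => χ t x.1.1.2) x.1.1.1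
        * fderiv ℝ k x.1.2 ((inner ℝ (w x.1.1.1 (x.2 + x.1.2)) s : ℝ) • w x.1.1.2 x.2)
      + ∑ i, χ x.1.1.1 x.1.1.2
        * fderiv ℝ (fun z => fderiv ℝ k z (EuclideanSpace.single i 1)) x.1.2
          ((w x.1.1.1 (x.2 + x.1.2) i * (inner ℝ (w x.1.1.1 (x.2 + x.1.2)) s : ℝ)) • w x.1.1.2 x.2))
      - (deriv (fun t => χ t x.1.1.2) x.1.1.1
        * (fderiv ℝ k x.1.2 s * inner ℝ (w x.1.1.1 (x.2 + x.1.2)) (w x.1.1.2 x.2))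
      + χ x.1.1.1 x.1.1.2 * fderiv ℝ (fun z => fderiv ℝ k z s) x.1.2
          ((inner ℝ (w x.1.1.1 (x.2 + x.1.2)) (w x.1.1.2 x.2) : ℝ)
            • w x.1.1.1 (x.2 + x.1.2)))) := by
    funext x
    set b := w x.1.1.1 (x.2 + x.1.2)
    set a := w x.1.1.2 x.2
    have hs : ∑ i, b i * fderiv ℝ (fderiv ℝ k) x.1.2 a (EuclideanSpace.single i 1)
        = fderiv ℝ (fderiv ℝ k) x.1.2 a b := by
      conv_rhs => rw [← sum_coord_smul_single b]
      simp
    have hs' : ∑ i, χ x.1.1.1 x.1.1.2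
        * fderiv ℝ (fun z => fderiv ℝ k z (EuclideanSpace.single i 1)) x.1.2
          ((b i * (inner ℝ b s : ℝ)) • a)
        = χ x.1.1.1 x.1.1.2 * ((inner ℝ b s : ℝ) * fderiv ℝ (fderiv ℝ k) x.1.2 b a) := by
      rw [hk.fderiv_fderiv_comm _ b a, ← hs, Finset.mul_sum, Finset.mul_sum]
      refine Finset.sum_congr rfl fun i _ => ?_
      rw [map_smul, hk.fderiv_fderiv_apply, smul_eq_mul]
      ring
    rw [hs', map_smul, map_smul, hk.fderiv_fderiv_apply]
    simp only [hF, fderiv_curlField hk, curlField, inner_sub_right, inner_smul_right, smul_eq_mul]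
    ring
  have S1 := I1.add I3'
  have S2 := I2.add I4
  simp only [Pi.add_def] at S1 S2
  have hFi : Integrable F ((pairMeasure T d).prod (Ω.measure d)) := by
    rw [hFeq]; exact S1.sub S2
  have hF0 : ∫ x, F x ∂((pairMeasure T d).prod (Ω.measure d)) = 0 := by
    rw [integral_prod_symm _ hFi]
    refine integral_eq_zero_of_ae ?_
    filter_upwards [hFi.prod_left_ae] with y hy
    rw [integral_prod _ hy, integral_prod_symm _ hy.integral_prod_left]
    refine integral_eq_zero_of_ae (Eventually.of_forall fun τ => ?_)
    exact hw.momentum _ (hχ.test τ) _ (isSpaceTest_curlField hk (w τ y) s)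
      (divergence_curlField hk _ _) y
  rw [hFeq, integral_sub S1 S2, integral_add I1 I3', integral_finsetSum _ fun i _ => I3 i, Z1,
    Finset.sum_eq_zero fun i _ => Z3 i, add_zero, zero_sub, neg_eq_zero,
    integral_prod _ S2] at hF0
  rw [← hF0]
  refine integral_congr_ae (Eventually.of_forall fun p => ?_)
  have c2 := (hw.spaceField p.1.1).integrable_corr2 (hw.spaceField p.1.2) p.2
  have c3 := (hw.spaceField p.1.1).integrable_corr3 (hw.spaceField p.1.2) p.2
  simp only
  rw [integral_add ((c2.const_mul _).const_mul _)
    (((fderiv ℝ (fun z => fderiv ℝ k z s) p.2).integrable_comp c3).const_mul _)]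
  simp only [integral_const_mul]
  rw [(fderiv ℝ (fun z => fderiv ℝ k z s) p.2).integral_comp_comm c3]
  rfl

end

/-! ### Integrating the correlation equation in the spatial increment -/

section
variable {d : ℕ} {Ω : Domain} {T : ℝ} {w : ℝ → Space d → Space d}

lemma indicator_closedBall_mono {R R' C C' : ℝ} (hR : R ≤ R') (hC : C ≤ C') (hC' : 0 ≤ C')
    (z : Space d) : (Metric.closedBall (0 : Space d) R).indicator (fun _ => C) z
      ≤ (Metric.closedBall (0 : Space d) R').indicator (fun _ => C') z := by
  by_cases hz : z ∈ Metric.closedBall (0 : Space d) R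
  · rw [indicator_of_mem hz, indicator_of_mem (Metric.closedBall_subset_closedBall hR hz)]
    exact hC
  · rw [indicator_of_notMem hz]
    exact indicator_nonneg (fun _ _ => hC') _

/-- A common bound for a test function, its derivative, and all their translates by vectors of
length at most `r`. -/
lemma IsSpaceTest.exists_bound_translate {F : Type*} [NormedAddCommGroup F] [NormedSpace ℝ F]
    {g : Space d → F} (hg : IsSpaceTest g) (r : ℝ) : ∃ R C, 0 ≤ C ∧ ∀ h, ‖h‖ ≤ r → ∀ z,
      ‖g (z + h)‖ ≤ (Metric.closedBall (0 : Space d) R).indicator (fun _ => C) z ∧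
      ‖_root_.fderiv ℝ g (z + h)‖ ≤ (Metric.closedBall (0 : Space d) R).indicator (fun _ => C) z := by
  obtain ⟨R1, C1, hC1, h1⟩ := hg.exists_bound
  obtain ⟨R2, C2, hC2, h2⟩ := hg.fderiv.exists_bound
  have hCm : 0 ≤ max C1 C2 := hC1.trans (le_max_left _ _)
  refine ⟨max R1 R2 + r, max C1 C2, hCm, fun h hh z => ?_⟩
  have key : (Metric.closedBall (0 : Space d) (max R1 R2)).indicator (fun _ => max C1 C2) (z + h)
      ≤ (Metric.closedBall (0 : Space d) (max R1 R2 + r)).indicator (fun _ => max C1 C2) z := by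
    by_cases hz : z + h ∈ Metric.closedBall (0 : Space d) (max R1 R2)
    · rw [indicator_of_mem hz, indicator_of_mem]
      rw [mem_closedBall_zero_iff] at hz ⊢
      have := norm_sub_le (z + h) h
      rw [add_sub_cancel_right] at this
      linarith
    · rw [indicator_of_notMem hz]
      exact indicator_nonneg (fun _ _ => hCm) _
  exact ⟨((h1 _).trans (indicator_closedBall_mono (le_max_left _ _) (le_max_left _ _) hCm _)).trans
    key, ((h2 _).trans (indicator_closedBall_mono (le_max_right _ _) (le_max_right _ _) hCm _)).trans
    key⟩

/-- An integrable majorant for the two-time correlations of a field, cut off at `‖z‖ ≤ R`. -/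
def pairWeight (Ω : Domain) (w : ℝ → Space d → Space d) (R C : ℝ) (p : (ℝ × ℝ) × Space d) : ℝ :=
  (Metric.closedBall (0 : Space d) R).indicator (fun _ => C) p.2
    * ((lpEnergy Ω 2 (w p.1.1) + lpEnergy Ω 2 (w p.1.2))
      + (lpEnergy Ω 3 (w p.1.1) + lpEnergy Ω 3 (w p.1.2)))

lemma EulerField.integrable_pairWeight (hw : EulerField Ω T w) (R C : ℝ) :
    Integrable (pairWeight Ω w R C) (pairMeasure T d) := by
  obtain ⟨a1, a2⟩ := hw.integrable_pair_weight (n := 2) (Or.inl rfl) R C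
  obtain ⟨b1, b2⟩ := hw.integrable_pair_weight (n := 3) (Or.inr rfl) R C
  have := (a1.add a2).add (b1.add b2)
  simp only [Pi.add_def, ← mul_add] at this
  exact this

lemma EulerField.stronglyMeasurable_corr2 (hw : EulerField Ω T w) (h : Space d) :
    StronglyMeasurable fun p : (ℝ × ℝ) × Space d => corr2 Ω (w p.1.1) (w p.1.2) (p.2 + h) := by
  have m1 : StronglyMeasurable fun x : ((ℝ × ℝ) × Space d) × Space d =>
      w x.1.1.1 (x.2 + (x.1.2 + h)) := hw.stronglyMeasurable.comp_measurable
    (g := fun x : ((ℝ × ℝ) × Space d) × Space d => (x.1.1.1, x.2 + (x.1.2 + h))) (by fun_prop)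
  have m2 : StronglyMeasurable fun x : ((ℝ × ℝ) × Space d) × Space d => w x.1.1.2 x.2 :=
    hw.stronglyMeasurable.comp_measurable
      (g := fun x : ((ℝ × ℝ) × Space d) × Space d => (x.1.1.2, x.2)) (by fun_prop)
  exact (m1.inner (𝕜 := ℝ) m2).integral_prod_right' (ν := Ω.measure d)

lemma EulerField.stronglyMeasurable_corr3 (hw : EulerField Ω T w) (h : Space d) :
    StronglyMeasurable fun p : (ℝ × ℝ) × Space d => corr3 Ω (w p.1.1) (w p.1.2) (p.2 + h) := by
  have m1 : StronglyMeasurable fun x : ((ℝ × ℝ) × Space d) × Space d =>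
      w x.1.1.1 (x.2 + (x.1.2 + h)) := hw.stronglyMeasurable.comp_measurable
    (g := fun x : ((ℝ × ℝ) × Space d) × Space d => (x.1.1.1, x.2 + (x.1.2 + h))) (by fun_prop)
  have m2 : StronglyMeasurable fun x : ((ℝ × ℝ) × Space d) × Space d => w x.1.1.2 x.2 :=
    hw.stronglyMeasurable.comp_measurable
      (g := fun x : ((ℝ × ℝ) × Space d) × Space d => (x.1.1.2, x.2)) (by fun_prop)
  exact ((m1.inner (𝕜 := ℝ) m2).smul m1).integral_prod_right' (ν := Ω.measure d)

/-- The integrand of the two-time correlation equation, for the kernel `κ`, the kernel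
gradient `L`, and correlations with increment shifted by `h`. -/
def pairDensity (Ω : Domain) (w : ℝ → Space d → Space d) (χ : ℝ → ℝ → ℝ) (κ : Space d → ℝ)
    (L : Space d → Space d →L[ℝ] ℝ) (h : Space d) (p : (ℝ × ℝ) × Space d) : ℝ :=
  deriv (fun t => χ t p.1.2) p.1.1 * (κ p.2 * corr2 Ω (w p.1.1) (w p.1.2) (p.2 + h))
    + χ p.1.1 p.1.2 * L p.2 (corr3 Ω (w p.1.1) (w p.1.2) (p.2 + h))

lemma EulerField.stronglyMeasurable_pairDensity (hw : EulerField Ω T w) {χ : ℝ → ℝ → ℝ}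
    (hχ : IsTwoTimeTest T χ) {κ : Space d → ℝ} (hκ : Continuous κ) {L : Space d → Space d →L[ℝ] ℝ}
    (hL : Continuous L) (h : Space d) : StronglyMeasurable (pairDensity Ω w χ κ L h) := by
  have m1 : StronglyMeasurable fun p : (ℝ × ℝ) × Space d => deriv (fun t => χ t p.1.2) p.1.1 :=
    (hχ.continuous_deriv.comp continuous_fst).stronglyMeasurable
  have m2 : StronglyMeasurable fun p : (ℝ × ℝ) × Space d => χ p.1.1 p.1.2 :=
    (hχ.continuous.comp continuous_fst).stronglyMeasurable
  have m3 : StronglyMeasurable fun p : (ℝ × ℝ) × Space d => κ p.2 :=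
    (hκ.comp continuous_snd).stronglyMeasurable
  have m4 : StronglyMeasurable fun p : (ℝ × ℝ) × Space d =>
      L p.2 (corr3 Ω (w p.1.1) (w p.1.2) (p.2 + h)) :=
    isBoundedBilinearMap_apply.continuous.comp_stronglyMeasurable
      ((hL.comp continuous_snd).stronglyMeasurable.prodMk (hw.stronglyMeasurable_corr3 h))
  exact (m1.mul (m3.mul (hw.stronglyMeasurable_corr2 h))).add (m2.mul m4)

lemma EulerField.norm_pairDensity_le (hw : EulerField Ω T w) {χ : ℝ → ℝ → ℝ} {A : ℝ}
    (hA : ∀ q : ℝ × ℝ, ‖χ q.1 q.2‖ ≤ A ∧ ‖deriv (fun t => χ t q.2) q.1‖ ≤ A)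
    {κ : Space d → ℝ} {L : Space d → Space d →L[ℝ] ℝ} {R C : ℝ} {p : (ℝ × ℝ) × Space d}
    (hκ : ‖κ p.2‖ ≤ (Metric.closedBall (0 : Space d) R).indicator (fun _ => C) p.2)
    (hL : ‖L p.2‖ ≤ (Metric.closedBall (0 : Space d) R).indicator (fun _ => C) p.2) (h : Space d) :
    ‖pairDensity Ω w χ κ L h p‖ ≤ A * pairWeight Ω w R C p := by
  have hA0 : 0 ≤ A := (norm_nonneg _).trans (hA p.1).1
  have h2 := (hw.spaceField p.1.1).norm_corr2_le_add (hw.spaceField p.1.2) (p.2 + h)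
  have h3 := (hw.spaceField p.1.1).norm_corr3_le_add (hw.spaceField p.1.2) (p.2 + h)
  have b2 : ‖deriv (fun t => χ t p.1.2) p.1.1 * (κ p.2 * corr2 Ω (w p.1.1) (w p.1.2) (p.2 + h))‖
      ≤ A * ((Metric.closedBall (0 : Space d) R).indicator (fun _ => C) p.2
        * (lpEnergy Ω 2 (w p.1.1) + lpEnergy Ω 2 (w p.1.2))) := by
    rw [norm_mul, norm_mul]
    exact mul_le_mul (hA p.1).2 (mul_le_mul hκ h2 (norm_nonneg _) ((norm_nonneg _).trans hκ))
      (by positivity) hA0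
  have b3 : ‖χ p.1.1 p.1.2 * L p.2 (corr3 Ω (w p.1.1) (w p.1.2) (p.2 + h))‖
      ≤ A * ((Metric.closedBall (0 : Space d) R).indicator (fun _ => C) p.2
        * (lpEnergy Ω 3 (w p.1.1) + lpEnergy Ω 3 (w p.1.2))) := by
    rw [norm_mul]
    exact mul_le_mul (hA p.1).1 ((ContinuousLinearMap.le_opNorm _ _).trans
      (mul_le_mul hL h3 (norm_nonneg _) ((norm_nonneg _).trans hL))) (by positivity) hA0
  refine (norm_add_le _ _).trans ((add_le_add b2 b3).trans (le_of_eq ?_))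
  rw [pairWeight]
  ring

lemma hasDerivAt_pairDensity {χ : ℝ → ℝ → ℝ} {k : Space d → ℝ} (hk : IsSpaceTest k) (s : Space d)
    (p : (ℝ × ℝ) × Space d) (σ : ℝ) :
    HasDerivAt (fun σ : ℝ =>
      pairDensity Ω w χ (fun z => k (z + σ • s)) (fun z => fderiv ℝ k (z + σ • s)) 0 p)
      (pairDensity Ω w χ (fun z => fderiv ℝ k (z + σ • s) s)
        (fun z => fderiv ℝ (fun z => fderiv ℝ k z s) (z + σ • s)) 0 p) σ := by
  have hd1 : HasDerivAt (fun σ : ℝ => p.2 + σ • s) s σ := by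
    simpa using ((hasDerivAt_id σ).smul_const s).const_add p.2
  have g1 : HasDerivAt (fun σ : ℝ => k (p.2 + σ • s)) (fderiv ℝ k (p.2 + σ • s) s) σ :=
    (hk.differentiable _).hasFDerivAt.comp_hasDerivAt σ hd1
  have g2 : HasDerivAt (fun σ : ℝ => fderiv ℝ k (p.2 + σ • s))
      (fderiv ℝ (fderiv ℝ k) (p.2 + σ • s) s) σ :=
    (hk.fderiv.differentiable _).hasFDerivAt.comp_hasDerivAt σ hd1
  have g3 := g2.clm_apply (hasDerivAt_const σ (corr3 Ω (w p.1.1) (w p.1.2) (p.2 + 0)))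
  have g4 := ((g1.mul_const (corr2 Ω (w p.1.1) (w p.1.2) (p.2 + 0))).const_mul
    (deriv (fun t => χ t p.1.2) p.1.1)).add (g3.const_mul (χ p.1.1 p.1.2))
  refine g4.congr_deriv ?_
  rw [pairDensity, hk.fderiv_fderiv_apply, hk.fderiv_fderiv_comm _ s, map_zero, add_zero, add_zero]

lemma EulerField.hasDerivAt_integral_pairDensity (hw : EulerField Ω T w) {χ : ℝ → ℝ → ℝ}
    (hχ : IsTwoTimeTest T χ) {k : Space d → ℝ} (hk : IsSpaceTest k) (s : Space d) (σ₀ : ℝ) :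
    HasDerivAt (fun σ : ℝ => ∫ p, pairDensity Ω w χ (fun z => k (z + σ • s))
        (fun z => fderiv ℝ k (z + σ • s)) 0 p ∂(pairMeasure T d))
      (∫ p, pairDensity Ω w χ (fun z => fderiv ℝ k (z + σ₀ • s) s)
        (fun z => fderiv ℝ (fun z => fderiv ℝ k z s) (z + σ₀ • s)) 0 p ∂(pairMeasure T d)) σ₀ := by
  obtain ⟨A, hA⟩ := hχ.bounded
  have hks := hk.fderiv_apply s
  have hc : ∀ σ : ℝ, Continuous fun z : Space d => z + σ • s := fun σ => by fun_prop
  obtain ⟨R1, C1, hC1, h1⟩ := hk.exists_bound_translate ((|σ₀| + 1) * ‖s‖)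
  obtain ⟨R2, C2, hC2, h2⟩ := hks.exists_bound_translate ((|σ₀| + 1) * ‖s‖)
  have hball : ∀ σ ∈ Metric.ball σ₀ 1, ‖σ • s‖ ≤ (|σ₀| + 1) * ‖s‖ := fun σ hσ => by
    rw [norm_smul]
    refine mul_le_mul_of_nonneg_right ?_ (norm_nonneg _)
    rw [Metric.mem_ball, Real.dist_eq] at hσ
    have := abs_add_le (σ - σ₀) σ₀
    rw [sub_add_cancel] at this
    rw [Real.norm_eq_abs]
    linarith
  have hFm : ∀ σ : ℝ, StronglyMeasurable (pairDensity Ω w χ (fun z => k (z + σ • s))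
      (fun z => fderiv ℝ k (z + σ • s)) 0) := fun σ => hw.stronglyMeasurable_pairDensity hχ
    (hk.contDiff.continuous.comp (hc σ)) (hk.fderiv.contDiff.continuous.comp (hc σ)) 0
  have hFm' : StronglyMeasurable (pairDensity Ω w χ (fun z => fderiv ℝ k (z + σ₀ • s) s)
      (fun z => fderiv ℝ (fun z => fderiv ℝ k z s) (z + σ₀ • s)) 0) :=
    hw.stronglyMeasurable_pairDensity hχ
      (hks.contDiff.continuous.comp (hc σ₀)) (hks.fderiv.contDiff.continuous.comp (hc σ₀)) 0
  have hb0 := hball σ₀ (Metric.mem_ball_self one_pos)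
  have hint : Integrable (pairDensity Ω w χ (fun z => k (z + σ₀ • s))
      (fun z => fderiv ℝ k (z + σ₀ • s)) 0) (pairMeasure T d) := by
    refine ((hw.integrable_pairWeight R1 C1).const_mul A).mono' (hFm σ₀).aestronglyMeasurable
      (Eventually.of_forall fun p => ?_)
    obtain ⟨e1, e2⟩ := h1 _ hb0 p.2
    exact hw.norm_pairDensity_le (κ := fun z => k (z + σ₀ • s))
      (L := fun z => fderiv ℝ k (z + σ₀ • s)) hA e1 e2 0
  have hbd : ∀ p : (ℝ × ℝ) × Space d, ∀ σ ∈ Metric.ball σ₀ 1,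
      ‖pairDensity Ω w χ (fun z => fderiv ℝ k (z + σ • s) s)
        (fun z => fderiv ℝ (fun z => fderiv ℝ k z s) (z + σ • s)) 0 p‖
        ≤ A * pairWeight Ω w R2 C2 p := fun p σ hσ => by
    obtain ⟨e1, e2⟩ := h2 _ (hball σ hσ) p.2
    exact hw.norm_pairDensity_le (κ := fun z => fderiv ℝ k (z + σ • s) s)
      (L := fun z => fderiv ℝ (fun z => fderiv ℝ k z s) (z + σ • s)) hA e1 e2 0
  exact (hasDerivAt_integral_of_dominated_loc_of_deriv_le (μ := pairMeasure T d)
    (F := fun σ => pairDensity Ω w χ (fun z => k (z + σ • s)) (fun z => fderiv ℝ k (z + σ • s)) 0)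
    (F' := fun σ => pairDensity Ω w χ (fun z => fderiv ℝ k (z + σ • s) s)
        (fun z => fderiv ℝ (fun z => fderiv ℝ k z s) (z + σ • s)) 0)
    (bound := fun p => A * pairWeight Ω w R2 C2 p)
    (Metric.ball_mem_nhds σ₀ one_pos)
    (Eventually.of_forall fun σ => (hFm σ).aestronglyMeasurable) hint
    hFm'.aestronglyMeasurable (Eventually.of_forall hbd)
    ((hw.integrable_pairWeight R2 C2).const_mul A)
    (Eventually.of_forall fun p σ _ => hasDerivAt_pairDensity hk s p σ)).2

/-- Translating the kernel does not change the two-time correlation functional. -/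
lemma EulerField.integral_pairDensity_translate (hw : EulerField Ω T w) {χ : ℝ → ℝ → ℝ}
    (hχ : IsTwoTimeTest T χ) {k : Space d → ℝ} (hk : IsSpaceTest k) (s : Space d) :
    ∫ p, pairDensity Ω w χ (fun z => k (z + s)) (fun z => fderiv ℝ k (z + s)) 0 p
        ∂(pairMeasure T d)
      = ∫ p, pairDensity Ω w χ k (fderiv ℝ k) 0 p ∂(pairMeasure T d) := by
  have hz : ∀ σ : ℝ, ∫ p, pairDensity Ω w χ (fun z => fderiv ℝ k (z + σ • s) s)
      (fun z => fderiv ℝ (fun z => fderiv ℝ k z s) (z + σ • s)) 0 p ∂(pairMeasure T d) = 0 :=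
    fun σ => by
    have := hw.integral_directional_kernel hχ (hk.comp_add_right (σ • s)) s
    simp only [fderiv_comp_add_right] at this
    have e : ∀ z, fderiv ℝ (fun z => fderiv ℝ k (z + σ • s) s) z
        = fderiv ℝ (fun z => fderiv ℝ k z s) (z + σ • s) := fun z =>
      fderiv_comp_add_right (f := fun z => fderiv ℝ k z s) (σ • s)
    simp only [e] at this
    simpa only [pairDensity, add_zero] using this
  have hderiv := hw.hasDerivAt_integral_pairDensity hχ hk s
  simp only [hz] at hderiv
  have hconst := is_const_of_deriv_eq_zero (fun σ => (hderiv σ).differentiableAt)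
    (fun σ => (hderiv σ).deriv) 1 0
  simpa only [one_smul, zero_smul, add_zero] using hconst

lemma EulerField.integrable_pairDensity (hw : EulerField Ω T w) {χ : ℝ → ℝ → ℝ}
    (hχ : IsTwoTimeTest T χ) {k : Space d → ℝ} (hk : IsSpaceTest k) (h : Space d) :
    Integrable (pairDensity Ω w χ k (fderiv ℝ k) h) (pairMeasure T d) := by
  obtain ⟨A, hA⟩ := hχ.bounded
  obtain ⟨R, C, -, hRC⟩ := hk.exists_bound_translate 0
  refine ((hw.integrable_pairWeight R C).const_mul A).mono' (hw.stronglyMeasurable_pairDensity hχ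
    hk.contDiff.continuous hk.fderiv.contDiff.continuous h).aestronglyMeasurable
    (Eventually.of_forall fun p => ?_)
  have := hRC 0 (by simp) p.2
  rw [add_zero] at this
  exact hw.norm_pairDensity_le hA this.1 this.2 h

/-- Shifting the increment does not change the two-time correlation functional. -/
lemma EulerField.integral_pairDensity_shift (hw : EulerField Ω T w) {χ : ℝ → ℝ → ℝ}
    (hχ : IsTwoTimeTest T χ) {k : Space d → ℝ} (hk : IsSpaceTest k) (s : Space d) :
    ∫ p, pairDensity Ω w χ k (fderiv ℝ k) s p ∂(pairMeasure T d)
      = ∫ p, pairDensity Ω w χ k (fderiv ℝ k) 0 p ∂(pairMeasure T d) := by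
  rw [← hw.integral_pairDensity_translate hχ hk (-s)]
  have hmp : MeasurePreserving (Prod.map id (MeasurableEquiv.addRight s))
      (pairMeasure T d) (pairMeasure T d) :=
    (MeasurePreserving.id _).prod (measurePreserving_add_right volume s)
  have := hmp.integral_comp
    ((MeasurableEquiv.prodCongr (MeasurableEquiv.refl (ℝ × ℝ))
      (MeasurableEquiv.addRight s)).measurableEmbedding)
    (pairDensity Ω w χ (fun z => k (z + -s)) (fun z => fderiv ℝ k (z + -s)) 0)
  rw [← this]
  refine integral_congr_ae (Eventually.of_forall fun p => ?_)
  simp [pairDensity]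

end

/-! ### Decay and averaging of the correlations -/

section
variable {d : ℕ} {Ω : Domain} {T : ℝ} {w : ℝ → Space d → Space d}

lemma SpaceField.isFunctionOn_corr2 {u : Space d → Space d} (hu : SpaceField Ω u)
    (u' : Space d → Space d) : Ω.IsFunctionOn (corr2 Ω u u') := by
  cases Ω with
  | whole => trivial
  | torus =>
    intro l x
    have h := hu.isFunctionOn l
    simp only [corr2, ← add_assoc, h]

lemma SpaceField.isFunctionOn_corr3 {u : Space d → Space d} (hu : SpaceField Ω u)
    (u' : Space d → Space d) : Ω.IsFunctionOn (corr3 Ω u u') := by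
  cases Ω with
  | whole => trivial
  | torus =>
    intro l x
    have h := hu.isFunctionOn l
    simp only [corr3, ← add_assoc, h]

/-- Averaging the correlation over all increments gives the product of the means. -/
lemma SpaceField.integral_corr2_torus {u u' : Space d → Space d} (hu : SpaceField .torus u)
    (hu' : SpaceField .torus u') :
    ∫ h, corr2 .torus u u' h ∂(Domain.torus.measure d)
      = ∫ x, inner ℝ (u x) (∫ y, u' y ∂(Domain.torus.measure d)) ∂(Domain.torus.measure d) := by
  have := isFiniteMeasure_torus d
  have i1 : Integrable u (Domain.torus.measure d) := hu.memLp_two.integrable (by norm_num)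
  have i2 : Integrable u' (Domain.torus.measure d) := hu'.memLp_two.integrable (by norm_num)
  have b1 := integrable_weight_translate (Ω := .torus) (π := Domain.torus.measure d)
    (a := fun _ => u) (hu.stronglyMeasurable.comp_measurable measurable_snd) (fun _ => hu) (n := 2)
    (Or.inl rfl) (h := fun z => z) measurable_id (κ := fun _ => 1) stronglyMeasurable_const
    (integrable_const _)
  have b2 : Integrable (fun x : Space d × Space d => ‖u' x.2‖ ^ 2)
      ((Domain.torus.measure d).prod (Domain.torus.measure d)) :=
    (hu'.integrable_pow (n := 2) (Or.inl rfl)).comp_snd _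
  have hm : StronglyMeasurable fun x : Space d × Space d => (inner ℝ (u (x.2 + x.1)) (u' x.2) : ℝ) :=
    (hu.stronglyMeasurable.comp_measurable
      (g := fun x : Space d × Space d => x.2 + x.1) (by fun_prop)).inner
      (hu'.stronglyMeasurable.comp_measurable measurable_snd)
  have hint : Integrable (fun x : Space d × Space d => (inner ℝ (u (x.2 + x.1)) (u' x.2) : ℝ))
      ((Domain.torus.measure d).prod (Domain.torus.measure d)) := by
    refine (b1.add b2).mono' hm.aestronglyMeasurable (Eventually.of_forall fun x => ?_)
    have := pow_mul_le_add (norm_nonneg (u (x.2 + x.1))) (norm_nonneg (u' x.2)) 1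
    have h2 := norm_corr2_integrand (u' x.2) (u (x.2 + x.1))
    simp only [Pi.add_apply, one_mul]
    exact h2.trans this
  simp only [corr2]
  rw [← integral_prod _ hint, integral_prod_symm _ hint]
  have e1 : ∀ y, ∫ h, (inner ℝ (u (y + h)) (u' y) : ℝ) ∂(Domain.torus.measure d)
      = inner ℝ (∫ h, u h ∂(Domain.torus.measure d)) (u' y) := fun y => by
    simp only [add_comm y]
    rw [integral_translate (hu.isFunctionOn.comp fun b => (inner ℝ b (u' y) : ℝ)) y]
    simp only [real_inner_comm (u' y)]
    rw [integral_inner i1, real_inner_comm]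
  simp only [e1]
  rw [integral_inner i2]
  simp only [real_inner_comm (∫ y, u' y ∂(Domain.torus.measure d))]
  rw [integral_inner i1, real_inner_comm]

/-- On the torus, averaging over the shift of the increment decouples the kernel from the
correlations. The flux term vanishes because an even kernel has a gradient of mean zero, and the
other one because the mean of the field is conserved. -/
lemma EulerField.integral_pairDensity_torus (hw : EulerField .torus T w)
    {χ : ℝ → ℝ → ℝ} (hχ : IsTwoTimeTest T χ) {k : Space d → ℝ} (hk : IsSpaceTest k)
    (hke : ∀ z, k (-z) = k z) :
    ∫ p, pairDensity .torus w χ k (fderiv ℝ k) 0 p ∂(pairMeasure T d) = 0 := by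
  have := isFiniteMeasure_torus d
  obtain ⟨A, hA⟩ := hχ.bounded
  obtain ⟨R, C, -, hRC⟩ := hk.exists_bound_translate 0
  have hg : Measurable fun x : ((ℝ × ℝ) × Space d) × Space d => (x.1.1, x.1.2 + x.2) := by fun_prop
  have m2 : StronglyMeasurable fun x : ((ℝ × ℝ) × Space d) × Space d =>
      corr2 .torus (w x.1.1.1) (w x.1.1.2) (x.1.2 + x.2) := by
    simpa only [add_zero, Function.comp_def] using (hw.stronglyMeasurable_corr2 0).comp_measurable hg
  have m3 : StronglyMeasurable fun x : ((ℝ × ℝ) × Space d) × Space d =>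
      corr3 .torus (w x.1.1.1) (w x.1.1.2) (x.1.2 + x.2) := by
    simpa only [add_zero, Function.comp_def] using (hw.stronglyMeasurable_corr3 0).comp_measurable hg
  have hm : StronglyMeasurable fun x : ((ℝ × ℝ) × Space d) × Space d =>
      pairDensity .torus w χ k (fderiv ℝ k) x.2 x.1 := by
    refine StronglyMeasurable.add (StronglyMeasurable.mul ?_ (StronglyMeasurable.mul ?_ m2))
      (StronglyMeasurable.mul ?_ ?_)
    · exact (hχ.continuous_deriv.comp (continuous_fst.comp continuous_fst)).stronglyMeasurable
    · exact (hk.contDiff.continuous.comp (continuous_snd.comp continuous_fst)).stronglyMeasurable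
    · exact (hχ.continuous.comp (continuous_fst.comp continuous_fst)).stronglyMeasurable
    · exact isBoundedBilinearMap_apply.continuous.comp_stronglyMeasurable
        ((hk.fderiv.contDiff.continuous.comp
          (continuous_snd.comp continuous_fst)).stronglyMeasurable.prodMk m3)
  have hint : Integrable (fun x : ((ℝ × ℝ) × Space d) × Space d =>
      pairDensity .torus w χ k (fderiv ℝ k) x.2 x.1)
      ((pairMeasure T d).prod (Domain.torus.measure d)) := by
    refine (((hw.integrable_pairWeight R C).const_mul A).comp_fst _).mono' hm.aestronglyMeasurable
      (Eventually.of_forall fun x => ?_)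
    have := hRC 0 (by simp) x.1.2
    rw [add_zero] at this
    exact hw.norm_pairDensity_le hA this.1 this.2 _
  have hav : ∀ p : (ℝ × ℝ) × Space d,
      ∫ s, pairDensity .torus w χ k (fderiv ℝ k) s p ∂(Domain.torus.measure d)
      = deriv (fun t => χ t p.1.2) p.1.1
          * (k p.2 * ∫ s, corr2 .torus (w p.1.1) (w p.1.2) s ∂(Domain.torus.measure d))
        + χ p.1.1 p.1.2
          * fderiv ℝ k p.2 (∫ s, corr3 .torus (w p.1.1) (w p.1.2) s ∂(Domain.torus.measure d)) := by
    intro p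
    have f2 := (hw.spaceField p.1.1).isFunctionOn_corr2 (w p.1.2)
    have f3 := (hw.spaceField p.1.1).isFunctionOn_corr3 (w p.1.2)
    have i2 : Integrable (fun s => corr2 .torus (w p.1.1) (w p.1.2) (p.2 + s))
        (Domain.torus.measure d) := by
      refine (integrable_const (lpEnergy .torus 2 (w p.1.1) + lpEnergy .torus 2 (w p.1.2))).mono'
        (m2.comp_measurable measurable_prodMk_left).aestronglyMeasurable
        (Eventually.of_forall fun s => ?_)
      exact (hw.spaceField p.1.1).norm_corr2_le_add (hw.spaceField p.1.2) _
    have i3 : Integrable (fun s => corr3 .torus (w p.1.1) (w p.1.2) (p.2 + s))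
        (Domain.torus.measure d) := by
      refine (integrable_const (lpEnergy .torus 3 (w p.1.1) + lpEnergy .torus 3 (w p.1.2))).mono'
        (m3.comp_measurable measurable_prodMk_left).aestronglyMeasurable
        (Eventually.of_forall fun s => ?_)
      exact (hw.spaceField p.1.1).norm_corr3_le_add (hw.spaceField p.1.2) _
    simp only [pairDensity]
    rw [integral_add ((i2.const_mul _).const_mul _)
      (((fderiv ℝ k p.2).integrable_comp i3).const_mul _), integral_const_mul, integral_const_mul,
      integral_const_mul, (fderiv ℝ k p.2).integral_comp_comm i3]
    simp only [add_comm p.2]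
    rw [integral_translate f2, integral_translate f3]
  have hI := hint.integral_prod_left
  simp only [hav] at hI
  have hki : Integrable k := hk.contDiff.continuous.integrable_of_hasCompactSupport hk.compact
  have hKi : Integrable (fderiv ℝ k) :=
    hk.fderiv.contDiff.continuous.integrable_of_hasCompactSupport hk.fderiv.compact
  have hz : ∀ q : ℝ × ℝ, ∫ z, (deriv (fun t => χ t q.2) q.1
          * (k z * ∫ s, corr2 .torus (w q.1) (w q.2) s ∂(Domain.torus.measure d))
        + χ q.1 q.2
          * fderiv ℝ k z (∫ s, corr3 .torus (w q.1) (w q.2) s ∂(Domain.torus.measure d)))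
      = (deriv (fun t => χ t q.2) q.1 * ∫ x, inner ℝ (w q.1 x)
          (∫ y, w q.2 y ∂(Domain.torus.measure d)) ∂(Domain.torus.measure d)) * ∫ z, k z := by
    intro q
    have hKa := ContinuousLinearMap.integral_apply hKi
      (∫ s, corr3 .torus (w q.1) (w q.2) s ∂(Domain.torus.measure d))
    rw [integral_fderiv_eq_zero_of_even hk.differentiable hke] at hKa
    rw [integral_add ((hki.mul_const _).const_mul _) ((hKi.apply_continuousLinearMap _).const_mul _),
      integral_const_mul, integral_const_mul, ← hKa, integral_mul_const,
      (hw.spaceField q.1).integral_corr2_torus (hw.spaceField q.2)]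
    simp only [zero_apply, mul_zero, add_zero]
    ring
  have hI2 := hI.integral_prod_left
  simp only [hz] at hI2
  have hzero : ∫ p, (∫ s, pairDensity .torus w χ k (fderiv ℝ k) s p ∂(Domain.torus.measure d))
      ∂(pairMeasure T d) = 0 := by
    simp only [hav]
    rw [integral_prod _ hI]
    simp only [hz]
    rw [integral_prod_symm _ hI2]
    refine integral_eq_zero_of_ae (Eventually.of_forall fun τ => ?_)
    simp only [Pi.zero_apply]
    rw [integral_mul_const]
    exact mul_eq_zero_of_left (hw.mean rfl _ (hχ.test τ) _) _
  rw [← integral_prod _ hint, integral_prod_symm _ hint] at hzero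
  simp only [hw.integral_pairDensity_shift hχ hk, integral_const, smul_eq_mul] at hzero
  refine (mul_eq_zero.1 hzero).resolve_left ?_
  have hne : volume (Domain.torus.cell d) ≠ 0 :=
    (isAddFundamentalDomain_cell d).measure_ne_zero (NeZero.ne _)
  have htop : (Domain.torus.measure d) univ ≠ ⊤ := measure_ne_top _ _
  rw [Measure.real]
  refine ENNReal.toReal_ne_zero.2 ⟨?_, htop⟩
  rwa [Domain.measure, Measure.restrict_apply_univ]

/-- On the whole space, the functional is unchanged by shifts of the increment, and the correlations
decay as the increment goes to infinity. The dimension has to be positive for a shift to exist. -/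
lemma EulerField.integral_pairDensity_whole (hd : 1 ≤ d) (hw : EulerField .whole T w)
    {χ : ℝ → ℝ → ℝ} (hχ : IsTwoTimeTest T χ) {k : Space d → ℝ} (hk : IsSpaceTest k) :
    ∫ p, pairDensity .whole w χ k (fderiv ℝ k) 0 p ∂(pairMeasure T d) = 0 := by
  obtain ⟨A, hA⟩ := hχ.bounded
  obtain ⟨R, C, -, hRC⟩ := hk.exists_bound_translate 0
  set e : Space d := EuclideanSpace.single ⟨0, hd⟩ 1 with he
  have he1 : ‖e‖ = 1 := by simp [he]
  have hlim : Tendsto (fun n : ℕ => ∫ p, pairDensity .whole w χ k (fderiv ℝ k) ((n : ℝ) • e) p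
      ∂(pairMeasure T d)) atTop (𝓝 (∫ _p, (0 : ℝ) ∂(pairMeasure T d))) := by
    refine tendsto_integral_of_dominated_convergence
      (fun p => A * pairWeight .whole w R C p)
      (fun n => (hw.integrable_pairDensity hχ hk _).aestronglyMeasurable)
      ((hw.integrable_pairWeight R C).const_mul A) (fun n => Eventually.of_forall fun p => ?_)
      (Eventually.of_forall fun p => ?_)
    · have := hRC 0 (by simp) p.2
      rw [add_zero] at this
      exact hw.norm_pairDensity_le hA this.1 this.2 _
    · have hinf : Tendsto (fun n : ℕ => p.2 + (n : ℝ) • e) atTop (comap norm atTop) := by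
        rw [tendsto_comap_iff]
        refine tendsto_atTop_mono (fun n => ?_)
          (tendsto_atTop_add_const_right _ (-‖p.2‖) tendsto_natCast_atTop_atTop)
        have := norm_sub_le (p.2 + (n : ℝ) • e) p.2
        rw [add_sub_cancel_left, norm_smul, he1, mul_one, Real.norm_natCast] at this
        simp only [Function.comp]
        linarith
      have t2 := (tendsto_corr2_whole (hw.spaceField p.1.1) (hw.spaceField p.1.2)).comp hinf
      have t3 := ((fderiv ℝ k p.2).continuous.tendsto 0).comp
        ((tendsto_corr3_whole (hw.spaceField p.1.1) (hw.spaceField p.1.2)).comp hinf)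
      rw [map_zero] at t3
      have := ((t2.const_mul (k p.2)).const_mul (deriv (fun t => χ t p.1.2) p.1.1)).add
        (t3.const_mul (χ p.1.1 p.1.2))
      simpa [pairDensity] using this
  simp only [hw.integral_pairDensity_shift hχ hk, integral_zero] at hlim
  exact tendsto_nhds_unique tendsto_const_nhds hlim

/-- The two-time correlation equation, integrated against an even kernel of the spatial
increment. -/
theorem EulerField.integral_pairDensity (hd : 1 ≤ d) (hw : EulerField Ω T w)
    {χ : ℝ → ℝ → ℝ} (hχ : IsTwoTimeTest T χ) {k : Space d → ℝ} (hk : IsSpaceTest k)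
    (hke : ∀ z, k (-z) = k z) :
    ∫ p, (deriv (fun t => χ t p.1.2) p.1.1 * (k p.2 * corr2 Ω (w p.1.1) (w p.1.2) p.2)
      + χ p.1.1 p.1.2 * fderiv ℝ k p.2 (corr3 Ω (w p.1.1) (w p.1.2) p.2))
      ∂(pairMeasure T d) = 0 := by
  have h : ∫ p, pairDensity Ω w χ k (fderiv ℝ k) 0 p ∂(pairMeasure T d) = 0 := by
    cases Ω with
    | whole => exact hw.integral_pairDensity_whole hd hχ hk
    | torus => exact hw.integral_pairDensity_torus hχ hk hke
  simpa only [pairDensity, add_zero] using h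

end

/-! ### Correlations at two times, smoothed by a kernel -/

section
variable {d : ℕ} {Ω : Domain} {T : ℝ} {w : ℝ → Space d → Space d} {u u' u'' : Space d → Space d}
  {k : Space d → ℝ}

/-- The kernel average `∫ k(z) ∫ u(y + z) · u'(y) dy dz` of the correlation of `u` and `u'`. -/
def kernelCorr (Ω : Domain) (k : Space d → ℝ) (u u' : Space d → Space d) : ℝ :=
  ∫ z, k z * corr2 Ω u u' z

/-- The flux `∫ ∇k(z) · ∫ (u(y + z) · u'(y)) u(y + z) dy dz`. -/
def kernelFlux (Ω : Domain) (k : Space d → ℝ) (u u' : Space d → Space d) : ℝ :=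
  ∫ z, fderiv ℝ k z (corr3 Ω u u' z)

lemma SpaceField.sub (hu : SpaceField Ω u) (hu' : SpaceField Ω u') :
    SpaceField Ω (fun x => u x - u' x) :=
  ⟨hu.stronglyMeasurable.sub hu'.stronglyMeasurable,
    hu.isFunctionOn.comp₂ hu'.isFunctionOn (fun a b => a - b),
    hu.memLp_two.sub hu'.memLp_two, hu.memLp_three.sub hu'.memLp_three⟩

lemma SpaceField.norm_corr2_le_young (hu : SpaceField Ω u) (hu' : SpaceField Ω u') {η : ℝ}
    (hη : 0 < η) (h : Space d) :
    ‖corr2 Ω u u' h‖ ≤ η * lpEnergy Ω 2 u + η⁻¹ ^ 1 * lpEnergy Ω 2 u' := by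
  have hn : (2 : ℕ) = 2 ∨ (2 : ℕ) = 3 := Or.inl rfl
  refine (hu.norm_corr2_le hu' h).trans ?_
  rw [← hu.integral_pow_translate 2 h, lpEnergy, ← integral_const_mul, ← integral_const_mul,
    ← integral_add ((hu.integrable_pow_translate hn h).const_mul _)
      ((hu'.integrable_pow hn).const_mul _)]
  exact integral_mono_of_nonneg (Eventually.of_forall fun y => by positivity)
    (((hu.integrable_pow_translate hn h).const_mul _).add ((hu'.integrable_pow hn).const_mul _))
    (Eventually.of_forall fun y => pow_mul_le_young (norm_nonneg _) (norm_nonneg _) hη 1)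

lemma SpaceField.norm_corr3_le_young (hu : SpaceField Ω u) (hu' : SpaceField Ω u') {η : ℝ}
    (hη : 0 < η) (h : Space d) :
    ‖corr3 Ω u u' h‖ ≤ η * lpEnergy Ω 3 u + η⁻¹ ^ 2 * lpEnergy Ω 3 u' := by
  have hn : (3 : ℕ) = 2 ∨ (3 : ℕ) = 3 := Or.inr rfl
  refine (hu.norm_corr3_le hu' h).trans ?_
  rw [← hu.integral_pow_translate 3 h, lpEnergy, ← integral_const_mul, ← integral_const_mul,
    ← integral_add ((hu.integrable_pow_translate hn h).const_mul _)
      ((hu'.integrable_pow hn).const_mul _)]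
  exact integral_mono_of_nonneg (Eventually.of_forall fun y => by positivity)
    (((hu.integrable_pow_translate hn h).const_mul _).add ((hu'.integrable_pow hn).const_mul _))
    (Eventually.of_forall fun y => pow_mul_le_young (norm_nonneg _) (norm_nonneg _) hη 2)

lemma SpaceField.stronglyMeasurable_corr2 (hu : SpaceField Ω u) (hu' : SpaceField Ω u') :
    StronglyMeasurable (corr2 Ω u u') :=
  ((hu.stronglyMeasurable.comp_measurable (g := fun x : Space d × Space d => x.2 + x.1)
    (by fun_prop)).inner (𝕜 := ℝ) (hu'.stronglyMeasurable.comp_measurable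
      measurable_snd)).integral_prod_right' (ν := Ω.measure d)

lemma SpaceField.stronglyMeasurable_corr3 (hu : SpaceField Ω u) (hu' : SpaceField Ω u') :
    StronglyMeasurable (corr3 Ω u u') := by
  have h : StronglyMeasurable fun x : Space d × Space d => u (x.2 + x.1) :=
    hu.stronglyMeasurable.comp_measurable (g := fun x : Space d × Space d => x.2 + x.1)
      (by fun_prop)
  exact ((h.inner (𝕜 := ℝ) (hu'.stronglyMeasurable.comp_measurable
      measurable_snd)).smul h).integral_prod_right' (ν := Ω.measure d)

lemma IsSpaceTest.integrable {F : Type*} [NormedAddCommGroup F] [NormedSpace ℝ F]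
    {g : Space d → F} (hg : IsSpaceTest g) : Integrable g :=
  hg.contDiff.continuous.integrable_of_hasCompactSupport hg.compact

lemma IsSpaceTest.integrable_corr2 (hk : IsSpaceTest k) (hu : SpaceField Ω u)
    (hu' : SpaceField Ω u') : Integrable (fun z => k z * corr2 Ω u u' z) :=
  (hk.integrable.norm.mul_const (lpEnergy Ω 2 u + lpEnergy Ω 2 u')).mono'
    (hk.contDiff.continuous.stronglyMeasurable.mul
      (hu.stronglyMeasurable_corr2 hu')).aestronglyMeasurable
    (Eventually.of_forall fun z => by
      rw [norm_mul]
      exact mul_le_mul_of_nonneg_left (hu.norm_corr2_le_add hu' z) (norm_nonneg _))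

lemma IsSpaceTest.integrable_corr3 (hk : IsSpaceTest k) (hu : SpaceField Ω u)
    (hu' : SpaceField Ω u') : Integrable (fun z => _root_.fderiv ℝ k z (corr3 Ω u u' z)) :=
  (hk.fderiv.integrable.norm.mul_const (lpEnergy Ω 3 u + lpEnergy Ω 3 u')).mono'
    (isBoundedBilinearMap_apply.continuous.comp_stronglyMeasurable
      (hk.fderiv.contDiff.continuous.stronglyMeasurable.prodMk
        (hu.stronglyMeasurable_corr3 hu'))).aestronglyMeasurable
    (Eventually.of_forall fun z => (ContinuousLinearMap.le_opNorm _ _).trans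
      (mul_le_mul_of_nonneg_left (hu.norm_corr3_le_add hu' z) (norm_nonneg _)))

lemma IsSpaceTest.norm_kernelCorr_le (hk : IsSpaceTest k) (hu : SpaceField Ω u)
    (hu' : SpaceField Ω u') {η : ℝ} (hη : 0 < η) : ‖kernelCorr Ω k u u'‖
      ≤ (∫ z, ‖k z‖) * (η * lpEnergy Ω 2 u + η⁻¹ ^ 1 * lpEnergy Ω 2 u') := by
  rw [← integral_mul_const]
  refine norm_integral_le_of_norm_le (hk.integrable.norm.mul_const _)
    (Eventually.of_forall fun z => ?_)
  rw [norm_mul]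
  exact mul_le_mul_of_nonneg_left (hu.norm_corr2_le_young hu' hη z) (norm_nonneg _)

lemma IsSpaceTest.norm_kernelFlux_le (hk : IsSpaceTest k) (hu : SpaceField Ω u)
    (hu' : SpaceField Ω u') {η : ℝ} (hη : 0 < η) : ‖kernelFlux Ω k u u'‖
      ≤ (∫ z, ‖_root_.fderiv ℝ k z‖) * (η * lpEnergy Ω 3 u + η⁻¹ ^ 2 * lpEnergy Ω 3 u') := by
  rw [← integral_mul_const]
  refine norm_integral_le_of_norm_le (hk.fderiv.integrable.norm.mul_const _)
    (Eventually.of_forall fun z => ?_)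
  exact (ContinuousLinearMap.le_opNorm _ _).trans
    (mul_le_mul_of_nonneg_left (hu.norm_corr3_le_young hu' hη z) (norm_nonneg _))

lemma IsSpaceTest.kernelCorr_sub (hk : IsSpaceTest k) (hu : SpaceField Ω u)
    (hu' : SpaceField Ω u') (hu'' : SpaceField Ω u'') :
    kernelCorr Ω k u (fun x => u' x - u'' x) = kernelCorr Ω k u u' - kernelCorr Ω k u u'' := by
  rw [kernelCorr, kernelCorr, kernelCorr,
    ← integral_sub (hk.integrable_corr2 hu hu') (hk.integrable_corr2 hu hu'')]
  refine integral_congr_ae (Eventually.of_forall fun z => ?_)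
  simp only [corr2, inner_sub_right]
  rw [integral_sub (hu.integrable_corr2 hu' z) (hu.integrable_corr2 hu'' z), mul_sub]

lemma IsSpaceTest.kernelFlux_sub (hk : IsSpaceTest k) (hu : SpaceField Ω u)
    (hu' : SpaceField Ω u') (hu'' : SpaceField Ω u'') :
    kernelFlux Ω k u (fun x => u' x - u'' x) = kernelFlux Ω k u u' - kernelFlux Ω k u u'' := by
  rw [kernelFlux, kernelFlux, kernelFlux,
    ← integral_sub (hk.integrable_corr3 hu hu') (hk.integrable_corr3 hu hu'')]
  refine integral_congr_ae (Eventually.of_forall fun z => ?_)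
  simp only [corr3, inner_sub_right, sub_smul]
  rw [integral_sub (hu.integrable_corr3 hu' z) (hu.integrable_corr3 hu'' z), map_sub]

lemma SpaceField.kernelCorr_comm (hu : SpaceField Ω u) (hu' : SpaceField Ω u')
    (hke : ∀ z, k (-z) = k z) : kernelCorr Ω k u u' = kernelCorr Ω k u' u := by
  rw [kernelCorr, ← integral_neg_eq_self]
  simp only [hke, hu.corr2_neg hu', kernelCorr]

lemma kernelCorr_zero_left : kernelCorr Ω k 0 u' = 0 := by simp [kernelCorr, corr2]
lemma kernelCorr_zero_right : kernelCorr Ω k u 0 = 0 := by simp [kernelCorr, corr2]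
lemma kernelFlux_zero_left : kernelFlux Ω k 0 u' = 0 := by simp [kernelFlux, corr3]
lemma kernelFlux_zero_right : kernelFlux Ω k u 0 = 0 := by simp [kernelFlux, corr3]

lemma EulerField.stronglyMeasurable_kernelCorr (hw : EulerField Ω T w) (hk : IsSpaceTest k) :
    StronglyMeasurable fun q : ℝ × ℝ => kernelCorr Ω k (w q.1) (w q.2) := by
  have h := hw.stronglyMeasurable_corr2 0
  simp only [add_zero] at h
  exact ((hk.contDiff.continuous.comp continuous_snd).stronglyMeasurable.mul
    h).integral_prod_right' (ν := (volume : Measure (Space d)))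

lemma EulerField.stronglyMeasurable_kernelFlux (hw : EulerField Ω T w) (hk : IsSpaceTest k) :
    StronglyMeasurable fun q : ℝ × ℝ => kernelFlux Ω k (w q.1) (w q.2) := by
  have h := hw.stronglyMeasurable_corr3 0
  simp only [add_zero] at h
  exact (isBoundedBilinearMap_apply.continuous.comp_stronglyMeasurable
    ((hk.fderiv.contDiff.continuous.comp continuous_snd).stronglyMeasurable.prodMk
      h)).integral_prod_right' (ν := (volume : Measure (Space d)))

/-- The kernel-averaged two-time correlation equation, over all pairs of times. -/
lemma EulerField.integral_kernel_equation (hd : 1 ≤ d) (hw : EulerField Ω T w) {χ : ℝ → ℝ → ℝ}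
    (hχ : IsTwoTimeTest T χ) (hk : IsSpaceTest k) (hke : ∀ z, k (-z) = k z) :
    ∫ q : ℝ × ℝ, (deriv (fun t => χ t q.2) q.1 * kernelCorr Ω k (w q.1) (w q.2)
      + χ q.1 q.2 * kernelFlux Ω k (w q.1) (w q.2)) = 0 := by
  have h := hw.integral_pairDensity hd hχ hk hke
  have hi := hw.integrable_pairDensity hχ hk 0
  have hi' : Integrable (fun p : (ℝ × ℝ) × Space d =>
      deriv (fun t => χ t p.1.2) p.1.1 * (k p.2 * corr2 Ω (w p.1.1) (w p.1.2) p.2)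
      + χ p.1.1 p.1.2 * fderiv ℝ k p.2 (corr3 Ω (w p.1.1) (w p.1.2) p.2)) (pairMeasure T d) := by
    refine hi.congr (Eventually.of_forall fun p => ?_)
    simp only [pairDensity, add_zero]
  rw [integral_prod _ hi'] at h
  have e : ∀ q : ℝ × ℝ, ∫ z, (deriv (fun t => χ t q.2) q.1 * (k z * corr2 Ω (w q.1) (w q.2) z)
      + χ q.1 q.2 * fderiv ℝ k z (corr3 Ω (w q.1) (w q.2) z))
      = deriv (fun t => χ t q.2) q.1 * kernelCorr Ω k (w q.1) (w q.2)
      + χ q.1 q.2 * kernelFlux Ω k (w q.1) (w q.2) := fun q => by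
    rw [integral_add ((hk.integrable_corr2 (hw.spaceField _) (hw.spaceField _)).const_mul _)
      ((hk.integrable_corr3 (hw.spaceField _) (hw.spaceField _)).const_mul _),
      integral_const_mul, integral_const_mul, kernelCorr, kernelFlux]
  simp only [e] at h
  rw [Measure.prod_restrict] at h
  rw [← setIntegral_eq_integral_of_forall_compl_eq_zero (s := Ioo 0 T ×ˢ Ioo 0 T)]
  · exact h
  · intro q hq
    rw [mem_prod, not_and_or] at hq
    rcases hq with hq | hq
    · simp only [hw.eq_zero _ hq, kernelCorr_zero_left, kernelFlux_zero_left, mul_zero, add_zero]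
    · simp only [hw.eq_zero _ hq, kernelCorr_zero_right, kernelFlux_zero_right, mul_zero, add_zero]

end

/-! ### Continuity of time translations -/

section
variable {d : ℕ} {Ω : Domain} {T : ℝ} {w : ℝ → Space d → Space d} {k : Space d → ℝ}

/-- The translation by `h` in time. -/
def timeShift (d : ℕ) (h : ℝ) : C(ℝ × Space d, ℝ × Space d) :=
  ⟨fun x => (x.1 + h, x.2), by fun_prop⟩

lemma measurePreserving_timeShift {m : Measure (Space d)} [SFinite m] (h : ℝ) :
    MeasurePreserving (timeShift d h) (volume.prod m) (volume.prod m) :=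
  (measurePreserving_add_right (volume : Measure ℝ) h).prod (MeasurePreserving.id m)

lemma tendsto_timeShift : Tendsto (timeShift d) (𝓝 0) (𝓝 (timeShift d 0)) := by
  have hc : Continuous (timeShift d) :=
    ContinuousMap.continuous_of_continuous_uncurry _ (by
      simp only [Function.uncurry_def, timeShift, ContinuousMap.coe_mk]
      fun_prop)
  exact hc.tendsto 0

lemma tendsto_integral_time_increment {f : ℝ × Space d → Space d} {n : ℕ} (hn : 1 ≤ n)
    (hf : MemLp f n (volume.prod (Ω.measure d))) :
    Tendsto (fun h : ℝ => ∫ x : ℝ × Space d, ‖f (x.1 + h, x.2) - f x‖ ^ n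
      ∂(volume.prod (Ω.measure d))) (𝓝 0) (𝓝 0) := by
  have : Fact (1 ≤ (n : ℝ≥0∞)) := ⟨by exact_mod_cast hn⟩
  have hmp := fun h => measurePreserving_timeShift (d := d) (m := Ω.measure d) h
  have hlim := (tendsto_const_nhds (x := hf.toLp f)).compMeasurePreservingLp tendsto_timeShift
    hmp (hmp 0) (ENNReal.natCast_ne_top n)
  have hval : ∀ h, Lp.compMeasurePreserving (timeShift d h) (hmp h) (hf.toLp f)
      = (hf.comp_measurePreserving (hmp h)).toLp (f ∘ timeShift d h) := fun h =>
    Lp.toLp_compMeasurePreserving hf (hmp h)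
  simp only [hval] at hlim
  have hnorm := (tendsto_iff_norm_sub_tendsto_zero.1 hlim).pow n
  rw [zero_pow (by omega)] at hnorm
  refine hnorm.congr fun h => ?_
  have h1 := hf.comp_measurePreserving (hmp h)
  have h0 := hf.comp_measurePreserving (hmp 0)
  have hn0 : (n : ℝ) ≠ 0 := by exact_mod_cast (by omega : n ≠ 0)
  rw [← MemLp.toLp_sub, Lp.norm_toLp, (h1.sub h0).eLpNorm_eq_integral_rpow_norm
    (by exact_mod_cast (by omega : n ≠ 0)) (ENNReal.natCast_ne_top n), ENNReal.toReal_ofReal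
    (by positivity), ENNReal.toReal_natCast, ← Real.rpow_natCast, ← Real.rpow_mul
    (integral_nonneg fun _ => by positivity), inv_mul_cancel₀ hn0, Real.rpow_one]
  refine integral_congr_ae (Eventually.of_forall fun x => ?_)
  simp [timeShift]

lemma EulerField.memLp_prod (hw : EulerField Ω T w) {n : ℕ} (hn : n = 2 ∨ n = 3) :
    MemLp (Function.uncurry w) n (volume.prod (Ω.measure d)) := by
  rcases hn with rfl | rfl
  · exact_mod_cast hw.memLp_two_prod
  · exact_mod_cast hw.memLp_three_prod

lemma EulerField.integrable_increment (hw : EulerField Ω T w) {n : ℕ} (hn : n = 2 ∨ n = 3)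
    (h : ℝ) : Integrable (fun x : ℝ × Space d => ‖w (x.1 + h) x.2 - w x.1 x.2‖ ^ n)
      (volume.prod (Ω.measure d)) := by
  have h1 := (hw.memLp_prod hn).comp_measurePreserving
    (measurePreserving_timeShift (d := d) (m := Ω.measure d) h)
  exact (h1.sub (hw.memLp_prod hn)).integrable_norm_pow (by omega)

lemma EulerField.integrable_lpEnergy_increment (hw : EulerField Ω T w) {n : ℕ}
    (hn : n = 2 ∨ n = 3) (h : ℝ) :
    Integrable (fun t => lpEnergy Ω n (fun x => w (t + h) x - w t x)) :=
  (hw.integrable_increment hn h).integral_prod_left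

lemma EulerField.tendsto_lpEnergy_increment (hw : EulerField Ω T w) {n : ℕ} (hn : n = 2 ∨ n = 3) :
    Tendsto (fun h => ∫ t, lpEnergy Ω n (fun x => w (t + h) x - w t x)) (𝓝 0) (𝓝 0) := by
  refine (tendsto_integral_time_increment (by omega) (hw.memLp_prod hn)).congr fun h => ?_
  exact integral_prod _ (hw.integrable_increment hn h)

/-- The integrand of the symmetrized energy balance at the pair of times `(t, τ)`. -/
def balance (Ω : Domain) (w : ℝ → Space d → Space d) (k : Space d → ℝ) (ψ : ℝ → ℝ) (t τ : ℝ) : ℝ :=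
  deriv ψ t * kernelCorr Ω k (w t) (w τ) + (ψ t + ψ τ) * kernelFlux Ω k (w t) (w τ)

lemma EulerField.stronglyMeasurable_balance (hw : EulerField Ω T w) (hk : IsSpaceTest k)
    {ψ : ℝ → ℝ} (hψ : IsTimeTest T ψ) :
    StronglyMeasurable fun q : ℝ × ℝ => balance Ω w k ψ q.1 q.2 := by
  have hc := hψ.contDiff.continuous
  exact ((hψ.continuous_deriv.comp continuous_fst).stronglyMeasurable.mul
    (hw.stronglyMeasurable_kernelCorr hk)).add
    (((hc.comp continuous_fst).add (hc.comp continuous_snd)).stronglyMeasurable.mul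
    (hw.stronglyMeasurable_kernelFlux hk))

lemma EulerField.integrable_balance_diag (hw : EulerField Ω T w) (hk : IsSpaceTest k)
    {ψ : ℝ → ℝ} (hψ : IsTimeTest T ψ) : Integrable fun t => balance Ω w k ψ t t := by
  obtain ⟨C, hC0, hC1, hC2⟩ := hψ.bounded
  have i2 := hw.integrable_lpEnergy_volume (n := 2) (Or.inl rfl)
  have i3 := hw.integrable_lpEnergy_volume (n := 3) (Or.inr rfl)
  refine (((i2.const_mul (C * ((∫ z, ‖k z‖) * 2)))).add
    (i3.const_mul (C * ((∫ z, ‖fderiv ℝ k z‖) * 4)))).mono'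
    ((hw.stronglyMeasurable_balance hk hψ).comp_measurable
      (g := fun t : ℝ => (t, t)) (by fun_prop)).aestronglyMeasurable
    (Eventually.of_forall fun t => ?_)
  have b2 := hk.norm_kernelCorr_le (hw.spaceField t) (hw.spaceField t) one_pos
  have b3 := hk.norm_kernelFlux_le (hw.spaceField t) (hw.spaceField t) one_pos
  refine (norm_add_le _ _).trans (add_le_add ?_ ?_)
  · rw [norm_mul]
    refine (mul_le_mul (hC2 t) b2 (norm_nonneg _) hC0).trans (le_of_eq ?_)
    simp only [inv_one, one_pow]; ring
  · rw [norm_mul]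
    have e1 : ‖ψ t + ψ t‖ ≤ C + C := (norm_add_le _ _).trans (add_le_add (hC1 t) (hC1 t))
    refine (mul_le_mul e1 b3 (norm_nonneg _) (by linarith)).trans (le_of_eq ?_)
    simp only [inv_one, one_pow]; ring

lemma IsTimeTest.abs_sub_le {ψ : ℝ → ℝ} (hψ : IsTimeTest T ψ) {C : ℝ}
    (hC : ∀ t, |deriv ψ t| ≤ C) (t h : ℝ) : |ψ (t + h) - ψ t| ≤ C * |h| := by
  have := Convex.norm_image_sub_le_of_norm_deriv_le (f := ψ) (s := univ) (x := t) (y := t + h)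
    (fun x _ => hψ.differentiable x) (fun x _ => hC x) convex_univ (mem_univ _) (mem_univ _)
  simpa using this

/-- The two correlations depend linearly on the field at the second time, so that its replacement
by the field at the first time costs an increment in time. Young's parameter `η` isolates this
increment from the energy of the field. -/
lemma EulerField.norm_balance_sub_le (hw : EulerField Ω T w) (hk : IsSpaceTest k)
    {ψ : ℝ → ℝ} (hψ : IsTimeTest T ψ) {C : ℝ} (hC1 : ∀ t, |ψ t| ≤ C)
    (hC2 : ∀ t, |deriv ψ t| ≤ C) {η : ℝ} (hη : 0 < η) (t h : ℝ) :
    ‖balance Ω w k ψ t (t + h) - balance Ω w k ψ t t‖ ≤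
      C * ((∫ z, ‖k z‖) * (η * lpEnergy Ω 2 (w t)
        + η⁻¹ ^ 1 * lpEnergy Ω 2 (fun x => w (t + h) x - w t x)))
      + (2 * C) * ((∫ z, ‖fderiv ℝ k z‖) * (η * lpEnergy Ω 3 (w t)
        + η⁻¹ ^ 2 * lpEnergy Ω 3 (fun x => w (t + h) x - w t x)))
      + (C * |h|) * ((∫ z, ‖fderiv ℝ k z‖) * (2 * lpEnergy Ω 3 (w t))) := by
  have hC0 : 0 ≤ C := (abs_nonneg _).trans (hC1 0)
  have s0 := hw.spaceField t
  have s1 := hw.spaceField (t + h)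
  have b2 := hk.norm_kernelCorr_le s0 (s1.sub s0) hη
  have b3 := hk.norm_kernelFlux_le s0 (s1.sub s0) hη
  have b4 := hk.norm_kernelFlux_le s0 s0 one_pos
  have e : balance Ω w k ψ t (t + h) - balance Ω w k ψ t t
      = deriv ψ t * kernelCorr Ω k (w t) (fun x => w (t + h) x - w t x)
        + (ψ t + ψ (t + h)) * kernelFlux Ω k (w t) (fun x => w (t + h) x - w t x)
        + (ψ (t + h) - ψ t) * kernelFlux Ω k (w t) (w t) := by
    rw [hk.kernelCorr_sub s0 s1 s0, hk.kernelFlux_sub s0 s1 s0, balance, balance]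
    ring
  rw [e]
  refine (norm_add_le _ _).trans (add_le_add ((norm_add_le _ _).trans (add_le_add ?_ ?_)) ?_)
  · rw [norm_mul]
    exact mul_le_mul (hC2 t) b2 (norm_nonneg _) hC0
  · rw [norm_mul]
    refine mul_le_mul ?_ b3 (norm_nonneg _) (by linarith)
    refine (norm_add_le _ _).trans ?_
    have := hC1 t
    have := hC1 (t + h)
    simp only [Real.norm_eq_abs]
    linarith
  · rw [norm_mul]
    refine mul_le_mul (hψ.abs_sub_le hC2 t h) (b4.trans (le_of_eq ?_)) (norm_nonneg _)
      (by positivity)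
    simp only [inv_one, one_pow]; ring

lemma EulerField.integrable_balance_bound (hw : EulerField Ω T w) (a b c η η' η'' h : ℝ) :
    Integrable fun t => a * (b * (η * lpEnergy Ω 2 (w t)
        + η' * lpEnergy Ω 2 (fun x => w (t + h) x - w t x)))
      + (2 * a) * (c * (η * lpEnergy Ω 3 (w t)
        + η'' * lpEnergy Ω 3 (fun x => w (t + h) x - w t x)))
      + (a * |h|) * (c * (2 * lpEnergy Ω 3 (w t))) := by
  have i2 := hw.integrable_lpEnergy_volume (n := 2) (Or.inl rfl)
  have i3 := hw.integrable_lpEnergy_volume (n := 3) (Or.inr rfl)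
  have j2 := hw.integrable_lpEnergy_increment (n := 2) (Or.inl rfl) h
  have j3 := hw.integrable_lpEnergy_increment (n := 3) (Or.inr rfl) h
  exact (((((i2.const_mul _).add (j2.const_mul _)).const_mul _).const_mul _).add
    ((((i3.const_mul _).add (j3.const_mul _)).const_mul _).const_mul _)).add
    (((i3.const_mul _).const_mul _).const_mul _)

lemma EulerField.integral_balance_bound (hw : EulerField Ω T w) (a b c η η' η'' h : ℝ) :
    ∫ t, (a * (b * (η * lpEnergy Ω 2 (w t)
        + η' * lpEnergy Ω 2 (fun x => w (t + h) x - w t x)))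
      + (2 * a) * (c * (η * lpEnergy Ω 3 (w t)
        + η'' * lpEnergy Ω 3 (fun x => w (t + h) x - w t x)))
      + (a * |h|) * (c * (2 * lpEnergy Ω 3 (w t))))
    = a * (b * (η * (∫ t, lpEnergy Ω 2 (w t))
        + η' * ∫ t, lpEnergy Ω 2 (fun x => w (t + h) x - w t x)))
      + (2 * a) * (c * (η * (∫ t, lpEnergy Ω 3 (w t))
        + η'' * ∫ t, lpEnergy Ω 3 (fun x => w (t + h) x - w t x)))
      + (a * |h|) * (c * (2 * ∫ t, lpEnergy Ω 3 (w t))) := by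
  have i2 := hw.integrable_lpEnergy_volume (n := 2) (Or.inl rfl)
  have i3 := hw.integrable_lpEnergy_volume (n := 3) (Or.inr rfl)
  have j2 := hw.integrable_lpEnergy_increment (n := 2) (Or.inl rfl) h
  have j3 := hw.integrable_lpEnergy_increment (n := 3) (Or.inr rfl) h
  have k2 := (i2.const_mul η).fun_add (j2.const_mul η')
  have k3 := (i3.const_mul η).fun_add (j3.const_mul η'')
  rw [integral_add (((k2.const_mul b).const_mul a).fun_add ((k3.const_mul c).const_mul (2 * a)))
      (((i3.const_mul 2).const_mul c).const_mul (a * |h|)),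
    integral_add ((k2.const_mul b).const_mul a) ((k3.const_mul c).const_mul (2 * a))]
  simp only [integral_const_mul]
  rw [integral_add (i2.const_mul η) (j2.const_mul η'),
    integral_add (i3.const_mul η) (j3.const_mul η'')]
  simp only [integral_const_mul]

lemma EulerField.integrable_balance_shift (hw : EulerField Ω T w) (hk : IsSpaceTest k)
    {ψ : ℝ → ℝ} (hψ : IsTimeTest T ψ) (h : ℝ) :
    Integrable fun t => balance Ω w k ψ t (t + h) := by
  obtain ⟨C, -, hC1, hC2⟩ := hψ.bounded
  have hd := hw.integrable_balance_diag hk hψ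
  have hm : StronglyMeasurable fun t => balance Ω w k ψ t (t + h) :=
    (hw.stronglyMeasurable_balance hk hψ).comp_measurable (g := fun t : ℝ => (t, t + h))
      (by fun_prop)
  have : Integrable fun t => balance Ω w k ψ t (t + h) - balance Ω w k ψ t t :=
    (hw.integrable_balance_bound C _ _ 1 _ _ h).mono' (hm.aestronglyMeasurable.sub hd.1)
      (Eventually.of_forall fun t => hw.norm_balance_sub_le hk hψ hC1 hC2 one_pos t h)
  exact (this.add hd).congr (Eventually.of_forall fun t => sub_add_cancel _ _)

/-- The symmetrized balance is continuous at coinciding times. -/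
lemma EulerField.tendsto_integral_balance (hw : EulerField Ω T w) (hk : IsSpaceTest k)
    {ψ : ℝ → ℝ} (hψ : IsTimeTest T ψ) :
    Tendsto (fun h => ∫ t, balance Ω w k ψ t (t + h)) (𝓝 0) (𝓝 (∫ t, balance Ω w k ψ t t)) := by
  obtain ⟨C, hC0, hC1, hC2⟩ := hψ.bounded
  set K2 := ∫ z, ‖k z‖ with hK2
  set K3 := ∫ z, ‖fderiv ℝ k z‖ with hK3
  set N2 := ∫ t, lpEnergy Ω 2 (w t) with hN2
  set N3 := ∫ t, lpEnergy Ω 3 (w t) with hN3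
  have k2 : 0 ≤ K2 := integral_nonneg fun _ => norm_nonneg _
  have k3 : 0 ≤ K3 := integral_nonneg fun _ => norm_nonneg _
  have n2 : 0 ≤ N2 := integral_nonneg fun _ => lpEnergy_nonneg _ _ _
  have n3 : 0 ≤ N3 := integral_nonneg fun _ => lpEnergy_nonneg _ _ _
  have hbound : ∀ η > 0, ∀ h, ‖(∫ t, balance Ω w k ψ t (t + h)) - ∫ t, balance Ω w k ψ t t‖
      ≤ C * (K2 * (η * N2 + η⁻¹ ^ 1 * ∫ t, lpEnergy Ω 2 (fun x => w (t + h) x - w t x)))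
      + (2 * C) * (K3 * (η * N3 + η⁻¹ ^ 2 * ∫ t, lpEnergy Ω 3 (fun x => w (t + h) x - w t x)))
      + (C * |h|) * (K3 * (2 * N3)) := fun η hη h => by
    rw [← integral_sub (hw.integrable_balance_shift hk hψ h) (hw.integrable_balance_diag hk hψ),
      ← hw.integral_balance_bound]
    exact norm_integral_le_of_norm_le (hw.integrable_balance_bound C K2 K3 η _ _ h)
      (Eventually.of_forall fun t => hw.norm_balance_sub_le hk hψ hC1 hC2 hη t h)
  rw [tendsto_iff_norm_sub_tendsto_zero, Metric.tendsto_nhds]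
  intro ε hε
  set M := C * (K2 * N2) + 2 * C * (K3 * N3) with hM
  have hM0 : 0 ≤ M := by positivity
  set η := ε / (2 * (M + 1)) with hη
  have hη0 : 0 < η := by positivity
  have hηM : η * M < ε := by
    have : η * (M + 1) = ε / 2 := by rw [hη]; field_simp
    have : η * M ≤ η * (M + 1) := mul_le_mul_of_nonneg_left (by linarith) hη0.le
    linarith
  have hlim : Tendsto (fun h : ℝ =>
      C * (K2 * (η * N2 + η⁻¹ ^ 1 * ∫ t, lpEnergy Ω 2 (fun x => w (t + h) x - w t x)))
      + (2 * C) * (K3 * (η * N3 + η⁻¹ ^ 2 * ∫ t, lpEnergy Ω 3 (fun x => w (t + h) x - w t x)))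
      + (C * |h|) * (K3 * (2 * N3))) (𝓝 0)
      (𝓝 (C * (K2 * (η * N2 + η⁻¹ ^ 1 * 0)) + (2 * C) * (K3 * (η * N3 + η⁻¹ ^ 2 * 0))
        + (C * |(0 : ℝ)|) * (K3 * (2 * N3)))) := by
    refine Tendsto.add (Tendsto.add ?_ ?_) ?_
    · exact ((((hw.tendsto_lpEnergy_increment (Or.inl rfl)).const_mul _).const_add _).const_mul
        _).const_mul _
    · exact ((((hw.tendsto_lpEnergy_increment (Or.inr rfl)).const_mul _).const_add _).const_mul
        _).const_mul _
    · exact ((continuous_abs.tendsto 0).const_mul C).mul_const _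
  have hval : C * (K2 * (η * N2 + η⁻¹ ^ 1 * 0)) + (2 * C) * (K3 * (η * N3 + η⁻¹ ^ 2 * 0))
      + (C * |(0 : ℝ)|) * (K3 * (2 * N3)) = η * M := by
    rw [hM, abs_zero]; ring
  rw [hval] at hlim
  filter_upwards [hlim.eventually (gt_mem_nhds hηM)] with h hh
  rw [Real.dist_eq, sub_zero, abs_norm]
  exact (hbound η hη0 h).trans_lt hh

end

/-! ### The regularized energy balance -/

section
variable {d : ℕ} {Ω : Domain} {T : ℝ} {w : ℝ → Space d → Space d} {k : Space d → ℝ}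

lemma EulerField.integrable_kernelCorr (hw : EulerField Ω T w) (hk : IsSpaceTest k) :
    Integrable fun q : ℝ × ℝ => kernelCorr Ω k (w q.1) (w q.2) := by
  have i2 := hw.integrable_lpEnergy (n := 2) (Or.inl rfl)
  have h : Integrable (fun q : ℝ × ℝ => kernelCorr Ω k (w q.1) (w q.2))
      ((timeMeasure T).prod (timeMeasure T)) := by
    refine (((i2.comp_fst (timeMeasure T)).add (i2.comp_snd (timeMeasure T))).const_mul
      (∫ z, ‖k z‖)).mono' (hw.stronglyMeasurable_kernelCorr hk).aestronglyMeasurable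
      (Eventually.of_forall fun q => ?_)
    simpa using hk.norm_kernelCorr_le (hw.spaceField q.1) (hw.spaceField q.2) one_pos
  rw [Measure.prod_restrict] at h
  refine (integrableOn_iff_integrable_of_support_subset fun q hq => ?_).1 h
  by_contra hn
  rw [mem_prod, not_and_or] at hn
  rcases hn with hn | hn
  · exact hq (by simp only [hw.eq_zero _ hn, kernelCorr_zero_left])
  · exact hq (by simp only [hw.eq_zero _ hn, kernelCorr_zero_right])

lemma EulerField.integrable_kernelFlux (hw : EulerField Ω T w) (hk : IsSpaceTest k) :
    Integrable fun q : ℝ × ℝ => kernelFlux Ω k (w q.1) (w q.2) := by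
  have i3 := hw.integrable_lpEnergy (n := 3) (Or.inr rfl)
  have h : Integrable (fun q : ℝ × ℝ => kernelFlux Ω k (w q.1) (w q.2))
      ((timeMeasure T).prod (timeMeasure T)) := by
    refine (((i3.comp_fst (timeMeasure T)).add (i3.comp_snd (timeMeasure T))).const_mul
      (∫ z, ‖fderiv ℝ k z‖)).mono' (hw.stronglyMeasurable_kernelFlux hk).aestronglyMeasurable
      (Eventually.of_forall fun q => ?_)
    simpa using hk.norm_kernelFlux_le (hw.spaceField q.1) (hw.spaceField q.2) one_pos
  rw [Measure.prod_restrict] at h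
  refine (integrableOn_iff_integrable_of_support_subset fun q hq => ?_).1 h
  by_contra hn
  rw [mem_prod, not_and_or] at hn
  rcases hn with hn | hn
  · exact hq (by simp only [hw.eq_zero _ hn, kernelFlux_zero_left])
  · exact hq (by simp only [hw.eq_zero _ hn, kernelFlux_zero_right])

lemma hasDerivAt_two_time {ψ ρ : ℝ → ℝ} (hψ : Differentiable ℝ ψ) (hρ : Differentiable ℝ ρ)
    (t τ : ℝ) : HasDerivAt (fun t => (ψ t + ψ τ) * ρ (t - τ))
      (deriv ψ t * ρ (t - τ) + (ψ t + ψ τ) * deriv ρ (t - τ)) t := by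
  have h1 := (hψ t).hasDerivAt.add_const (ψ τ)
  have h2 : HasDerivAt (fun t => ρ (t - τ)) (deriv ρ (t - τ)) t := by
    simpa using (hρ (t - τ)).hasDerivAt.comp_sub_const t τ
  exact h1.mul h2

/-- Products of a symmetrized time cutoff with a kernel concentrated near coinciding times are
admissible. -/
lemma IsTimeTest.isTwoTimeTest {ψ : ℝ → ℝ} (hψ : IsTimeTest T ψ) {ε : ℝ}
    (hε : Metric.cthickening ε (tsupport ψ) ⊆ Ioo 0 T) {ρ : ℝ → ℝ}
    (hρ : ContDiff ℝ ((⊤ : ℕ∞) : WithTop ℕ∞) ρ) (hρc : HasCompactSupport ρ)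
    (hρε : ∀ h, ρ h ≠ 0 → |h| ≤ ε) :
    IsTwoTimeTest T (fun t τ => (ψ t + ψ τ) * ρ (t - τ)) := by
  have hρd : Differentiable ℝ ρ := hρ.differentiable (by simp)
  have hder : ∀ q : ℝ × ℝ, deriv (fun t => (ψ t + ψ q.2) * ρ (t - q.2)) q.1
      = deriv ψ q.1 * ρ (q.1 - q.2) + (ψ q.1 + ψ q.2) * deriv ρ (q.1 - q.2) := fun q =>
    (hasDerivAt_two_time hψ.differentiable hρd q.1 q.2).deriv
  have hψc := hψ.contDiff.continuous
  have hρ'c : Continuous (deriv ρ) := hρ.continuous_deriv (by simp)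
  refine ⟨fun τ => ?_, ?_, ?_, ?_⟩
  · have hsupp : tsupport (fun t => (ψ t + ψ τ) * ρ (t - τ))
        ⊆ Metric.cthickening ε (tsupport ψ) := by
      refine closure_minimal (fun t ht => ?_) Metric.isClosed_cthickening
      obtain ⟨h1, h2⟩ := mul_ne_zero_iff.1 ht
      have hd := hρε _ h2
      by_cases hτ : τ ∈ tsupport ψ
      · exact Metric.mem_cthickening_of_dist_le t τ ε _ hτ (by rwa [Real.dist_eq])
      · rw [image_eq_zero_of_notMem_tsupport hτ, add_zero] at h1
        exact Metric.self_subset_cthickening _ (subset_tsupport _ h1)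
    refine ⟨(hψ.contDiff.add contDiff_const).mul (hρ.comp (contDiff_id.sub contDiff_const)),
      ?_, hsupp.trans hε⟩
    exact hψ.compact.isCompact.cthickening.of_isClosed_subset (isClosed_tsupport _) hsupp
  · exact ((hψc.comp continuous_fst).add (hψc.comp continuous_snd)).mul
      (hρ.continuous.comp (continuous_fst.sub continuous_snd))
  · simp only [hder]
    have := hψ.continuous_deriv
    have := hρ.continuous
    fun_prop
  · obtain ⟨C, hC0, hC1, hC2⟩ := hψ.bounded
    obtain ⟨D, hD⟩ := hρ.continuous.bounded_above_of_compact_support hρc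
    obtain ⟨D', hD'⟩ := hρ'c.bounded_above_of_compact_support hρc.deriv
    have hD0 : 0 ≤ D := (norm_nonneg _).trans (hD 0)
    have hD0' : 0 ≤ D' := (norm_nonneg _).trans (hD' 0)
    have hadd : ∀ t τ, ‖ψ t + ψ τ‖ ≤ C + C := fun t τ =>
      (norm_add_le _ _).trans (add_le_add (hC1 t) (hC1 τ))
    refine ⟨2 * C * D + (C * D + 2 * C * D'), fun q => ⟨?_, ?_⟩⟩
    · rw [norm_mul]
      refine (mul_le_mul (hadd _ _) (hD _) (norm_nonneg _) (by linarith)).trans ?_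
      have : 0 ≤ C * D + 2 * C * D' := by positivity
      linarith
    · rw [hder]
      refine (norm_add_le _ _).trans ?_
      rw [norm_mul, norm_mul]
      have e1 := mul_le_mul (hC2 q.1) (hD (q.1 - q.2)) (norm_nonneg _) hC0
      have e2 := mul_le_mul (hadd q.1 q.2) (hD' (q.1 - q.2)) (norm_nonneg _) (by linarith)
      have : 0 ≤ 2 * C * D := by positivity
      rw [← Real.norm_eq_abs] at e1
      linarith

/-- The correlation equation tested with `(ψ(t) + ψ(τ)) ρ(t - τ)`, for an even approximate identity
`ρ`, in the variable `h = τ - t`. -/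
lemma EulerField.integral_mul_balance (hd : 1 ≤ d) (hw : EulerField Ω T w)
    (hk : IsSpaceTest k) (hke : ∀ z, k (-z) = k z) {ψ : ℝ → ℝ} (hψ : IsTimeTest T ψ) {ε : ℝ}
    (hε : Metric.cthickening ε (tsupport ψ) ⊆ Ioo 0 T) {ρ : ℝ → ℝ}
    (hρ : ContDiff ℝ ((⊤ : ℕ∞) : WithTop ℕ∞) ρ) (hρc : HasCompactSupport ρ)
    (hρe : ∀ h, ρ (-h) = ρ h) (hρε : ∀ h, ρ h ≠ 0 → |h| ≤ ε) :
    ∫ h, ρ h * (∫ t, balance Ω w k ψ t (t + h)) = 0 ∧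
      Integrable fun h => ρ h * (∫ t, balance Ω w k ψ t (t + h)) := by
  have hρd : Differentiable ℝ ρ := hρ.differentiable (by simp)
  have hψc := hψ.contDiff.continuous
  have hψ'c := hψ.continuous_deriv
  have hρ'c : Continuous (deriv ρ) := hρ.continuous_deriv (by simp)
  have hρ0 := hρ.continuous
  obtain ⟨C, hC0, hC1, hC2⟩ := hψ.bounded
  obtain ⟨D, hD⟩ := hρ.continuous.bounded_above_of_compact_support hρc
  obtain ⟨D', hD'⟩ := hρ'c.bounded_above_of_compact_support hρc.deriv
  have hD0 : 0 ≤ D := (norm_nonneg _).trans (hD 0)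
  have hadd : ∀ t τ, ‖ψ t + ψ τ‖ ≤ C + C := fun t τ =>
    (norm_add_le _ _).trans (add_le_add (hC1 t) (hC1 τ))
  have iF := hw.integrable_kernelCorr hk
  have iJ := hw.integrable_kernelFlux hk
  have i1 : Integrable fun q : ℝ × ℝ =>
      ((ψ q.1 + ψ q.2) * deriv ρ (q.1 - q.2)) * kernelCorr Ω k (w q.1) (w q.2) := by
    refine iF.bdd_mul (c := (C + C) * D') (Continuous.aestronglyMeasurable (by fun_prop))
      (Eventually.of_forall fun q => ?_)
    rw [norm_mul]
    exact mul_le_mul (hadd _ _) (hD' _) (norm_nonneg _) (by linarith)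
  have i2 : Integrable fun q : ℝ × ℝ =>
      (deriv ψ q.1 * ρ (q.1 - q.2)) * kernelCorr Ω k (w q.1) (w q.2) := by
    refine iF.bdd_mul (c := C * D) (Continuous.aestronglyMeasurable (by fun_prop))
      (Eventually.of_forall fun q => ?_)
    rw [norm_mul]
    exact mul_le_mul (hC2 _) (hD _) (norm_nonneg _) hC0
  have i3 : Integrable fun q : ℝ × ℝ =>
      ((ψ q.1 + ψ q.2) * ρ (q.1 - q.2)) * kernelFlux Ω k (w q.1) (w q.2) := by
    refine iJ.bdd_mul (c := (C + C) * D) (Continuous.aestronglyMeasurable (by fun_prop))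
      (Eventually.of_forall fun q => ?_)
    rw [norm_mul]
    exact mul_le_mul (hadd _ _) (hD _) (norm_nonneg _) (by linarith)
  -- The term with the odd kernel `ρ'` vanishes: both the correlation and the cutoff `ψ(t) + ψ(τ)`
  -- are symmetric in the two times.
  have hodd : ∀ h, deriv ρ (-h) = - deriv ρ h := fun h => by
    have e : (fun h => ρ (-h)) = ρ := funext hρe
    have := deriv_comp_neg ρ h
    rw [e] at this
    rw [this, neg_neg]
  have z1 : ∫ q : ℝ × ℝ,
      ((ψ q.1 + ψ q.2) * deriv ρ (q.1 - q.2)) * kernelCorr Ω k (w q.1) (w q.2) = 0 := by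
    have hsw := integral_prod_swap (μ := (volume : Measure ℝ)) (ν := (volume : Measure ℝ))
      (fun q : ℝ × ℝ =>
        ((ψ q.1 + ψ q.2) * deriv ρ (q.1 - q.2)) * kernelCorr Ω k (w q.1) (w q.2))
    have hneg : ∀ q : ℝ × ℝ, ((ψ q.swap.1 + ψ q.swap.2) * deriv ρ (q.swap.1 - q.swap.2))
        * kernelCorr Ω k (w q.swap.1) (w q.swap.2)
        = - (((ψ q.1 + ψ q.2) * deriv ρ (q.1 - q.2)) * kernelCorr Ω k (w q.1) (w q.2)) := fun q => by
      rw [Prod.fst_swap, Prod.snd_swap, (hw.spaceField q.2).kernelCorr_comm (hw.spaceField q.1) hke,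
        ← neg_sub q.1 q.2, hodd]
      ring
    simp only [hneg, integral_neg] at hsw
    rw [← Measure.volume_eq_prod] at hsw
    linarith
  have hmain := hw.integral_kernel_equation hd (hψ.isTwoTimeTest hε hρ hρc hρε) hk hke
  have e1 : ∀ q : ℝ × ℝ, deriv (fun t => (ψ t + ψ q.2) * ρ (t - q.2)) q.1
        * kernelCorr Ω k (w q.1) (w q.2)
        + (ψ q.1 + ψ q.2) * ρ (q.1 - q.2) * kernelFlux Ω k (w q.1) (w q.2)
      = ((ψ q.1 + ψ q.2) * deriv ρ (q.1 - q.2)) * kernelCorr Ω k (w q.1) (w q.2)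
        + ((deriv ψ q.1 * ρ (q.1 - q.2)) * kernelCorr Ω k (w q.1) (w q.2)
          + ((ψ q.1 + ψ q.2) * ρ (q.1 - q.2)) * kernelFlux Ω k (w q.1) (w q.2)) := fun q => by
    rw [(hasDerivAt_two_time hψ.differentiable hρd q.1 q.2).deriv]
    ring
  simp only [e1] at hmain
  rw [integral_add i1 (i2.fun_add i3), z1, zero_add] at hmain
  have e2 : ∀ q : ℝ × ℝ, (deriv ψ q.1 * ρ (q.1 - q.2)) * kernelCorr Ω k (w q.1) (w q.2)
          + ((ψ q.1 + ψ q.2) * ρ (q.1 - q.2)) * kernelFlux Ω k (w q.1) (w q.2)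
      = ρ (q.1 - q.2) * balance Ω w k ψ q.1 q.2 := fun q => by rw [balance]; ring
  have i4 := i2.fun_add i3
  simp only [e2] at hmain i4
  -- Change variables `τ = t + h`.
  have hmp := measurePreserving_prod_add (volume : Measure ℝ) (volume : Measure ℝ)
  have hemb := (MeasurableEquiv.shearAddRight ℝ).measurableEmbedding
  have e3 : ∀ q : ℝ × ℝ, ρ (q.1 - (q.1 + q.2)) = ρ q.2 := fun q => by
    rw [sub_add_cancel_left, hρe]
  have i5 := hmp.integrable_comp_of_integrable (g := fun q : ℝ × ℝ =>
    ρ (q.1 - q.2) * balance Ω w k ψ q.1 q.2) i4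
  have h5 := hmp.integral_comp hemb (fun q : ℝ × ℝ => ρ (q.1 - q.2) * balance Ω w k ψ q.1 q.2)
  rw [← Measure.volume_eq_prod, hmain] at h5
  simp only [Function.comp_def, e3] at i5 h5
  rw [Measure.volume_eq_prod, integral_prod_symm _ i5] at h5
  have i6 := i5.integral_prod_right
  simp only [integral_const_mul] at h5 i6
  exact ⟨h5, i6⟩

/-- The energy balance at the scale of the kernel: letting the two times coincide. -/
theorem EulerField.integral_balance_eq_zero (hd : 1 ≤ d) (hw : EulerField Ω T w)
    (hk : IsSpaceTest k) (hke : ∀ z, k (-z) = k z) {ψ : ℝ → ℝ} (hψ : IsTimeTest T ψ) :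
    ∫ t, balance Ω w k ψ t t = 0 := by
  obtain ⟨ε₀, hε₀, hsub⟩ := hψ.compact.isCompact.exists_cthickening_subset_open isOpen_Ioo hψ.subset
  have hlim := hw.tendsto_integral_balance hk hψ
  rw [← norm_eq_zero]
  refine le_antisymm (le_of_forall_pos_le_add fun ε hε => ?_) (norm_nonneg _)
  rw [zero_add]
  obtain ⟨δ, hδ, hball⟩ := Metric.tendsto_nhds_nhds.1 hlim ε hε
  set r := min ε₀ (δ / 2) with hr
  have hr0 : 0 < r := lt_min hε₀ (half_pos hδ)
  let f : ContDiffBump (0 : ℝ) := ⟨r / 2, r, half_pos hr0, half_lt_self hr0⟩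
  have hf1 : ∀ h, f.normed volume h ≠ 0 → |h| < r := fun h hh => by
    have : h ∈ Function.support (f.normed volume) := hh
    rw [f.support_normed_eq] at this
    simpa using this
  obtain ⟨h1, h2⟩ := hw.integral_mul_balance hd hk hke hψ hsub (ρ := f.normed volume)
    f.contDiff_normed f.hasCompactSupport_normed (fun h => f.normed_neg h)
    (fun h hh => (hf1 h hh).le.trans (min_le_left _ _))
  have h3 : ∫ h, f.normed volume h * (∫ t, balance Ω w k ψ t t) = ∫ t, balance Ω w k ψ t t := by
    rw [integral_mul_const, f.integral_normed, one_mul]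
  have hfi : Integrable fun h => f.normed volume h * (∫ t, balance Ω w k ψ t t) :=
    f.integrable_normed.mul_const _
  have h4 : ∫ t, balance Ω w k ψ t t = ∫ h, (f.normed volume h * (∫ t, balance Ω w k ψ t t)
      - f.normed volume h * ∫ t, balance Ω w k ψ t (t + h)) := by
    rw [integral_sub hfi h2, h3, h1, sub_zero]
  rw [h4]
  calc ‖∫ h, (f.normed volume h * (∫ t, balance Ω w k ψ t t)
        - f.normed volume h * ∫ t, balance Ω w k ψ t (t + h))‖
      ≤ ∫ h, f.normed volume h * ε := by
        refine norm_integral_le_of_norm_le (f.integrable_normed.mul_const ε)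
          (Eventually.of_forall fun h => ?_)
        rw [← mul_sub, norm_mul, Real.norm_of_nonneg (f.nonneg_normed h)]
        by_cases hh : f.normed volume h = 0
        · simp [hh]
        · refine mul_le_mul_of_nonneg_left ?_ (f.nonneg_normed h)
          have hlt : dist h 0 < δ := by
            rw [Real.dist_eq, sub_zero]
            have := hf1 h hh
            have := min_le_right ε₀ (δ / 2)
            linarith
          have := hball hlt
          rw [dist_comm, dist_eq_norm] at this
          exact this.le
    _ = ε := by rw [integral_mul_const, f.integral_normed, one_mul]

end

/-! ### Energy defect and flux in terms of increments -/

section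
variable {d : ℕ} {Ω : Domain} {T : ℝ} {w : ℝ → Space d → Space d} {k : Space d → ℝ}

/-- The `n`-th power of the increments of `u`, averaged with the weight `‖K‖`. -/
def incrementEnergy {G : Type*} [NormedAddCommGroup G] (Ω : Domain) (n : ℕ) (K : Space d → G)
    (u : Space d → Space d) : ℝ≥0∞ :=
  ∫⁻ z, ‖K z‖ₑ * ∫⁻ y, ‖u (y + z) - u y‖ₑ ^ n ∂(Ω.measure d)

lemma measurable_incrementEnergy {G : Type*} [NormedAddCommGroup G]
    (hw : StronglyMeasurable (Function.uncurry w)) (n : ℕ) {K : Space d → G} (hK : Continuous K) :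
    Measurable fun t => incrementEnergy Ω n K (w t) := by
  have m1 : StronglyMeasurable fun x : (ℝ × Space d) × Space d => w x.1.1 (x.2 + x.1.2) :=
    hw.comp_measurable (g := fun x : (ℝ × Space d) × Space d => (x.1.1, x.2 + x.1.2)) (by fun_prop)
  have m2 : StronglyMeasurable fun x : (ℝ × Space d) × Space d => w x.1.1 x.2 :=
    hw.comp_measurable (g := fun x : (ℝ × Space d) × Space d => (x.1.1, x.2)) (by fun_prop)
  have m3 : Measurable fun x : ℝ × Space d =>
      ∫⁻ y, ‖w x.1 (y + x.2) - w x.1 y‖ₑ ^ n ∂(Ω.measure d) :=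
    Measurable.lintegral_prod_right'
      (f := fun x : (ℝ × Space d) × Space d => ‖w x.1.1 (x.2 + x.1.2) - w x.1.1 x.2‖ₑ ^ n)
      ((m1.sub m2).measurable.enorm.pow_const n)
  have m4 : Measurable fun x : ℝ × Space d => ‖K x.2‖ₑ :=
    (continuous_enorm.comp (hK.comp continuous_snd)).measurable
  exact Measurable.lintegral_prod_right' (f := fun x : ℝ × Space d =>
    ‖K x.2‖ₑ * ∫⁻ y, ‖w x.1 (y + x.2) - w x.1 y‖ₑ ^ n ∂(Ω.measure d)) (m4.mul m3)

/-- For `z = 0` the left side vanishes, so that the bound holds although the Besov seminorm only sees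
nonzero increments. -/
lemma lintegral_increment_le {q : ℝ} {n : ℕ} (hn : 0 < n) (u : Space d → Space d) (z : Space d) :
    ∫⁻ y, ‖u (y + z) - u y‖ₑ ^ n ∂(Ω.measure d)
      ≤ (ENNReal.ofReal (‖z‖ ^ q) * besovNorm Ω q n u) ^ n := by
  have h := eLpNorm_sub_le_besovNorm (Ω := Ω) (θ := q) (q := (n : ℝ≥0∞)) (f := u) z
  rw [eLpNorm_eq_lintegral_rpow_enorm_toReal (by exact_mod_cast hn.ne')
    (ENNReal.natCast_ne_top n), ENNReal.toReal_natCast] at h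
  have h2 := pow_le_pow_left' h n
  rw [← ENNReal.rpow_natCast, ← ENNReal.rpow_mul, one_div_mul_cancel (by exact_mod_cast hn.ne'),
    ENNReal.rpow_one] at h2
  simpa only [ENNReal.rpow_natCast] using h2

/-- Increments over distances at most `ℓ` are controlled by the Besov norm. -/
lemma incrementEnergy_le {G : Type*} [NormedAddCommGroup G] {q ℓ : ℝ} (hq : 0 ≤ q) {n : ℕ}
    (hn : 0 < n) {K : Space d → G} (hKm : Measurable fun z => ‖K z‖ₑ)
    (hK : ∀ z, ℓ < ‖z‖ → K z = 0) (u : Space d → Space d) :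
    incrementEnergy Ω n K u
      ≤ (∫⁻ z, ‖K z‖ₑ) * ENNReal.ofReal (ℓ ^ q) ^ n * besovNorm Ω q n u ^ n := by
  rw [mul_assoc, ← mul_pow, ← lintegral_mul_const _ hKm]
  refine lintegral_mono fun z => ?_
  by_cases hz : ‖z‖ ≤ ℓ
  · refine mul_le_mul_right ((lintegral_increment_le (q := q) hn u z).trans
      (pow_le_pow_left' (mul_le_mul_left (ENNReal.ofReal_le_ofReal ?_) _) n)) _
    exact Real.rpow_le_rpow (norm_nonneg z) hz hq
  · rw [hK z (not_le.1 hz), enorm_zero, zero_mul]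
    exact zero_le

/-- The energy variation seen by `ψ`, estimated by quadratic increments where `ψ` varies and by cubic
increments through the flux. -/
lemma EulerField.enorm_integral_deriv_mul_lpEnergy_le (hd : 1 ≤ d) (hw : EulerField Ω T w)
    (hk : IsSpaceTest k) (hke : ∀ z, k (-z) = k z) (hk1 : ∫ z, k z = 1) {ψ : ℝ → ℝ}
    (hψ : IsTimeTest T ψ) :
    ‖∫ t in Ioo 0 T, deriv ψ t * lpEnergy Ω 2 (w t)‖ₑ
      ≤ (∫⁻ t in Ioo 0 T, ‖deriv ψ t‖ₑ * incrementEnergy Ω 2 k (w t))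
        + ∫⁻ t in Ioo 0 T, ‖ψ t‖ₑ * incrementEnergy Ω 3 (fderiv ℝ k) (w t) := by
  have hbal := hw.integral_balance_eq_zero hd hk hke hψ
  have hout : ∀ t ∉ Ioo 0 T, balance Ω w k ψ t t = 0 := fun t ht => by
    simp only [balance, hw.eq_zero t ht, kernelCorr_zero_left, kernelFlux_zero_left, mul_zero,
      add_zero]
  rw [← setIntegral_eq_integral_of_forall_compl_eq_zero hout] at hbal
  obtain ⟨C, hC0, hC1, hC2⟩ := hψ.bounded
  have i1 : Integrable (fun t => deriv ψ t * lpEnergy Ω 2 (w t)) (timeMeasure T) :=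
    (hw.integrable_lpEnergy (Or.inl rfl)).bdd_mul hψ.continuous_deriv.aestronglyMeasurable
      (Eventually.of_forall hC2)
  have i2 : Integrable (fun t => balance Ω w k ψ t t) (timeMeasure T) :=
    (hw.integrable_balance_diag hk hψ).integrableOn
  have e : ∫ t in Ioo 0 T, deriv ψ t * lpEnergy Ω 2 (w t)
      = ∫ t in Ioo 0 T, (deriv ψ t * lpEnergy Ω 2 (w t) - balance Ω w k ψ t t) := by
    rw [integral_sub i1 i2, hbal, sub_zero]
  rw [e, ← lintegral_add_left' (by
    exact (hψ.continuous_deriv.enorm.measurable.mul (measurable_incrementEnergy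
      hw.stronglyMeasurable 2 hk.contDiff.continuous)).aemeasurable)]
  refine (enorm_integral_le_lintegral_enorm _).trans (lintegral_mono_ae ?_)
  filter_upwards [ae_restrict_of_ae (hw.incompressible k hk)] with t ht
  have hu := hw.spaceField t
  have hF := hu.integral_mul_corr2_self hk hk1
  have hJ := hu.integral_fderiv_corr3_self hk hke ht
  have hdiff : deriv ψ t * lpEnergy Ω 2 (w t) - balance Ω w k ψ t t
      = deriv ψ t * (1 / 2 * ∫ z, k z * ∫ y, ‖w t (y + z) - w t y‖ ^ 2 ∂(Ω.measure d))
        + ψ t * (1 / 2 * ∫ x : Space d × Space d,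
          fderiv ℝ k x.1 (‖w t (x.2 + x.1) - w t x.2‖ ^ 2 • (w t (x.2 + x.1) - w t x.2))
          ∂(volume.prod (Ω.measure d))) := by
    rw [balance, kernelCorr, kernelFlux, hF, hJ]
    ring
  have hhalf : ∀ r : ℝ, ‖1 / 2 * r‖ₑ ≤ ‖r‖ₑ := fun r => by
    rw [← ofReal_norm, ← ofReal_norm, norm_mul]
    refine ENNReal.ofReal_le_ofReal ?_
    have := norm_nonneg r
    rw [Real.norm_of_nonneg (by norm_num : (0 : ℝ) ≤ 1 / 2)]
    linarith
  rw [hdiff]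
  refine (enorm_add_le _ _).trans (add_le_add ?_ ?_)
  · rw [enorm_mul]
    refine mul_le_mul_right ((hhalf _).trans ((enorm_integral_le_lintegral_enorm _).trans
      (lintegral_mono fun z => ?_))) _
    rw [enorm_mul]
    refine mul_le_mul_right ((enorm_integral_le_lintegral_enorm _).trans
      (lintegral_mono fun y => ?_)) _
    rw [enorm_pow, enorm_norm]
  · rw [enorm_mul]
    refine mul_le_mul_right ((hhalf _).trans ((enorm_integral_le_lintegral_enorm _).trans ?_)) _
    have m1 : StronglyMeasurable fun x : Space d × Space d => w t (x.2 + x.1) :=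
      hu.stronglyMeasurable.comp_measurable (g := fun x : Space d × Space d => x.2 + x.1)
        (by fun_prop)
    have m2 : StronglyMeasurable fun x : Space d × Space d => w t x.2 :=
      hu.stronglyMeasurable.comp_measurable measurable_snd
    have m3 : Measurable fun x : Space d × Space d => ‖fderiv ℝ k x.1‖ₑ :=
      (hk.fderiv.contDiff.continuous.comp continuous_fst).enorm.measurable
    have m4 : Measurable fun x : Space d × Space d =>
        ‖fderiv ℝ k x.1‖ₑ * ‖w t (x.2 + x.1) - w t x.2‖ₑ ^ 3 :=
      m3.mul ((m1.sub m2).measurable.enorm.pow_const 3)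
    calc _ ≤ ∫⁻ x : Space d × Space d, ‖fderiv ℝ k x.1‖ₑ * ‖w t (x.2 + x.1) - w t x.2‖ₑ ^ 3
          ∂(volume.prod (Ω.measure d)) := by
          refine lintegral_mono fun x => ?_
          refine (ContinuousLinearMap.le_opENorm _ _).trans (mul_le_mul_right (le_of_eq ?_) _)
          rw [enorm_smul, enorm_pow, enorm_norm]
          ring
      _ = incrementEnergy Ω 3 (fderiv ℝ k) (w t) := by
          rw [lintegral_prod _ m4.aemeasurable]
          refine lintegral_congr fun z => ?_
          have m5 : Measurable fun y => ‖w t (y + z) - w t y‖ₑ ^ 3 :=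
            ((hu.translate_stronglyMeasurable z).sub
              hu.stronglyMeasurable).measurable.enorm.pow_const 3
          exact lintegral_const_mul ‖fderiv ℝ k z‖ₑ m5

/-- Hölder's inequality in time, for a measurable function dominated by the power `q` of a function
whose measurability is not known. -/
lemma setLIntegral_le_of_le_rpow {ν : Measure ℝ} {X B : ℝ → ℝ≥0∞} (hX : Measurable X)
    {M : ℝ≥0∞} (hM0 : M ≠ 0) (hM : M ≠ ⊤) {n : ℕ} (hn : 0 < n)
    (h : ∀ᵐ t ∂ν, X t ≤ M * B t ^ n) {r : ℝ≥0∞} (hr : (n : ℝ≥0∞) ≤ r) (A : Set ℝ) :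
    ∫⁻ t in A, X t ∂ν ≤ M * (eLpNorm B r ν ^ n * ν A ^ (1 - n / r.toReal)) := by
  have hn0 : (n : ℝ) ≠ 0 := by exact_mod_cast hn.ne'
  have hf : Measurable fun t => (M⁻¹ * X t) ^ ((n : ℝ)⁻¹) := (hX.const_mul _).pow_const _
  have hpow : ∀ t, ((M⁻¹ * X t) ^ ((n : ℝ)⁻¹)) ^ (n : ℝ) = M⁻¹ * X t := fun t => by
    rw [← ENNReal.rpow_mul, inv_mul_cancel₀ hn0, ENNReal.rpow_one]
  have hfB : ∀ᵐ t ∂ν, (M⁻¹ * X t) ^ ((n : ℝ)⁻¹) ≤ B t := by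
    filter_upwards [h] with t ht
    have h1 : M⁻¹ * X t ≤ B t ^ (n : ℝ) := by
      rw [ENNReal.rpow_natCast]
      calc M⁻¹ * X t ≤ M⁻¹ * (M * B t ^ n) := mul_le_mul_right ht _
        _ = B t ^ n := by rw [← mul_assoc, ENNReal.inv_mul_cancel hM0 hM, one_mul]
    calc (M⁻¹ * X t) ^ ((n : ℝ)⁻¹) ≤ (B t ^ (n : ℝ)) ^ ((n : ℝ)⁻¹) :=
          ENNReal.rpow_le_rpow h1 (by positivity)
      _ = B t := by rw [← ENNReal.rpow_mul, mul_inv_cancel₀ hn0, ENNReal.rpow_one]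
  have := setLIntegral_rpow_le_of_le hf hfB (q := n) (by exact_mod_cast hn)
    (by simpa using hr) A
  simp only [hpow, ENNReal.rpow_natCast] at this
  rw [lintegral_const_mul _ hX] at this
  calc ∫⁻ t in A, X t ∂ν = M * (M⁻¹ * ∫⁻ t in A, X t ∂ν) := by
        rw [← mul_assoc, ENNReal.mul_inv_cancel hM0 hM, one_mul]
    _ ≤ _ := mul_le_mul_right this _

end

/-! ### Kernels and time cutoffs at a given scale -/

/-- An even, nonnegative, normalized smooth kernel `k` supported in the ball of radius `ℓ`, with
`‖∇k‖_{L¹} ≤ C / ℓ`. -/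
structure IsScaleKernel {E : Type*} [NormedAddCommGroup E] [NormedSpace ℝ E] [MeasurableSpace E]
    (μ : Measure E) (C ℓ : ℝ) (k : E → ℝ) : Prop where
  contDiff : ContDiff ℝ ((⊤ : ℕ∞) : WithTop ℕ∞) k
  compact : HasCompactSupport k
  nonneg : ∀ z, 0 ≤ k z
  even : ∀ z, k (-z) = k z
  integral : ∫ z, k z ∂μ = 1
  eq_zero : ∀ z, ℓ ≤ ‖z‖ → k z = 0
  integral_fderiv : ∫ z, ‖fderiv ℝ k z‖ ∂μ ≤ C / ℓ

/-- Dilations of one bump function. They are only scaled by `ℓ`, so the constant `C` does not depend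
on it. -/
lemma exists_scaleKernel {E : Type*} [NormedAddCommGroup E] [InnerProductSpace ℝ E]
    [FiniteDimensional ℝ E] [MeasurableSpace E] [BorelSpace E] (μ : Measure E)
    [μ.IsAddHaarMeasure] :
    ∃ C > 0, ∀ ℓ > 0, ∃ k : E → ℝ, IsScaleKernel μ C ℓ k := by
  let f : ContDiffBump (0 : E) := ⟨1 / 2, 1, by norm_num, by norm_num⟩
  set g : E → ℝ := f.normed μ with hg
  have hgs : ContDiff ℝ ((⊤ : ℕ∞) : WithTop ℕ∞) g := f.contDiff_normed
  have hgd : Differentiable ℝ g := hgs.differentiable (by simp)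
  have hg0 : 0 ≤ ∫ z, ‖fderiv ℝ g z‖ ∂μ := integral_nonneg fun _ => norm_nonneg _
  refine ⟨(∫ z, ‖fderiv ℝ g z‖ ∂μ) + 1, by positivity, fun ℓ hℓ => ?_⟩
  set n := Module.finrank ℝ E with hn
  have hℓn : (ℓ ^ n) ≠ 0 := by positivity
  have hder : ∀ z, fderiv ℝ (fun z => (ℓ ^ n)⁻¹ * g (ℓ⁻¹ • z)) z
      = (ℓ ^ n)⁻¹ • (ℓ⁻¹ • fderiv ℝ g (ℓ⁻¹ • z)) := fun z => by
    have h1 : HasFDerivAt (fun z : E => ℓ⁻¹ • z) (ℓ⁻¹ • ContinuousLinearMap.id ℝ E) z :=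
      (hasFDerivAt_id z).const_smul ℓ⁻¹
    have h2 := ((hgd (ℓ⁻¹ • z)).hasFDerivAt.comp z h1).const_mul ((ℓ ^ n)⁻¹)
    rw [show (fun z => (ℓ ^ n)⁻¹ * g (ℓ⁻¹ • z)) = fun z => (ℓ ^ n)⁻¹ * (g ∘ fun z => ℓ⁻¹ • z) z
      from rfl, h2.fderiv]
    ext x
    simp
  refine ⟨fun z => (ℓ ^ n)⁻¹ * g (ℓ⁻¹ • z), ?_, ?_, ?_, ?_, ?_, ?_, ?_⟩
  · exact contDiff_const.mul (hgs.comp (contDiff_const.smul contDiff_id))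
  · exact (f.hasCompactSupport_normed.comp_smul (inv_ne_zero hℓ.ne')).mul_left
  · exact fun z => mul_nonneg (by positivity) (f.nonneg_normed _)
  · intro z
    rw [smul_neg, hg, f.normed_neg]
  · rw [integral_const_mul, Measure.integral_comp_inv_smul, f.integral_normed, smul_eq_mul, mul_one,
      abs_of_pos (by positivity), inv_mul_cancel₀ hℓn]
  · intro z hz
    have : ℓ⁻¹ • z ∉ Function.support g := by
      rw [hg, f.support_normed_eq, mem_ball_zero_iff, norm_smul, Real.norm_of_nonneg (by positivity),
        not_lt]
      rw [inv_mul_eq_div, le_div_iff₀ hℓ]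
      simpa [f] using hz
    rw [Function.notMem_support.1 this, mul_zero]
  · simp only [hder, norm_smul]
    rw [integral_const_mul, integral_const_mul,
      Measure.integral_comp_inv_smul μ (fun z => ‖fderiv ℝ g z‖), smul_eq_mul,
      Real.norm_of_nonneg (by positivity), Real.norm_of_nonneg (by positivity),
      abs_of_pos (by positivity)]
    rw [le_div_iff₀ hℓ]
    have : (ℓ ^ n)⁻¹ * (ℓ⁻¹ * (ℓ ^ n * ∫ z, ‖fderiv ℝ g z‖ ∂μ)) * ℓ = ∫ z, ‖fderiv ℝ g z‖ ∂μ := by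
      field_simp
    rw [this]
    linarith

lemma IsScaleKernel.integrable_fderiv {E : Type*} [NormedAddCommGroup E] [NormedSpace ℝ E]
    [MeasurableSpace E] [BorelSpace E] {μ : Measure E} [IsFiniteMeasureOnCompacts μ]
    {C ℓ : ℝ} {k : E → ℝ}
    (hk : IsScaleKernel μ C ℓ k) : Integrable (fderiv ℝ k) μ :=
  (hk.contDiff.continuous_fderiv (by simp)).integrable_of_hasCompactSupport (hk.compact.fderiv ℝ)

lemma IsScaleKernel.lintegral_fderiv_le {E : Type*} [NormedAddCommGroup E] [NormedSpace ℝ E]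
    [MeasurableSpace E] [BorelSpace E] {μ : Measure E} [IsFiniteMeasureOnCompacts μ]
    {C ℓ : ℝ} {k : E → ℝ}
    (hk : IsScaleKernel μ C ℓ k) : ∫⁻ z, ‖fderiv ℝ k z‖ₑ ∂μ ≤ ENNReal.ofReal (C / ℓ) := by
  rw [← ofReal_integral_norm_eq_lintegral_enorm hk.integrable_fderiv]
  exact ENNReal.ofReal_le_ofReal hk.integral_fderiv

lemma IsScaleKernel.lintegral_enorm {E : Type*} [NormedAddCommGroup E] [NormedSpace ℝ E]
    [MeasurableSpace E] [BorelSpace E] {μ : Measure E} [IsFiniteMeasureOnCompacts μ]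
    {C ℓ : ℝ} {k : E → ℝ}
    (hk : IsScaleKernel μ C ℓ k) : ∫⁻ z, ‖k z‖ₑ ∂μ = 1 := by
  rw [← ofReal_integral_norm_eq_lintegral_enorm
    (hk.contDiff.continuous.integrable_of_hasCompactSupport hk.compact)]
  simp only [Real.norm_of_nonneg (hk.nonneg _), hk.integral, ENNReal.ofReal_one]

/-- A smooth function of time which is `1` near `S`, vanishes outside the `δ`-neighbourhood of `S`,
and has derivative of size `1 / δ`. -/
lemma exists_time_cutoff : ∃ C > 0, ∀ (S : Set ℝ), ∀ δ > 0, ∃ χ : ℝ → ℝ,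
    ContDiff ℝ ((⊤ : ℕ∞) : WithTop ℕ∞) χ ∧ (∀ t, |χ t| ≤ 1) ∧ (∀ t, |deriv χ t| ≤ C / δ) ∧
    (∀ t ∈ Metric.thickening (δ / 4) S, χ t = 1) ∧ ∀ t ∉ Metric.cthickening δ S, χ t = 0 := by
  obtain ⟨C, hC, hker⟩ := exists_scaleKernel (volume : Measure ℝ)
  -- The indicator function of the `δ/2`-neighbourhood, mollified at scale `δ/4`, is `1` on the
  -- `δ/4`-neighbourhood and `0` off the `3δ/4`-neighbourhood.
  refine ⟨4 * C, by positivity, fun S δ hδ => ?_⟩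
  obtain ⟨k, hk⟩ := hker (δ / 4) (by positivity)
  set A := Metric.cthickening (δ / 2) S with hA
  set a : ℝ → ℝ := A.indicator 1 with ha
  have hAm : MeasurableSet A := Metric.isClosed_cthickening.measurableSet
  have ha1 : ∀ s, ‖a s‖ ≤ 1 := fun s => by
    rw [ha]
    exact (norm_indicator_le_norm_self _ _).trans (by simp)
  have hai : LocallyIntegrable a :=
    (locallyIntegrable_const (1 : ℝ)).mono
      ((measurable_const.indicator hAm).aestronglyMeasurable)
      (Eventually.of_forall fun s => by simpa using ha1 s)
  set L := ContinuousLinearMap.mul ℝ ℝ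
  have hbd : ∀ g : ℝ → ℝ, Integrable g → ∀ t, ‖convolution a g L volume t‖ ≤ ∫ s, ‖g s‖ :=
    fun g hg t => by
    rw [← integral_sub_left_eq_self (fun s => ‖g s‖) volume t]
    refine norm_integral_le_of_norm_le (hg.norm.comp_sub_left t)
      (Eventually.of_forall fun s => ?_)
    rw [ContinuousLinearMap.mul_apply', norm_mul]
    exact mul_le_of_le_one_left (norm_nonneg _) (ha1 s)
  have hki : Integrable k := hk.contDiff.continuous.integrable_of_hasCompactSupport hk.compact
  refine ⟨convolution a k L volume, ?_, fun t => ?_, fun t => ?_, fun t ht => ?_, fun t ht => ?_⟩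
  · exact hk.compact.contDiff_convolution_right L hai hk.contDiff
  · have := hbd k hki t
    simpa only [Real.norm_of_nonneg (hk.nonneg _), hk.integral, Real.norm_eq_abs] using this
  · rw [(hk.compact.hasDerivAt_convolution_right L hai (hk.contDiff.of_le (by simp)) t).deriv]
    have hdi : Integrable (deriv k) :=
      (hk.contDiff.continuous_deriv (by simp)).integrable_of_hasCompactSupport hk.compact.deriv
    refine (hbd _ hdi t).trans ?_
    simp only [norm_deriv_eq_norm_fderiv]
    refine hk.integral_fderiv.trans (le_of_eq ?_)
    field_simp
  · rw [convolution_def]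
    have : ∀ s, L (a s) (k (t - s)) = k (t - s) := fun s => by
      by_cases hs : s ∈ A
      · simp [L, ha, hs]
      · have hk0 : k (t - s) = 0 := by
          refine hk.eq_zero _ (not_lt.1 fun hlt => hs ?_)
          obtain ⟨x, hx, hdx⟩ := Metric.mem_thickening_iff.1 ht
          refine Metric.mem_cthickening_of_dist_le s x _ _ hx ?_
          have h1 := dist_triangle s t x
          rw [dist_comm s t, dist_eq_norm t s] at h1
          linarith
        simp [hk0]
    simp only [this]
    rw [integral_sub_left_eq_self k volume t, hk.integral]
  · rw [convolution_def]
    refine integral_eq_zero_of_ae (Eventually.of_forall fun s => ?_)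
    by_cases hs : s ∈ A
    · have hk0 : k (t - s) = 0 := by
        refine hk.eq_zero _ (not_lt.1 fun hlt => ht ?_)
        obtain ⟨x, hx, hdx⟩ := Metric.mem_thickening_iff.1
          (Metric.cthickening_subset_thickening' (by positivity) (by linarith : δ / 2 < 3 * δ / 4) S
            hs)
        refine Metric.mem_cthickening_of_dist_le t x _ _ hx ?_
        have h1 := dist_triangle t s x
        rw [dist_eq_norm t s] at h1
        linarith
      simp [hk0]
    · simp [ha, hs]

/-! ### The energy estimate near a set of times -/

/-- For `p = ∞` the quotient `3 / p.toReal` is `3 / 0 = 0`, the intended value. -/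
lemma holderGap_eq {p : ℝ≥0∞} (hp : 3 ≤ p) : holderGap p = 1 - 3 / p.toReal := by
  rw [holderGap]
  split_ifs with h
  · simp [h]
  · have h3 : (3 : ℝ) ≤ p.toReal := by
      simpa using (ENNReal.toReal_le_toReal (by norm_num) h).2 hp
    rw [sub_div, div_self (by linarith)]

/-- Hölder's inequality for the square of a function in `L^{2p/3}` gives the same exponent as for the
cube of a function in `L^p`. -/
lemma holderGap_eq_two {p : ℝ≥0∞} (hp : 3 ≤ p) : holderGap p = 1 - 2 / (2 * p / 3).toReal := by
  rw [holderGap_eq hp]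
  by_cases h : p = ⊤
  · simp [h]
  · have h3 : (3 : ℝ) ≤ p.toReal := by
      simpa using (ENNReal.toReal_le_toReal (by norm_num) h).2 hp
    have hpos : p.toReal ≠ 0 := by linarith
    simp only [ENNReal.toReal_div, ENNReal.toReal_mul, ENNReal.toReal_ofNat]
    field_simp

lemma holderGap_nonneg {p : ℝ≥0∞} (hp : 3 ≤ p) : 0 ≤ holderGap p := by
  rw [holderGap]
  split_ifs with h
  · exact zero_le_one
  · have h3 : (3 : ℝ) ≤ p.toReal := by
      simpa using (ENNReal.toReal_le_toReal (by norm_num) h).2 hp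
    exact div_nonneg (by linarith) (by linarith)

section
variable {d : ℕ} {Ω : Domain} {T : ℝ} {w : ℝ → Space d → Space d} {k : Space d → ℝ}

lemma IsScaleKernel.fderiv_eq_zero {C ℓ : ℝ} (hk : IsScaleKernel (volume : Measure (Space d)) C ℓ k)
    (z : Space d) (hz : ℓ < ‖z‖) : fderiv ℝ k z = 0 :=
  fderiv_eq_zero_of_radius (fun x hx => hk.eq_zero x hx.le) z hz

lemma setLIntegral_mul_le {ν : Measure ℝ} {g : ℝ → ℝ} {X : ℝ → ℝ≥0∞} {A : Set ℝ}
    (hA : MeasurableSet A) (hgA : ∀ t ∉ A, g t = 0) {c : ℝ} (hc : ∀ t, |g t| ≤ c)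
    (hX : Measurable X) :
    ∫⁻ t, ‖g t‖ₑ * X t ∂ν ≤ ENNReal.ofReal c * ∫⁻ t in A, X t ∂ν := by
  rw [← lintegral_const_mul _ hX, ← lintegral_indicator hA]
  refine lintegral_mono fun t => ?_
  by_cases ht : t ∈ A
  · rw [indicator_of_mem ht]
    refine mul_le_mul_left ?_ _
    rw [← ofReal_norm]
    exact ENNReal.ofReal_le_ofReal (hc t)
  · rw [hgA t ht, enorm_zero, zero_mul]
    exact zero_le

/-- The energy variation seen by a test function `ψ` carried by a set `A` of times, estimated with
a regularization at scale `ℓ`. -/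
lemma EulerField.enorm_integral_deriv_mul_lpEnergy_le_besov (hd : 1 ≤ d) (hw : EulerField Ω T w)
    {p : ℝ≥0∞} (hp : 3 ≤ p) {θ β : ℝ} (hθ : 0 ≤ θ) (hβ : 0 ≤ β) {C ℓ : ℝ} (hC : 0 < C) (hℓ : 0 < ℓ)
    (hk : IsScaleKernel volume C ℓ k) {ψ : ℝ → ℝ} (hψ : IsTimeTest T ψ) {A : Set ℝ}
    (hA : MeasurableSet A) (hψA : ∀ t ∉ A, ψ t = 0) (hψA' : ∀ t ∉ A, deriv ψ t = 0) {c c' : ℝ}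
    (hc : ∀ t, |ψ t| ≤ c) (hc' : ∀ t, |deriv ψ t| ≤ c') :
    ‖∫ t in Ioo 0 T, deriv ψ t * lpEnergy Ω 2 (w t)‖ₑ
      ≤ ENNReal.ofReal c' * (ENNReal.ofReal (ℓ ^ β) ^ 2
          * (eLpNorm (fun t => besovNorm Ω β 2 (w t)) (2 * p / 3) (timeMeasure T) ^ 2
            * volume A ^ holderGap p))
        + ENNReal.ofReal c * (ENNReal.ofReal (C / ℓ) * ENNReal.ofReal (ℓ ^ θ) ^ 3
          * (eLpNorm (fun t => besovNorm Ω θ 3 (w t)) p (timeMeasure T) ^ 3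
            * volume A ^ holderGap p)) := by
  have hks : IsSpaceTest k := ⟨hk.contDiff, hk.compact⟩
  have hνA : timeMeasure T A ^ holderGap p ≤ volume A ^ holderGap p :=
    ENNReal.rpow_le_rpow (Measure.restrict_le_self A) (holderGap_nonneg hp)
  have hX2 := measurable_incrementEnergy (Ω := Ω) hw.stronglyMeasurable 2 hks.contDiff.continuous
  have hX3 := measurable_incrementEnergy (Ω := Ω) hw.stronglyMeasurable 3
    hks.fderiv.contDiff.continuous
  have hr2 : ((2 : ℕ) : ℝ≥0∞) ≤ 2 * p / 3 := by
    rw [ENNReal.le_div_iff_mul_le (by simp) (by simp)]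
    simpa using mul_le_mul_right hp 2
  have hr3 : ((3 : ℕ) : ℝ≥0∞) ≤ p := by simpa using hp
  have b2 : ∀ t, incrementEnergy Ω 2 k (w t)
      ≤ ENNReal.ofReal (ℓ ^ β) ^ 2 * besovNorm Ω β (2 : ℕ) (w t) ^ 2 := fun t => by
    have := incrementEnergy_le (Ω := Ω) hβ two_pos (K := k) hk.contDiff.continuous.enorm.measurable
      (fun z hz => hk.eq_zero z hz.le) (w t)
    rwa [hk.lintegral_enorm, one_mul] at this
  have b3 : ∀ t, incrementEnergy Ω 3 (fderiv ℝ k) (w t)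
      ≤ ENNReal.ofReal (C / ℓ) * ENNReal.ofReal (ℓ ^ θ) ^ 3 * besovNorm Ω θ (3 : ℕ) (w t) ^ 3 :=
    fun t => by
    refine (incrementEnergy_le (Ω := Ω) hθ three_pos (K := fderiv ℝ k)
      hks.fderiv.contDiff.continuous.enorm.measurable hk.fderiv_eq_zero (w t)).trans ?_
    exact mul_le_mul_left (mul_le_mul_left hk.lintegral_fderiv_le _) _
  have pos : ∀ r : ℝ, 0 < r → ENNReal.ofReal r ≠ 0 := fun r hr => (ENNReal.ofReal_pos.2 hr).ne'
  have h2 := setLIntegral_le_of_le_rpow (ν := timeMeasure T) hX2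
    (pow_ne_zero 2 (pos _ (Real.rpow_pos_of_pos hℓ β))) (by finiteness) two_pos
    (Eventually.of_forall b2) hr2 A
  have h3 := setLIntegral_le_of_le_rpow (ν := timeMeasure T) hX3
    (mul_ne_zero (pos _ (div_pos hC hℓ)) (pow_ne_zero 3 (pos _ (Real.rpow_pos_of_pos hℓ θ))))
    (by finiteness) three_pos (Eventually.of_forall b3) hr3 A
  simp only [Nat.cast_ofNat] at h2 h3
  rw [← holderGap_eq_two hp] at h2
  rw [← holderGap_eq hp] at h3
  refine (hw.enorm_integral_deriv_mul_lpEnergy_le hd hks hk.even hk.integral hψ).trans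
    (add_le_add ?_ ?_)
  · refine (setLIntegral_mul_le hA hψA' hc' hX2).trans (mul_le_mul_right (h2.trans ?_) _)
    exact mul_le_mul_right (mul_le_mul_right hνA _) _
  · refine (setLIntegral_mul_le hA hψA hc hX3).trans (mul_le_mul_right (h3.trans ?_) _)
    exact mul_le_mul_right (mul_le_mul_right hνA _) _

/-- The optimal choice `ℓ = δ ^ (1 / (1 - 3 θ + 2 β))` balances the cutoff and the flux terms. -/
lemma balanced_scale {θ β : ℝ} (hD : 0 < 1 - 3 * θ + 2 * β) {δ : ℝ} (hδ : 0 < δ) :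
    δ⁻¹ * ((δ ^ (1 / (1 - 3 * θ + 2 * β))) ^ β) ^ 2
      = δ ^ (-((1 - 3 * θ) / (1 - 3 * θ + 2 * β))) ∧
    (δ ^ (1 / (1 - 3 * θ + 2 * β)))⁻¹ * ((δ ^ (1 / (1 - 3 * θ + 2 * β))) ^ θ) ^ 3
      = δ ^ (-((1 - 3 * θ) / (1 - 3 * θ + 2 * β))) := by
  constructor
  · rw [← Real.rpow_natCast, ← Real.rpow_mul hδ.le, ← Real.rpow_mul hδ.le, ← Real.rpow_neg_one,
      ← Real.rpow_add hδ]
    congr 1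
    push_cast
    field_simp
    ring
  · rw [← Real.rpow_natCast, ← Real.rpow_mul hδ.le, ← Real.rpow_mul hδ.le, ← Real.rpow_neg hδ.le,
      ← Real.rpow_add hδ]
    congr 1
    push_cast
    field_simp
    ring

end

/-! ### Conservation across a set of times of small dimension -/

lemma eventually_volume_cthickening_le {S : Set ℝ} {s : ℝ} (hs : upperMinkowskiContent s S = 0) :
    ∀ᶠ δ : ℝ in 𝓝[>] 0, volume (Metric.cthickening δ S) ≤ ENNReal.ofReal (δ ^ (1 - s)) := by
  have h := eventually_lt_of_limsup_lt (lt_of_eq_of_lt hs one_pos)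
  filter_upwards [h, self_mem_nhdsWithin] with δ hδ hpos
  have hp : 0 < ENNReal.ofReal (δ ^ (1 - s)) :=
    ENNReal.ofReal_pos.2 (Real.rpow_pos_of_pos hpos _)
  have := (ENNReal.div_le_iff hp.ne' ENNReal.ofReal_ne_top).1 hδ.le
  rwa [one_mul] at this

/-- The content in the exponent `2` of a bounded set vanishes, since its neighbourhoods have bounded
measure. In particular the set of exponents of vanishing content is nonempty. -/
lemma upperMinkowskiContent_two {T : ℝ} {S : Set ℝ} (hS : S ⊆ Ioo 0 T) :
    upperMinkowskiContent 2 S = 0 := by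
  have hb : Bornology.IsBounded S := Metric.isBounded_Ioo 0 T |>.subset hS
  have hfin : volume (Metric.cthickening 1 S) ≠ ⊤ :=
    (hb.cthickening (δ := 1)).measure_lt_top.ne
  refine Tendsto.limsup_eq ?_
  have hlim : Tendsto (fun δ : ℝ => volume (Metric.cthickening 1 S) * ENNReal.ofReal δ) (𝓝[>] 0)
      (𝓝 0) := by
    have h1 : Tendsto (fun δ : ℝ => ENNReal.ofReal δ) (𝓝[>] 0) (𝓝 0) := by
      have := (ENNReal.continuous_ofReal.tendsto 0).mono_left
        (nhdsWithin_le_nhds (s := Ioi (0 : ℝ)))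
      rwa [ENNReal.ofReal_zero] at this
    simpa using ENNReal.Tendsto.const_mul h1 (Or.inr hfin)
  refine tendsto_of_tendsto_of_tendsto_of_le_of_le' tendsto_const_nhds hlim
    (Eventually.of_forall fun _ => zero_le) ?_
  filter_upwards [Ioo_mem_nhdsGT (one_pos : (0 : ℝ) < 1)] with δ hδ
  have e : ENNReal.ofReal (δ ^ ((1 : ℝ) - 2)) = (ENNReal.ofReal δ)⁻¹ := by
    rw [show (1 : ℝ) - 2 = -1 by norm_num, Real.rpow_neg_one, ENNReal.ofReal_inv_of_pos hδ.1]
  rw [e, div_eq_mul_inv, inv_inv]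
  exact mul_le_mul_left (measure_mono (Metric.cthickening_mono hδ.2.le S)) _

/-- The energy variation against `φ` is only seen on arbitrarily small neighbourhoods of the set
outside of which the solution is conservative. -/
lemma integral_kineticEnergy_mul_cutoff {d : ℕ} {Ω : Domain} {T : ℝ} {v : ℝ → Space d → Space d}
    {S U : Set ℝ} (hcons : IsConservativeOn Ω v (Ioo 0 T \ S))
    (hint : Integrable (kineticEnergy Ω v) (timeMeasure T)) {φ χ : ℝ → ℝ} (hφ : IsTimeTest T φ)
    (hχ : ContDiff ℝ ((⊤ : ℕ∞) : WithTop ℕ∞) χ) (hU : IsOpen U) (hSU : S ⊆ U)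
    (hχU : ∀ t ∈ U, χ t = 1) :
    ∫ t in Ioo 0 T, kineticEnergy Ω v t * deriv φ t
      = ∫ t in Ioo 0 T, kineticEnergy Ω v t * deriv (fun t => φ t * χ t) t := by
  have hφd := hφ.differentiable
  have hχd : Differentiable ℝ χ := hχ.differentiable (by simp)
  have hψ : IsTimeTest T (fun t => φ t * χ t) :=
    ⟨hφ.contDiff.mul hχ, hφ.compact.mul_right, (tsupport_mul_subset_left).trans hφ.subset⟩
  set ζ : ℝ → ℝ := fun t => φ t * (1 - χ t) with hζ
  have hζc : ContDiff ℝ ((⊤ : ℕ∞) : WithTop ℕ∞) ζ := hφ.contDiff.mul (contDiff_const.sub hχ)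
  have hζsupp : tsupport ζ ⊆ Ioo 0 T \ S := by
    intro t ht
    refine ⟨hφ.subset (tsupport_mul_subset_left ht), fun htS => ?_⟩
    have : tsupport ζ ⊆ Uᶜ := closure_minimal (fun x hx hxU => hx (by simp [hζ, hχU x hxU]))
      hU.isClosed_compl
    exact this ht (hSU htS)
  have h0 := hcons ζ hζc hφ.compact.mul_right hζsupp
  rw [neg_eq_zero] at h0
  have h1 : ∫ t in Ioo 0 T, kineticEnergy Ω v t * deriv ζ t = 0 := by
    refine Eq.trans (setIntegral_eq_of_subset_of_forall_sdiff_eq_zero measurableSet_Ioo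
      sdiff_subset fun t ht => ?_) h0
    have : t ∉ tsupport ζ := fun h => ht.2 (hζsupp h)
    rw [deriv_eq_zero_of_notMem_tsupport this, mul_zero]
  have hζt : IsTimeTest T ζ := ⟨hζc, hφ.compact.mul_right, hζsupp.trans sdiff_subset⟩
  have hmul : ∀ {f : ℝ → ℝ}, IsTimeTest T f →
      Integrable (fun t => kineticEnergy Ω v t * deriv f t) (timeMeasure T) := fun hf => by
    obtain ⟨C, -, -, hC⟩ := hf.bounded
    exact hint.mul_bdd hf.continuous_deriv.aestronglyMeasurable (Eventually.of_forall hC)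
  have hder : ∀ t, deriv φ t = deriv ζ t + deriv (fun t => φ t * χ t) t := fun t => by
    have hsum : φ = fun t => ζ t + φ t * χ t := by
      funext t; simp only [hζ]; ring
    conv_lhs => rw [hsum]
    exact deriv_fun_add (hζt.differentiable t) (hψ.differentiable t)
  simp only [hder, mul_add]
  rw [integral_add (hmul hζt) (hmul hψ), h1, zero_add]

/-- A solution which is conservative outside `S` is conservative, if `S` has vanishing Minkowski
content in an exponent `s` satisfying the strict inequality `hlt`: the energy variation is at most a
constant times `δ ^ (holderGap p * (1 - s) - (1 - 3 * θ) / (1 - 3 * θ + 2 * β))`, for all small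
`δ`. -/
theorem isConservative_of_content_eq_zero {Ω : Domain} {d : ℕ} (hd : 1 ≤ d) {T : ℝ}
    {p : ℝ≥0∞} (hp : 3 ≤ p) {θ : ℝ} (hθ : θ ∈ Ioo (0 : ℝ) (1 / 3)) {β : ℝ} (hβ : 0 < β)
    {v : ℝ → Space d → Space d} (hv3 : MemLpBesov Ω T p θ 3 v)
    (hv2 : MemLpBesov Ω T (2 * p / 3) β 2 v) (hv : IsWeakEulerSolution Ω T v) {S : Set ℝ} {s : ℝ}
    (hs : upperMinkowskiContent s S = 0)
    (hlt : (1 - 3 * θ) / (1 - 3 * θ + 2 * β) < holderGap p * (1 - s))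
    (hcons : IsConservativeOn Ω v (Ioo 0 T \ S)) : IsConservative Ω T v := by
  intro φ hφ hφc hφs
  have hφt : IsTimeTest T φ := ⟨hφ, hφc, hφs⟩
  obtain ⟨w, hw, hvw⟩ := exists_eulerField hp hv3 hv2 hv
  have hac : Ω.measure d ≪ volume := Measure.restrict_le_self.absolutelyContinuous
  have hkin : kineticEnergy Ω v =ᵐ[timeMeasure T] fun t => (1 / 2) * lpEnergy Ω 2 (w t) := by
    filter_upwards [hvw] with t ht
    rw [kineticEnergy, lpEnergy]
    congr 1
    exact integral_congr_ae ((hac.ae_eq ht).mono fun x hx => by simp only [hx])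
  have hkint : Integrable (kineticEnergy Ω v) (timeMeasure T) :=
    ((hw.integrable_lpEnergy (Or.inl rfl)).const_mul _).congr hkin.symm
  have hN : ∀ {q : ℝ} {n r : ℝ≥0∞}, MemLpBesov Ω T r q n v →
      eLpNorm (fun t => besovNorm Ω q n (w t)) r (timeMeasure T) ≠ ⊤ := fun h => by
    refine ne_of_lt (lt_of_eq_of_lt (eLpNorm_congr_ae ?_) h.norm_lt_top)
    filter_upwards [hvw] with t ht
    exact besovNorm_congr ht.symm
  have hN2 := hN hv2
  have hN3 := hN hv3
  set N2 := eLpNorm (fun t => besovNorm Ω β 2 (w t)) (2 * p / 3) (timeMeasure T)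
  set N3 := eLpNorm (fun t => besovNorm Ω θ 3 (w t)) p (timeMeasure T)
  obtain ⟨C, hC, hker⟩ := exists_scaleKernel (volume : Measure (Space d))
  obtain ⟨C', hC', hcut⟩ := exists_time_cutoff
  obtain ⟨M, hM0, hM1, hM2⟩ := hφt.bounded
  have hD : 0 < 1 - 3 * θ + 2 * β := by linarith [hθ.2]
  have hg := holderGap_nonneg hp
  set D := 1 - 3 * θ + 2 * β with hDdef
  set g := holderGap p with hgdef
  set e := g * (1 - s) - (1 - 3 * θ) / D with he
  have he0 : 0 < e := by rw [he]; linarith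
  set I := ∫ t in Ioo 0 T, kineticEnergy Ω v t * deriv φ t with hI
  -- The estimate at a fixed distance `δ` from `S`.
  have hest : ∀ᶠ δ : ℝ in 𝓝[>] 0, ‖I‖ₑ
      ≤ (ENNReal.ofReal (M + M * C') * N2 ^ 2 + ENNReal.ofReal (M * C) * N3 ^ 3)
        * ENNReal.ofReal (δ ^ e) := by
    filter_upwards [eventually_volume_cthickening_le hs, Ioo_mem_nhdsGT (one_pos : (0 : ℝ) < 1)]
      with δ hvol hδ
    obtain ⟨hδ0, hδ1⟩ := hδ
    obtain ⟨χ, hχ, hχ1, hχ', hχU, hχA⟩ := hcut S δ hδ0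
    have hψ : IsTimeTest T (fun t => φ t * χ t) :=
      ⟨hφ.mul hχ, hφc.mul_right, (tsupport_mul_subset_left).trans hφs⟩
    set ℓ := δ ^ (1 / D) with hℓ
    have hℓ0 : 0 < ℓ := Real.rpow_pos_of_pos hδ0 _
    obtain ⟨k, hk⟩ := hker ℓ hℓ0
    have hχd : Differentiable ℝ χ := hχ.differentiable (by simp)
    have hψ0 : ∀ t ∉ Metric.cthickening δ S, φ t * χ t = 0 := fun t ht => by
      rw [hχA t ht, mul_zero]
    have hψ0' : ∀ t ∉ Metric.cthickening δ S, deriv (fun t => φ t * χ t) t = 0 := fun t ht => by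
      refine deriv_eq_zero_of_notMem_tsupport fun h => ht ?_
      refine closure_minimal (fun x hx => ?_) Metric.isClosed_cthickening h
      by_contra hxA
      exact hx (hψ0 x hxA)
    have hc : ∀ t, |φ t * χ t| ≤ M := fun t => by
      rw [abs_mul]
      exact (mul_le_mul (hM1 t) (hχ1 t) (abs_nonneg _) hM0).trans (mul_one M).le
    have hc' : ∀ t, |deriv (fun t => φ t * χ t) t| ≤ (M + M * C') * δ⁻¹ := fun t => by
      rw [deriv_fun_mul (hφt.differentiable t) (hχd t)]
      refine (abs_add_le _ _).trans ?_
      rw [abs_mul, abs_mul]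
      have e1 := mul_le_mul (hM2 t) (hχ1 t) (abs_nonneg _) hM0
      have e2 := mul_le_mul (hM1 t) (hχ' t) (abs_nonneg _) hM0
      have e3 : M * 1 ≤ M * δ⁻¹ := mul_le_mul_of_nonneg_left ((one_le_inv₀ hδ0).2 hδ1.le) hM0
      calc _ ≤ M * 1 + M * (C' / δ) := add_le_add e1 e2
        _ ≤ M * δ⁻¹ + M * (C' / δ) := by linarith
        _ = (M + M * C') * δ⁻¹ := by ring
    have hmain := hw.enorm_integral_deriv_mul_lpEnergy_le_besov hd hp hθ.1.le hβ.le hC hℓ0 hk hψ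
      (Metric.isClosed_cthickening (δ := δ) (E := S)).measurableSet hψ0 hψ0' hc hc'
    have hIeq : I = 1 / 2 * ∫ t in Ioo 0 T, deriv (fun t => φ t * χ t) t * lpEnergy Ω 2 (w t) := by
      rw [hI, integral_kineticEnergy_mul_cutoff hcons hkint hφt hχ Metric.isOpen_thickening
        (Metric.self_subset_thickening (by positivity) S) hχU, ← integral_const_mul]
      refine integral_congr_ae ?_
      filter_upwards [hkin] with t ht
      rw [ht]
      ring
    have hIle : ‖I‖ₑ ≤ ‖∫ t in Ioo 0 T, deriv (fun t => φ t * χ t) t * lpEnergy Ω 2 (w t)‖ₑ := by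
      rw [hIeq, ← ofReal_norm, ← ofReal_norm, norm_mul]
      refine ENNReal.ofReal_le_ofReal (mul_le_of_le_one_left (norm_nonneg _) ?_)
      norm_num
    have hV : volume (Metric.cthickening δ S) ^ g ≤ ENNReal.ofReal (δ ^ (g * (1 - s))) := by
      refine (ENNReal.rpow_le_rpow hvol hg).trans (le_of_eq ?_)
      rw [ENNReal.ofReal_rpow_of_pos (Real.rpow_pos_of_pos hδ0 _), ← Real.rpow_mul hδ0.le, mul_comm]
    obtain ⟨s1, s2⟩ := balanced_scale hD hδ0
    rw [← hDdef, ← hℓ] at s1 s2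
    have hδe : δ ^ (-((1 - 3 * θ) / D)) * δ ^ (g * (1 - s)) = δ ^ e := by
      rw [← Real.rpow_add hδ0, he]
      congr 1
      ring
    have r0 : ∀ a : ℝ, 0 ≤ δ ^ a := fun a => Real.rpow_nonneg hδ0.le a
    have rℓ : ∀ a : ℝ, 0 ≤ ℓ ^ a := fun a => Real.rpow_nonneg hℓ0.le a
    have hMC : 0 ≤ M + M * C' := by positivity
    refine (hIle.trans hmain).trans ?_
    rw [add_mul (ENNReal.ofReal (M + M * C') * N2 ^ 2)]
    refine add_le_add ?_ ?_
    · calc ENNReal.ofReal ((M + M * C') * δ⁻¹) * (ENNReal.ofReal (ℓ ^ β) ^ 2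
            * (N2 ^ 2 * volume (Metric.cthickening δ S) ^ g))
          ≤ ENNReal.ofReal ((M + M * C') * δ⁻¹) * (ENNReal.ofReal (ℓ ^ β) ^ 2
            * (N2 ^ 2 * ENNReal.ofReal (δ ^ (g * (1 - s))))) := by gcongr
        _ = N2 ^ 2 * ENNReal.ofReal ((M + M * C') * δ⁻¹ * (ℓ ^ β) ^ 2 * δ ^ (g * (1 - s))) := by
          rw [ENNReal.ofReal_mul (p := (M + M * C') * δ⁻¹ * (ℓ ^ β) ^ 2) (by positivity),
            ENNReal.ofReal_mul (p := (M + M * C') * δ⁻¹) (by positivity), ENNReal.ofReal_pow (rℓ β)]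
          ring
        _ = ENNReal.ofReal (M + M * C') * N2 ^ 2 * ENNReal.ofReal (δ ^ e) := by
          rw [mul_assoc (M + M * C'), s1, mul_assoc, hδe, ENNReal.ofReal_mul hMC]
          ring
    · calc ENNReal.ofReal M * (ENNReal.ofReal (C / ℓ) * ENNReal.ofReal (ℓ ^ θ) ^ 3
            * (N3 ^ 3 * volume (Metric.cthickening δ S) ^ g))
          ≤ ENNReal.ofReal M * (ENNReal.ofReal (C / ℓ) * ENNReal.ofReal (ℓ ^ θ) ^ 3
            * (N3 ^ 3 * ENNReal.ofReal (δ ^ (g * (1 - s))))) := by gcongr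
        _ = N3 ^ 3 * ENNReal.ofReal (M * (C / ℓ) * (ℓ ^ θ) ^ 3 * δ ^ (g * (1 - s))) := by
          rw [ENNReal.ofReal_mul (p := M * (C / ℓ) * (ℓ ^ θ) ^ 3) (by positivity),
            ENNReal.ofReal_mul (p := M * (C / ℓ)) (by positivity), ENNReal.ofReal_mul hM0,
            ENNReal.ofReal_pow (rℓ θ)]
          ring
        _ = ENNReal.ofReal (M * C) * N3 ^ 3 * ENNReal.ofReal (δ ^ e) := by
          rw [show M * (C / ℓ) * (ℓ ^ θ) ^ 3 = M * C * (ℓ⁻¹ * (ℓ ^ θ) ^ 3) by ring, s2, mul_assoc,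
            hδe, ENNReal.ofReal_mul (by positivity)]
          ring
  have hlim : Tendsto (fun δ : ℝ =>
      (ENNReal.ofReal (M + M * C') * N2 ^ 2 + ENNReal.ofReal (M * C) * N3 ^ 3)
        * ENNReal.ofReal (δ ^ e)) (𝓝[>] 0) (𝓝 0) := by
    have h1 : Tendsto (fun δ : ℝ => ENNReal.ofReal (δ ^ e)) (𝓝[>] 0) (𝓝 0) := by
      have h2 : Tendsto (fun δ : ℝ => δ ^ e) (𝓝[>] 0) (𝓝 0) := by
        have := (Real.continuousAt_rpow_const 0 e (Or.inr he0.le)).tendsto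
        rw [Real.zero_rpow he0.ne'] at this
        exact this.mono_left nhdsWithin_le_nhds
      simpa using ENNReal.tendsto_ofReal h2
    have hfin : ENNReal.ofReal (M + M * C') * N2 ^ 2 + ENNReal.ofReal (M * C) * N3 ^ 3 ≠ ⊤ := by
      finiteness
    simpa using ENNReal.Tendsto.const_mul h1 (Or.inr hfin)
  have hzero : ‖I‖ₑ ≤ 0 := ge_of_tendsto hlim hest
  rw [neg_eq_zero]
  exact enorm_eq_zero.1 (le_antisymm hzero zero_le)

end EulerTime

end

open EulerTime
theorem corollary2p4 (Ω : EulerTime.Domain) (d : ℕ) (hd : 2 ≤ d) (T : ℝ) (hT : 0 < T)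
    (p : ℝ≥0∞) (hp : 3 ≤ p) (θ : ℝ) (hθ : θ ∈ Ioo (0 : ℝ) (1 / 3))
    (β : ℝ) (hβ : β ∈ Ioo (0 : ℝ) 1)
    (v : ℝ → Space d → Space d)
    (hv3 : MemLpBesov Ω T p θ 3 v) (hv2 : MemLpBesov Ω T (2 * p / 3) β 2 v)
    (hv : IsWeakEulerSolution Ω T v) (hnc : ¬ IsConservative Ω T v)
    (S : Set ℝ) (hS : S ⊆ Ioo 0 T)
    (hS_closed : IsClosed ((↑) ⁻¹' S : Set (Ioo (0 : ℝ) T)))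
    (γ : ℝ) (hγ : upperMinkowskiDim S = γ) (hγ1 : γ < 1)
    (hcons : IsConservativeOn Ω v (Ioo 0 T \ S)) :
    (3 < p → 1 - holderConj p * (1 - 2 * β / (1 - 3 * θ + 2 * β)) ≤ γ) ∧
      2 * β / (1 - 3 * θ + 2 * β) ≤ 1 - holderGap p * (1 - γ) := by
  have hD : 0 < 1 - 3 * θ + 2 * β := by linarith [hθ.2, hβ.1]
  have hκ : 1 - 2 * β / (1 - 3 * θ + 2 * β) = (1 - 3 * θ) / (1 - 3 * θ + 2 * β) := by
    field_simp
    ring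
  have hg := holderGap_nonneg hp
  have key : 2 * β / (1 - 3 * θ + 2 * β) ≤ 1 - holderGap p * (1 - γ) := by
    by_contra! hcon
    have hpos : 0 < (1 - 3 * θ) / (1 - 3 * θ + 2 * β) := div_pos (by linarith [hθ.2]) hD
    have hlt : (1 - 3 * θ) / (1 - 3 * θ + 2 * β) < holderGap p * (1 - γ) := by linarith
    have hg0 : 0 < holderGap p := by
      refine lt_of_le_of_ne hg fun h => ?_
      rw [← h, zero_mul] at hlt
      linarith
    have hγlt : γ < 1 - (1 - 3 * θ) / (1 - 3 * θ + 2 * β) / holderGap p := by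
      have := (div_lt_iff₀' hg0).2 hlt
      linarith
    -- The infimum defining the dimension is over a nonempty set, so it is approached.
    obtain ⟨s, ⟨-, hs⟩, hsγ⟩ := exists_lt_of_csInf_lt
      (s := {s : ℝ | 0 ≤ s ∧ upperMinkowskiContent s S = 0})
      ⟨2, zero_le_two, upperMinkowskiContent_two hS⟩ (lt_of_eq_of_lt hγ hγlt)
    refine hnc (isConservative_of_content_eq_zero (by omega) hp hθ hβ.1 hv3 hv2 hv hs ?_ hcons)
    have : (1 - 3 * θ) / (1 - 3 * θ + 2 * β) / holderGap p < 1 - s := by linarith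
    exact (div_lt_iff₀' hg0).1 this
  refine ⟨fun hp3 => ?_, key⟩
  have hg0 : 0 < holderGap p ∧ holderConj p = (holderGap p)⁻¹ := by
    rw [holderGap, holderConj]
    split_ifs with h
    · simp
    · have h3 : (3 : ℝ) < p.toReal := by
        simpa using (ENNReal.toReal_lt_toReal (by norm_num) h).2 hp3
      exact ⟨div_pos (by linarith) (by linarith), (inv_div _ _).symm⟩
  have h1 : holderGap p * (1 - γ) ≤ 1 - 2 * β / (1 - 3 * θ + 2 * β) := by linarith
  have h2 := (le_div_iff₀' hg0.1).2 h1
  rw [hg0.2, ← div_eq_inv_mul]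
  linarith
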